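/- **Setting.** Let $T\ge 1$ be an integer, $\gamma_0,\dots,\gamma_{T-1}\ge 0$, and let $N=(N_l)_{0\le l\le T}$ be a process on a probability space $(\Omega,\mathcal A,\mathbb Q)$ with $N_0=0$ and independent Poisson($\gamma_l$) increments $N_{l+1}-N_l$. Let $\mathfrak F=(\mathfrak F_k)$ be the augmented natural filtration of $N$, $\mathbb E_k=\mathbb E[\,\cdot\mid\mathfrak F_k]$, $\mathbb Q_k=\mathbb Q[\,\cdot\mid\mathfrak F_k]$, and $I_k=(-1)^{N_k}$ (so $I_0=1$). Infima over subsets of $\{0,1,\dots\}$ are $+\infty$ for the empty set, and $0/0:=0$. All equalities between random variables, and all statements that a random variable is constant on an event, are meant almost surely. *Fair model.* $P_k(l)=\mathbb Q_k(I_l=-1)$. $Q_k=\operatorname{ess\,sup}_\tau\mathbb E_k\sum_{l=k+1}^T(\mathbf 1_{I_l=-1}-\mathbf 1_{I_l=1})\mathbf 1_{l\le\tau}$, over the stopping times $\tau$ with values in $\{k,\dots,T\}$; $\tau^k=\inf\{l\ge k: Q_l=0\}\wedge T$; $A_k(l)=\mathbb E_k[\mathbf 1_{I_l=-1}\mathbf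 1_{l\le\tau^k}]/P_k(l)$ and $B_k(l)=\mathbb E_k[\mathbf 1_{I_l=1}\mathbf 1_{l\le\tau^k}]/(1-P_k(l))$. With $u_l=\frac12(1+e^{-2\gamma_{l-1}})$ and $v_l=\frac12(1-e^{-2\gamma_{l-1}})$, the fair pricing function $Q(\cdot,\cdot)$ on $\{0,\dots,T\}\times\{1,-1\}$ is given by $Q(T,\pm1)=0$ and, for $k<T$, $Q(k,-1)=e^{-2\gamma_k}+v_{k+1}Q(k+1,1)+u_{k+1}Q(k+1,-1)$, $Q(k,1)=\max(0,-e^{-2\gamma_k}+u_{k+1}Q(k+1,1)+v_{k+1}Q(k+1,-1))$. *Trader's model at time $k$.* The regime $(i^k_l)_{k\le l\le T}$ starts from $i^k_k=I_k$; the state $-1$ is absorbing; if $I_k=1$, then $i^k_l=1$ if $n^k_l=0$ and $i^k_l=-1$ if $n^k_l\ge1$, where $n^k_k=0$ and the increments $n^k_{l+1}-n^k_l$ are independent Poisson($\nu^k_l$), with $\nu^k$ calibrated on $\{I_k=1\}$ by $1-e^{-\sum_{j=k}^{l-1}\nu^k_j}=P_k(l)$, $k<l\le T$. For $l\ge k$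 and $i=\pm1$, $q^k(l,i)$ is the supremum over stopping rules $\theta\in\{l,\dots,T\}$ of the expectation, in this model started from state $i$ at time $l$, of $\sum_{j=l+1}^T(\mathbf 1_{i_j=-1}-\mathbf 1_{i_j=1})\mathbf 1_{j\le\theta}$. Put $q_k=q^k(k,I_k)$ and $\theta^k=\inf\{l\ge k:q^k(l,i^k_l)=0\}\wedge T$. With the expectation in the trader's model at time $k$, $a_k(l)=\mathbb E[\mathbf 1_{i^k_l=-1}\mathbf 1_{l\le\theta^k}]/P_k(l)$ and $b_k(l)=\mathbb E[\mathbf 1_{i^k_l=1}\mathbf 1_{l\le\theta^k}]/(1-P_k(l))$. *Not-so-bad trader.* $\tau_s=\inf\{k:I_k=-1\}\wedge T$, $\theta^\star=\inf\{k<\tau_s:q_k=0\}\wedge\tau_s$, $\tau_e=\theta^\star$ if $\theta^\star<\tau_s$ and $\tau_e=\tau^{\tau_s}=\inf\{k\ge\tau_s:Q_k=0\}\wedge T$ otherwise; $J^s_k=\mathbf 1_{k<\tau_s}$, $J^e_k=\mathbf 1_{k<\tau_e}$. Further, - $\mathcal Q_k=\sum_{l=1}^k(\mathbf 1_{I_l=-1}-\mathbf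 1_{I_l=1})\mathbf 1_{l\le\tau_e}$; - $P^{bad}_k=\mathbb E_k\sum_{l=k+1}^T(a_0(l)\mathbf 1_{I_l=-1}-b_0(l)\mathbf 1_{I_l=1})$; - $\mathcal P^{nsb}_k=\sum_{l=1}^{k\wedge\tau_s}(a_0(l)\mathbf 1_{I_l=-1}-b_0(l)\mathbf 1_{I_l=1})+(1-J^s_k)(1-J^s_{\tau_e})\sum_{l=\tau_s}^k(A_{\tau_s}(l)\mathbf 1_{I_l=-1}-B_{\tau_s}(l)\mathbf 1_{I_l=1})$; - $P^{nsb}_k=\mathbb E_k[\mathcal P^{nsb}_{\tau_e}-\mathcal P^{nsb}_k+P^{nsb}_{\tau_e}]$ on $\{k\le\tau_e\}$, where $P^{nsb}_{\tau_e}=J^s_{\tau_e}P^{bad}_{\tau_e}+(1-J^s_{\tau_e})\,\mathbb E_{\tau_e}\sum_{l=\tau_e+1}^T(A_{\tau_s}(l)\mathbf 1_{I_l=-1}-B_{\tau_s}(l)\mathbf 1_{I_l=1})$; - with $s=k\wedge\tau_e$, $pnl_k=\mathcal Q_s+J^s_sq_s+(1-J^s_s)Q_s-(\mathcal P^{nsb}_s+J^s_sP^{bad}_s+(1-J^s_s)P^{nsb}_s)-(1-J^e_k)(J^s_{\tau_e}q_{\tau_e}+(1-J^s_{\tau_e})Q_{\tau_e})$;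 - $\mathrm{HVA}_k=pnl_k-\mathbb E_k[pnl_T]$; - $D_k=\mathbb E_k[J^s_{\theta^\star}(Q_{\theta^\star}-(P^{nsb}_{\theta^\star}-P^{bad}_{\theta^\star}))]$; - $K$ is the predictable process with $K_0=0$ such that $\sum_{l\le\cdot}(\mathbf 1_{I_l=-1}-\mathbf 1_{I_l=1})+Q+K$ is a martingale, and $va(K^{\tau_e})_k=\mathbb E_k[K_{\tau_e}-K_{k\wedge\tau_e}]$. *Risk.* Fix $\alpha\in(\frac12,1)$ and $r>0$. For a random variable $X$ with law $\rho$, the expected shortfall is $\mathbb{ES}(X)=\mathbb E[X\mid X\ge \mathrm{VaR}(X)]$, with $\mathrm{VaR}(X)=\inf\{x:\rho((-\infty,x])\ge\alpha\}$; $\mathbb{ES}_k(X)$ is the expected shortfall of the regular conditional law of $X$ given $\mathfrak F_k$. Write $k^+=(k+1)\wedge T$, $L_k=\mathrm{HVA}_{k^+}-\mathrm{HVA}_k-(pnl_{k^+}-pnl_k)$, and $\mathrm{KVA}_k=r\,\mathbb E_k\sum_{l=k}^{T-1}e^{-r(l-k)}\mathbb{ES}_l(L_l)$. *Partition.* $\mathcal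 I$ is the set of pairs $(l,m)$ with $1\le l<m\le T+1$ or $l=m=T+1$. $\Omega_{l,m}$ is the event that $I_j=1$ for $j<l$, $I_j=-1$ for $l\le j<m$ and $I_m=1$ if $m\le T$ (with $0\le j\le T$ throughout). **Proposition.** Assume $Q(k,1)=0$ for all $0\le k\le T$. Then, for every $0\le k\le T$: **(i)** With $s=k\wedge\tau_e$ and $s^+=(k+1)\wedge\tau_e$, $$pnl_k=\mathcal Q_s+J^s_sq_s+(1-J^s_s)Q_s-\big(\mathcal P^{nsb}_s+J^s_sP^{bad}_s+(1-J^s_s)P^{nsb}_s\big),$$ $$\mathrm{HVA}_k=J^s_s\big(q_s-Q_s-(P^{bad}_s-P^{nsb}_s)\big)+D_k+va(K^{\tau_e})_k,\qquad va(K^{\tau_e})_k=\mathcal Q_s+Q_s-\mathbb E_k[\mathcal Q_{\tau_e}+Q_{\tau_e}],$$ $$\mathrm{HVA}_0=q_0-Q_0-(P^{bad}_0-P^{nsb}_0)+D_0+va(K^{\tau_e})_0,$$ $$-pnl_k+\mathrm{HVA}_k-\mathrm{HVA}_0=-(\mathcal Q_s+Q_s)+\mathcal P^{nsb}_s+P^{nsb}_s+(Q_0-P^{nsb}_0)+D_k+va(K^{\tau_e})_k-(D_0+va(K^{\tau_e})_0),$$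 $$L_k=-(\mathcal Q_{s^+}+Q_{s^+})+\mathcal P^{nsb}_{s^+}+P^{nsb}_{s^+}+(\mathcal Q_s+Q_s)-\mathcal P^{nsb}_s-P^{nsb}_s+D_{k^+}+va(K^{\tau_e})_{k^+}-D_k-va(K^{\tau_e})_k.$$ **(ii)** $pnl_k$, $\mathrm{HVA}_k$, $\mathrm{HVA}_k-\mathrm{HVA}_0-pnl_k$ and $L_k$ are constant on each $\Omega_{l,m}$, $(l,m)\in\mathcal I$. Writing $X(\Omega_{l,m})$ for the constant value of $X$ on $\Omega_{l,m}$, $$\mathrm{HVA}_k(\Omega_{l,m})=pnl_k(\Omega_{l,m})-\sum_{(\lambda,\mu)\in\mathcal I}pnl_T(\Omega_{\lambda,\mu})\,\mathbb Q_k[\Omega_{\lambda,\mu}](\Omega_{l,m}).$$ The values can be computed from the following. First, $Q_k=Q(k,I_k)$. Second, on $\{I_k=1\}$, $q_k=q^k(k,1)$, where $q^k(T,1)=0$ and, for $k\le l<T$, $q^k(l,1)=\max\big(0,e^{-\nu^k_l}(-1+q^k(l+1,1))+(1-e^{-\nu^k_l})(1+T-l-1)\big)$, with $\nu^k$ calibrated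 to $P_k(l)=\frac12(1-e^{-2\sum_{j=k}^{l-1}\gamma_j})$. Third, the $\mathbb Q_k[\Omega_{\lambda,\mu}]$, $(\lambda,\mu)\in\mathcal I$, are constant on each $\Omega_{l,m}$, with value $$\big(\mathbf 1_{k<l\wedge\lambda}+\mathbf 1_{k\ge l\wedge\lambda}\mathbf 1_{l=\lambda}(\mathbf 1_{k<m\wedge\mu}+\mathbf 1_{k\ge m\wedge\mu}\mathbf 1_{m=\mu})\big)\Big(\mathbf 1_{k\ge\mu}+\mathbf 1_{\lambda\le k<\mu}\prod_{r=k+1}^{\mu-1}u_r\,v_\mu+\mathbf 1_{k<\lambda}\prod_{r=k+1}^{\lambda-1}u_r\,v_\lambda\prod_{r=\lambda+1}^{\mu-1}u_r\,v_\mu\Big)$$ if $\lambda<\mu\le T$, $$\big(\mathbf 1_{k<l\wedge\lambda}+\mathbf 1_{k\ge l\wedge\lambda}\mathbf 1_{l=\lambda}\mathbf 1_{k<m}\big)\Big(\mathbf 1_{k\ge\lambda}\prod_{r=k+1}^{T}u_r+\mathbf 1_{k<\lambda}\prod_{r=k+1}^{\lambda-1}u_r\,v_\lambda\prod_{r=\lambda+1}^{T}u_r\Big)$$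 if $\lambda\le T$ and $\mu=T+1$, and $\mathbf 1_{k<l}\prod_{r=k+1}^Tu_r$ if $\lambda=\mu=T+1$. **(iii)** $\mathbb{ES}_k(L_k)$ is constant on each $\Omega_{l,m}$, where it is the expected shortfall of a random variable worth $L_k(\Omega_{\lambda,\mu})$ with probability $\mathbb Q_k[\Omega_{\lambda,\mu}](\Omega_{l,m})$, $(\lambda,\mu)\in\mathcal I$. Moreover, $$\mathrm{KVA}_0=r\sum_{l=0}^{T-1}e^{-rl}\sum_{(\lambda,\mu)\in\mathcal I}\mathbb{ES}_l(L_l)(\Omega_{\lambda,\mu})\,\mathbb Q[\Omega_{\lambda,\mu}].$$ -/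

import Mathlib

open MeasureTheory ProbabilityTheory Filter
open scoped NNReal ENNReal

noncomputable section

namespace RangeAccrual

/-! ### Regime indicators and the partition indices -/

/-- Indicator of the extreme regime `-1`. -/
def dn (i : ℤ) : ℝ := if i = -1 then 1 else 0

/-- Indicator of the normal regime `1`. -/
def up (i : ℤ) : ℝ := if i = 1 then 1 else 0

/-- `u_l`, the probability that a Poisson variable with parameter `γ_{l-1}` is even. -/
def evenProb (γ : ℕ → ℝ≥0) (l : ℕ) : ℝ := (1 + Real.exp (-2 * (γ (l - 1) : ℝ))) / 2

/-- `v_l`, the probability that a Poisson variable with parameter `γ_{l-1}` is odd. -/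
def oddProb (γ : ℕ → ℝ≥0) (l : ℕ) : ℝ := (1 - Real.exp (-2 * (γ (l - 1) : ℝ))) / 2

/-- The index pairs `(l, m)` with `1 ≤ l < m ≤ T + 1`, or `(l, m) = (T + 1, T + 1)`. -/
def indexSet (T : ℕ) : Finset (ℕ × ℕ) :=
  (Finset.Icc 1 (T + 1) ×ˢ Finset.Icc 1 (T + 1)).filter
    (fun p => p.1 < p.2 ∨ p = (T + 1, T + 1))

/-- The explicit weight of the partition event with indices `q = (lam, mu)`, given the information at
time `k`, on the partition event with indices `p = (l, m)`. -/
def transProb (γ : ℕ → ℝ≥0) (T k : ℕ) (p q : ℕ × ℕ) : ℝ :=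
  let u := evenProb γ
  let v := oddProb γ
  let l := p.1
  let m := p.2
  let lam := q.1
  let mu := q.2
  if lam = T + 1 then
    if k < l then ∏ r ∈ Finset.Icc (k + 1) T, u r else 0
  else if mu = T + 1 then
    if k < min l lam ∨ (min l lam ≤ k ∧ l = lam ∧ k < m) then
      if lam ≤ k then ∏ r ∈ Finset.Icc (k + 1) T, u r
      else (∏ r ∈ Finset.Ico (k + 1) lam, u r) * v lam * ∏ r ∈ Finset.Icc (lam + 1) T, u r
    else 0
  else
    if k < min l lam ∨ (min l lam ≤ k ∧ l = lam ∧ (k < min m mu ∨ (min m mu ≤ k ∧ m = mu))) then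
      if mu ≤ k then 1
      else if lam ≤ k then (∏ r ∈ Finset.Ico (k + 1) mu, u r) * v mu
      else (∏ r ∈ Finset.Ico (k + 1) lam, u r) * v lam *
        (∏ r ∈ Finset.Ico (lam + 1) mu, u r) * v mu
    else 0

/-! ### Pricing functions given by dynamic programming -/

/-- The fair pricing function `Q(k, i)` of the callable asset. -/
def fairFn (γ : ℕ → ℝ≥0) (T k : ℕ) (i : ℤ) : ℝ :=
  if k < T then
    if i = 1 then
      max 0 (-Real.exp (-2 * (γ k : ℝ)) + evenProb γ (k + 1) * fairFn γ T (k + 1) 1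
        + oddProb γ (k + 1) * fairFn γ T (k + 1) (-1))
    else
      Real.exp (-2 * (γ k : ℝ)) + oddProb γ (k + 1) * fairFn γ T (k + 1) 1
        + evenProb γ (k + 1) * fairFn γ T (k + 1) (-1)
  else 0
termination_by T - k

/-- The pricing function at date `l` and in the regime `1`, of the callable asset in the
trader's model with intensities `ν` (in the absorbing regime `-1` it is `T - l`). -/
def traderFn (ν : ℕ → ℝ) (T l : ℕ) : ℝ :=
  if l < T then
    max 0 (Real.exp (-ν l) * (-1 + traderFn ν T (l + 1))
      + (1 - Real.exp (-ν l)) * (1 + ((T : ℝ) - ((l : ℝ) + 1))))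
  else 0
termination_by T - l

/-- The fair price at time `k`, in the regime `1`, of the binary option paying in the
extreme regime at time `l`. -/
def normalPrice (γ : ℕ → ℝ≥0) (k l : ℕ) : ℝ :=
  (1 - Real.exp (-2 * ∑ j ∈ Finset.Ico k l, (γ j : ℝ))) / 2

/-! ### The trader's model, as calibrated at a date `k`

The number of jumps `n_l` since date `k` has independent Poisson increments with parameters `ν_l`,
and the regime is `1` until the first jump and `-1` from then on; the regime `-1` is absorbing. -/

/-- The intensities `ν_l` calibrated at date `k` to a term structure `p` of binary option prices,
i.e. such that `1 - exp (-∑_{k ≤ j < l} ν_j) = p l` for `l > k`. -/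
def calibIntensity (p : ℕ → ℝ) (k l : ℕ) : ℝ :=
  let cumulated := fun j : ℕ => if j ≤ k then (0 : ℝ) else -Real.log (1 - p j)
  cumulated (l + 1) - cumulated l

/-- Joint law of the increments `n_{l+1} - n_l`, `0 ≤ l < T`, in the trader's model. -/
def traderLaw (T : ℕ) (ν : ℕ → ℝ) : Measure (Fin T → ℕ) :=
  Measure.pi fun j : Fin T => poissonMeasure (ν j).toNNReal

/-- The regime at time `l` in the trader's model started at time `k` in the regime `i`, as a
function of the increments of the jump counter. -/
def traderRegime {T : ℕ} (k : ℕ) (i : ℤ) (l : ℕ) (x : Fin T → ℕ) : ℤ :=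
  if i = 1 ∧ (∑ j : Fin T, if k ≤ (j : ℕ) ∧ (j : ℕ) < l then x j else 0) = 0 then 1 else -1

/-- Stopping rules in the trader's model from date `k` on, with values in `{k, …, T}`: whether to
have stopped by time `l` depends only on the increments between `k` and `l`. -/
def IsTraderRule (T k : ℕ) (θ : (Fin T → ℕ) → ℕ) : Prop :=
  (∀ x, k ≤ θ x ∧ θ x ≤ T) ∧
  ∀ (l : ℕ) (x y : Fin T → ℕ),
    (∀ j : Fin T, k ≤ (j : ℕ) → (j : ℕ) < l → x j = y j) → (θ x ≤ l ↔ θ y ≤ l)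

/-- The value at date `k` in the regime `i` of the callable asset in the trader's model: the optimal
expected cash flow over all the stopping rules. -/
def traderValue (T : ℕ) (ν : ℕ → ℝ) (k : ℕ) (i : ℤ) : ℝ :=
  ⨆ θ : {θ : (Fin T → ℕ) → ℕ // IsTraderRule T k θ},
    ∫ x, ∑ l ∈ Finset.Ioc k T, (dn (traderRegime k i l x) - up (traderRegime k i l x)) *
      (if l ≤ θ.1 x then 1 else 0) ∂(traderLaw T ν)

/-- The (earliest) optimal call rule in the trader's model from date `k` and regime `i`: call as
soon as the asset is worthless in the model. -/
def traderRule {T : ℕ} (ν : ℕ → ℝ) (k : ℕ) (i : ℤ) (x : Fin T → ℕ) : ℕ :=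
  sInf ({l | k ≤ l ∧ traderValue T ν l (traderRegime k i l x) = 0} ∪ {T})

/-! ### Essential suprema and tail conditional expectations -/

/-- `g` is an essential supremum of the family `S` of random variables. -/
structure IsEssSup {Ω : Type*} [MeasurableSpace Ω] (μ : Measure Ω) (S : Set (Ω → ℝ)) (g : Ω → ℝ) :
    Prop where
  measurable : Measurable g
  upper : ∀ f ∈ S, f ≤ᵐ[μ] g
  least : ∀ h : Ω → ℝ, Measurable h → (∀ f ∈ S, f ≤ᵐ[μ] h) → g ≤ᵐ[μ] h

open Classical in
/-- A version of the essential supremum of the family `S` (`0` if there is none). -/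
def essSupOf {Ω : Type*} [MeasurableSpace Ω] (μ : Measure Ω) (S : Set (Ω → ℝ)) : Ω → ℝ :=
  if h : ∃ g, IsEssSup μ S g then h.choose else 0

/-- Value-at-risk (lower quantile) at level `α` of a loss with law `ρ`. -/
def valueAtRisk (α : ℝ) (ρ : Measure ℝ) : ℝ := sInf {x | α ≤ ρ.real (Set.Iic x)}

/-- Expected shortfall at level `α` of a loss with law `ρ`, in the tail conditional expectation
sense: the expected loss given that the loss is at least its value-at-risk. -/
def expectedShortfall (α : ℝ) (ρ : Measure ℝ) : ℝ :=
  (∫ x in Set.Ici (valueAtRisk α ρ), x ∂ρ) / ρ.real (Set.Ici (valueAtRisk α ρ))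

/-! ### The market -/

/-- The discrete-time market: a maturity `T`, and a process `N` started from `0` with independent
increments `N_{l+1} - N_l`, `l < T`, that are Poisson distributed with parameters `γ_l`. -/
structure Market {Ω : Type*} [MeasurableSpace Ω] (μ : Measure Ω) where
  T : ℕ
  T_pos : 0 < T
  γ : ℕ → ℝ≥0
  N : ℕ → Ω → ℕ
  measurable_N : ∀ k, Measurable (N k)
  N_zero : ∀ᵐ ω ∂μ, N 0 ω = 0
  N_mono : ∀ l < T, ∀ᵐ ω ∂μ, N l ω ≤ N (l + 1) ω
  law_incr : ∀ l < T, μ.map (fun ω => N (l + 1) ω - N l ω) = poissonMeasure (γ l)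
  indep_incr : iIndepFun (fun (l : Fin T) ω => N (l + 1) ω - N l ω) μ

/-- The σ-algebra generated by the null events. -/
@[reducible]
def nullSigma {Ω : Type*} [MeasurableSpace Ω] (μ : Measure Ω) : MeasurableSpace Ω :=
  MeasurableSpace.generateFrom {s | MeasurableSet s ∧ μ s = 0}

theorem nullSigma_le {Ω : Type*} [m0 : MeasurableSpace Ω] (μ : Measure Ω) : nullSigma μ ≤ m0 :=
  MeasurableSpace.generateFrom_le fun _ hs => hs.1

namespace Market

variable {Ω : Type*} [m0 : MeasurableSpace Ω] {μ : Measure Ω} (M : Market μ)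

/-- The augmented natural filtration `𝔉` of `N`. -/
def 𝓕 : Filtration ℕ m0 :=
  Filtration.natural M.N (fun k => (M.measurable_N k).stronglyMeasurable) ⊔
    Filtration.const ℕ (nullSigma μ) (nullSigma_le μ)

/-- The market regime `I_k = (-1)^{N_k}` (so that `I_0 = 1`). -/
def I (k : ℕ) (ω : Ω) : ℤ := (-1) ^ M.N k ω

/-- The partition event `Ω_{l,m}`, `p = (l, m)`: the regime is `1` before `l`, `-1` from `l` until
before `m`, and `1` at `m` (as far as these dates do not exceed `T`). -/
def part (p : ℕ × ℕ) : Set Ω :=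
  {ω | ∀ j ≤ M.T, (j < p.1 → M.I j ω = 1) ∧ (p.1 ≤ j ∧ j < p.2 → M.I j ω = -1) ∧
    (j = p.2 → M.I j ω = 1)}

/-- The time-`k` market price (fair value) `P_k(l)` of the binary option with payoff `1_{I_l=-1}`. -/
def binary (k l : ℕ) : Ω → ℝ := μ[fun ω => dn (M.I l ω) | M.𝓕 k]

/-- A process evaluated at a random time. -/
def at' (X : ℕ → Ω → ℝ) (τ : Ω → ℕ) (ω : Ω) : ℝ := X (τ ω) ω

/-- A process stopped at a random time. -/
def stopAt (X : ℕ → Ω → ℝ) (τ : Ω → ℕ) (k : ℕ) (ω : Ω) : ℝ := X (min k (τ ω)) ω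

/-- Fair value process `va(Y)_k = 𝔼_k[Y_T - Y_k]` of a cash flow process `Y`. -/
def va (Y : ℕ → Ω → ℝ) (k : ℕ) : Ω → ℝ := μ[fun ω => Y M.T ω - Y k ω | M.𝓕 k]

/-! #### Prices of the callable asset -/

/-- The fair callable value `Q_k`: essential supremum, over the stopping times `τ` with values in
`{k, …, T}`, of the conditional expectation of the cash flow called at `τ`. -/
def Q (k : ℕ) : Ω → ℝ :=
  essSupOf μ {f | ∃ τ : Ω → ℕ, IsStoppingTime M.𝓕 (fun ω => ((τ ω : ℕ) : WithTop ℕ)) ∧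
    (∀ ω, k ≤ τ ω ∧ τ ω ≤ M.T) ∧
    f = μ[fun ω => ∑ l ∈ Finset.Ioc k M.T, (dn (M.I l ω) - up (M.I l ω)) *
      (if l ≤ τ ω then 1 else 0) | M.𝓕 k]}

/-- The (earliest) optimal call rule `τ^k` in the fair valuation model, from date `k` on. -/
def fairRule (k : ℕ) (ω : Ω) : ℕ := sInf ({l | k ≤ l ∧ M.Q l ω = 0} ∪ {M.T})

/-- Fair hedging ratio `A_k(l)`. -/
def ratioA (k l : ℕ) (ω : Ω) : ℝ :=
  (μ[fun ω' => dn (M.I l ω') * (if l ≤ M.fairRule k ω' then 1 else 0) | M.𝓕 k]) ω / M.binary k l ω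

/-- Fair hedging ratio `B_k(l)`. -/
def ratioB (k l : ℕ) (ω : Ω) : ℝ :=
  (μ[fun ω' => up (M.I l ω') * (if l ≤ M.fairRule k ω' then 1 else 0) | M.𝓕 k]) ω /
    (1 - M.binary k l ω)

/-- The intensities of the trader's model, calibrated at time `k` to the market prices. -/
def ν (k : ℕ) (ω : Ω) : ℕ → ℝ := calibIntensity (fun l => M.binary k l ω) k

/-- The price `q_k` of the callable asset in the trader's model calibrated at time `k`. -/
def q (k : ℕ) (ω : Ω) : ℝ := traderValue M.T (M.ν k ω) k (M.I k ω)

/-- Hedging ratio `a_k(l)` in the trader's model calibrated at time `k`. -/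
def ratio_a (k l : ℕ) (ω : Ω) : ℝ :=
  (∫ x : Fin M.T → ℕ, dn (traderRegime k (M.I k ω) l x) *
    (if l ≤ traderRule (M.ν k ω) k (M.I k ω) x then 1 else 0) ∂(traderLaw M.T (M.ν k ω))) /
    M.binary k l ω

/-- Hedging ratio `b_k(l)` in the trader's model calibrated at time `k`. -/
def ratio_b (k l : ℕ) (ω : Ω) : ℝ :=
  (∫ x : Fin M.T → ℕ, up (traderRegime k (M.I k ω) l x) *
    (if l ≤ traderRule (M.ν k ω) k (M.I k ω) x then 1 else 0) ∂(traderLaw M.T (M.ν k ω))) /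
    (1 - M.binary k l ω)

/-! #### Model switch time and exit time of the not-so-bad trader -/

/-- The model switch time `τ_s`. -/
def τs (ω : Ω) : ℕ := sInf ({k | M.I k ω = -1} ∪ {M.T}) ⊓ M.T

/-- The time `θ^⋆` of the trader's call before the model switch, capped at `τ_s`. -/
def θstar (ω : Ω) : ℕ := sInf ({k | k < M.τs ω ∧ M.q k ω = 0} ∪ {M.τs ω})

/-- The exit time `τ_e` of the not-so-bad trader. -/
def τe (ω : Ω) : ℕ := if M.θstar ω < M.τs ω then M.θstar ω else M.fairRule (M.τs ω) ω

/-- `J^s_k = 1_{k < τ_s}`. -/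
def Js (k : ℕ) (ω : Ω) : ℝ := if k < M.τs ω then 1 else 0

/-- `J^e_k = 1_{k < τ_e}`. -/
def Je (k : ℕ) (ω : Ω) : ℝ := if k < M.τe ω then 1 else 0

/-! #### Cash flows of the asset and of its hedge, with their values -/

/-- Cash flow of the asset, ignoring calls. -/
def promised (k : ℕ) (ω : Ω) : ℝ := ∑ l ∈ Finset.Icc 1 k, (dn (M.I l ω) - up (M.I l ω))

/-- Cash flow `𝒬` of the asset, called at `τ_e`. -/
def Qflow (k : ℕ) (ω : Ω) : ℝ :=
  ∑ l ∈ Finset.Icc 1 k, (dn (M.I l ω) - up (M.I l ω)) * (if l ≤ M.τe ω then 1 else 0)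

/-- Value `P^bad` of the initial static hedge. -/
def Pbad (k : ℕ) : Ω → ℝ :=
  μ[fun ω => ∑ l ∈ Finset.Ioc k M.T,
    (M.ratio_a 0 l ω * dn (M.I l ω) - M.ratio_b 0 l ω * up (M.I l ω)) | M.𝓕 k]

/-- Cash flow `𝒫^nsb` of the hedge of the not-so-bad trader. -/
def Pflow (k : ℕ) (ω : Ω) : ℝ :=
  (∑ l ∈ Finset.Icc 1 (min k (M.τs ω)),
    (M.ratio_a 0 l ω * dn (M.I l ω) - M.ratio_b 0 l ω * up (M.I l ω))) +
  (1 - M.Js k ω) * (1 - M.Js (M.τe ω) ω) *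
    ∑ l ∈ Finset.Icc (M.τs ω) k,
      (M.ratioA (M.τs ω) l ω * dn (M.I l ω) - M.ratioB (M.τs ω) l ω * up (M.I l ω))

/-- Fair value at time `k` of the hedge rebalanced at `τ_s`. -/
def Pgood (k : ℕ) : Ω → ℝ :=
  μ[fun ω => ∑ l ∈ Finset.Ioc k M.T,
    (M.ratioA (M.τs ω) l ω * dn (M.I l ω) - M.ratioB (M.τs ω) l ω * up (M.I l ω)) | M.𝓕 k]

/-- The value `P^nsb_{τ_e}` at the exit time of the hedge held at that time. -/
def Pexit (ω : Ω) : ℝ :=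
  M.Js (M.τe ω) ω * at' M.Pbad M.τe ω + (1 - M.Js (M.τe ω) ω) * at' M.Pgood M.τe ω

/-- The value `P^nsb_k` of the hedge of the not-so-bad trader, on `{k ≤ τ_e}`. -/
def P (k : ℕ) : Ω → ℝ := μ[fun ω => at' M.Pflow M.τe ω - M.Pflow k ω + M.Pexit ω | M.𝓕 k]

/-! #### Profit and loss, HVA, expected shortfall and KVA -/

/-- The raw profit and loss process (without dynamic hedge). -/
def pnl (k : ℕ) (ω : Ω) : ℝ :=
  stopAt M.Qflow M.τe k ω + stopAt M.Js M.τe k ω * stopAt M.q M.τe k ω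
    + (1 - stopAt M.Js M.τe k ω) * stopAt M.Q M.τe k ω
    - (stopAt M.Pflow M.τe k ω + stopAt M.Js M.τe k ω * stopAt M.Pbad M.τe k ω
      + (1 - stopAt M.Js M.τe k ω) * stopAt M.P M.τe k ω)
    - (1 - M.Je k ω) * (at' M.Js M.τe ω * at' M.q M.τe ω
      + (1 - at' M.Js M.τe ω) * at' M.Q M.τe ω)

/-- The hedging valuation adjustment, `HVA_k = -va(pnl)_k = pnl_k - 𝔼_k[pnl_T]`. -/
def HVA (k : ℕ) (ω : Ω) : ℝ := M.pnl k ω - (μ[M.pnl M.T | M.𝓕 k]) ω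

/-- The drift `K` of `𝒬 + Q`: the predictable process null at `0` such that `𝒬 + Q + K` is a
martingale (before calls). -/
def K (k : ℕ) (ω : Ω) : ℝ :=
  -predictablePart (fun j ω' => M.promised j ω' + M.Q j ω') M.𝓕 μ k ω

/-- `D_k = 𝔼_k[J^s_{θ^⋆} (Q - (P^nsb - P^bad))_{θ^⋆}]`. -/
def D (k : ℕ) : Ω → ℝ :=
  μ[fun ω => at' M.Js M.θstar ω *
    (at' M.Q M.θstar ω - (at' M.P M.θstar ω - at' M.Pbad M.θstar ω)) | M.𝓕 k]

/-- The loss of the HVA-compensated position over the period after `k`,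
`-(pnl_{(k+1)∧T} - pnl_k) + HVA_{(k+1)∧T} - HVA_k`. -/
def loss (k : ℕ) (ω : Ω) : ℝ :=
  M.HVA (min (k + 1) M.T) ω - M.HVA k ω - (M.pnl (min (k + 1) M.T) ω - M.pnl k ω)

/-- The expected shortfall at level `α` of a random variable `X` conditionally on `𝔉_k`: the
expected shortfall of its regular conditional law given `𝔉_k`. -/
def condES [IsFiniteMeasure μ] (α : ℝ) (k : ℕ) (X : Ω → ℝ) (ω : Ω) : ℝ :=
  expectedShortfall α (@condDistrib Ω Ω ℝ _ _ _ m0 (M.𝓕 k) X id μ _ ω)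

/-- The capital valuation adjustment, for a hurdle rate `r`. -/
def KVA [IsFiniteMeasure μ] (α r : ℝ) (k : ℕ) (ω : Ω) : ℝ :=
  r * (μ[fun ω' => ∑ l ∈ Finset.Ico k M.T,
    Real.exp (-r * ((l : ℝ) - (k : ℝ))) * M.condES α l (M.loss l) ω' | M.𝓕 k]) ω

end Market

end RangeAccrual

end

set_option linter.unusedSectionVars false

namespace RangeAccrual

/-! ### Conditional expectations -/

/-! The regime is a two-state Markov chain: between `k` and `k + 1` it flips exactly when the
Poisson increment is odd, which is independent of `𝓕 k` and has probability `oddProb M.γ (k + 1)`.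
Hence, up to null events, the quantities dated `k` are functions of the path of the regime up to
`k`, and there are finitely many such paths. This is the predicate `Known`. It is stable under
algebra, under evaluation at random dates, and under conditional expectation (`Known.condExp`, which
integrates out one regime at a time), so measurability and integrability come for free.

Prices come from one verification theorem of optimal stopping (`condExp_stopped_sum_le`,
`condExp_stopped_sum_eq`): a nonnegative solution of the dynamic programming equation dominates the
gain of every rule and is attained by stopping at its first zero. It is applied to the fair chain
(`Q_eq`) and to the absorbing chain of the trader (`traderValue_eq`). Since calibration equates the
trader's regime probabilities at date `0` with the fair ones, the initial static hedge has fair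
value `q_0` (`Pbad_zero`).

The hypothesis says that the asset is worthless in the normal regime, while before `T` it is always
worth something in the extreme one. So after the switch the fair call occurs at the first return to
the normal regime, or at `T`. Thus `τe` is a first hitting time (`τe_eq`) at which `Q` and `J^s q`
both vanish, and the closing term of the profit and loss disappears. At `τe`, the terminal profit
and loss is `𝒬 + Q`, minus `𝒫 + P`, minus the integrand of `D`. Up to `τe` the hedge is fairly
valued (`condExp_hedge`), and the drift of `𝒬 + Q` is compensated by `K` (`va_K`); conditioning
gives part (i).

For parts (ii) and (iii): on `Ω_{l,m}` the path is determined up to `m`, and `τe` does not exceed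
`m`, so the profit and loss is constant there (`pnl_const`). Conditional expectations of such
variables are finite sums weighted by the conditional probabilities of the partition events, which
satisfy the one-step equation of the chain (`condExp_part`). The same weights give the conditional
law of the loss as a finite mixture of Dirac masses (`condDistrib_of_const_on_part`), hence the
expected shortfall, and then the capital valuation adjustment by taking an expectation. -/

theorem condExp_indicator_of_indep {Ω : Type*} {m m0 : MeasurableSpace Ω} (hm : m ≤ m0)
    {μ : Measure Ω} [IsProbabilityMeasure μ] {B : Set Ω} (hB : MeasurableSet B)
    (hind : ∀ A, MeasurableSet[m] A → μ (A ∩ B) = μ A * μ B) :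
    μ[B.indicator (fun _ => (1 : ℝ)) | m] =ᵐ[μ] fun _ => μ.real B := by
  refine (ae_eq_condExp_of_forall_setIntegral_eq hm ?_ ?_ ?_ ?_).symm
  · exact (integrable_const _).indicator hB
  · intro s _ _
    exact (integrable_const _).integrableOn
  · intro s hs _
    rw [integral_indicator hB, setIntegral_const, setIntegral_const]
    simp only [smul_eq_mul, mul_one, measureReal_def]
    rw [Measure.restrict_apply hB, Set.inter_comm, hind s hs, ENNReal.toReal_mul]
  · exact aestronglyMeasurable_const

/-- One step of a Markov chain: the conditional expectation of a random choice, independent of the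
past, between two alternatives that are known. -/
theorem condExp_ite_of_indep {Ω : Type*} {m m0 : MeasurableSpace Ω} (hm : m ≤ m0)
    {μ : Measure Ω} [IsProbabilityMeasure μ] {B : Set Ω} [DecidablePred (· ∈ B)]
    (hB : MeasurableSet B)
    (hind : ∀ A, MeasurableSet[m] A → μ (A ∩ B) = μ A * μ B) {a b : Ω → ℝ}
    (ha : StronglyMeasurable[m] a) (hb : StronglyMeasurable[m] b)
    (hai : Integrable a μ) (hbi : Integrable b μ) :
    μ[fun ω => if ω ∈ B then a ω else b ω | m] =ᵐ[μ]
      fun ω => μ.real B * a ω + (1 - μ.real B) * b ω := by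
  -- In the form `(a - b) * 1_B + b`, the known factor `a - b` can be pulled out of the conditional
  -- expectation.
  have heq : (fun ω => if ω ∈ B then a ω else b ω)
      = (fun ω => (a - b) ω * B.indicator (fun _ => (1 : ℝ)) ω) + b := by
    funext ω
    by_cases h : ω ∈ B <;> simp [h]
  have hi : Integrable ((a - b) * B.indicator (fun _ => (1 : ℝ))) μ := by
    have : (a - b) * B.indicator (fun _ => (1 : ℝ)) = B.indicator (a - b) := by
      funext ω
      by_cases h : ω ∈ B <;> simp [h]
    rw [this]
    exact (hai.sub hbi).indicator hB
  rw [heq]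
  have h1 := condExp_add (m := m) hi hbi
  have h2 := condExp_mul_of_stronglyMeasurable_left (ha.sub hb) hi
    ((integrable_const (1 : ℝ)).indicator hB)
  have h3 := condExp_indicator_of_indep hm hB hind
  have h4 := condExp_of_stronglyMeasurable hm hb hbi
  filter_upwards [h1, h2, h3] with ω e1 e2 e3
  refine e1.trans ?_
  rw [Pi.add_apply, e2, h4]
  simp only [Pi.mul_apply, Pi.sub_apply, e3]
  ring

/-- The increment after `l` survives exactly when `l < n`. For a stopping time this is decided at
date `l`, which is what permits conditioning term by term. -/
theorem stopped_sub_eq_sum (y : ℕ → ℝ) (n k T : ℕ) (hkT : k ≤ T) :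
    y (min T n) - y (min k n)
      = ∑ l ∈ Finset.Ico k T, (if l < n then 1 else 0) * (y (l + 1) - y l) := by
  induction T, hkT using Nat.le_induction with
  | base => simp
  | succ T hkT ih =>
    rw [Finset.sum_Ico_succ_top hkT, ← ih]
    by_cases h : T < n
    · rw [if_pos h, min_eq_left h.le, min_eq_left (Nat.succ_le_of_lt h)]
      ring
    · rw [if_neg h, min_eq_right (not_lt.1 h), min_eq_right (by omega)]
      ring

/-! ### Stopped sums and the verification theorem of optimal stopping -/

section Stopping

variable {Ω : Type*} {m0 : MeasurableSpace Ω} {μ : Measure Ω} [IsProbabilityMeasure μ]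
  {F : Filtration ℕ m0}

theorem measurableSet_lt_of_stopping {τ : Ω → ℕ} {l : ℕ}
    (hτ : MeasurableSet[F l] {ω | τ ω ≤ l}) : MeasurableSet[F l] {ω | l < τ ω} := by
  have : {ω | l < τ ω} = {ω | τ ω ≤ l}ᶜ := by
    ext ω
    simp
  rw [this]
  exact hτ.compl

/-- Since `{l < τ}` belongs to `F l`, the tower property allows each increment to be replaced by its
conditional mean given `F l`. -/
theorem condExp_stopped_sub {Y : ℕ → Ω → ℝ} {k T : ℕ} (hkT : k ≤ T)
    (hY : ∀ l, k ≤ l → l ≤ T → Integrable (Y l) μ) {τ : Ω → ℕ}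
    (hτ : ∀ j, MeasurableSet[F j] {ω | τ ω ≤ j}) :
    μ[fun ω => Y (min T (τ ω)) ω - Y (min k (τ ω)) ω | F k] =ᵐ[μ]
      μ[fun ω => ∑ l ∈ Finset.Ico k T, (if l < τ ω then 1 else 0) * (μ[Y (l + 1) - Y l | F l]) ω
        | F k] := by
  have hs : ∀ l, MeasurableSet[F l] {ω | l < τ ω} := fun l => measurableSet_lt_of_stopping (hτ l)
  have e1 : (fun ω => Y (min T (τ ω)) ω - Y (min k (τ ω)) ω)
      = ∑ l ∈ Finset.Ico k T, {ω | l < τ ω}.indicator (Y (l + 1) - Y l) := by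
    funext ω
    rw [stopped_sub_eq_sum (fun l => Y l ω) _ _ _ hkT, Finset.sum_apply]
    refine Finset.sum_congr rfl fun l _ => ?_
    by_cases h : l < τ ω <;> simp [h]
  have e2 : (fun ω => ∑ l ∈ Finset.Ico k T,
        (if l < τ ω then 1 else 0) * (μ[Y (l + 1) - Y l | F l]) ω)
      = ∑ l ∈ Finset.Ico k T, {ω | l < τ ω}.indicator (μ[Y (l + 1) - Y l | F l]) := by
    funext ω
    rw [Finset.sum_apply]
    refine Finset.sum_congr rfl fun l _ => ?_
    by_cases h : l < τ ω <;> simp [h]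
  have hi : ∀ l ∈ Finset.Ico k T, Integrable (Y (l + 1) - Y l) μ := fun l hl => by
    obtain ⟨h1, h2⟩ := Finset.mem_Ico.1 hl
    exact (hY _ (by omega) (by omega)).sub (hY _ h1 (by omega))
  rw [e1, e2]
  refine (condExp_finsetSum (fun l hl => (hi l hl).indicator ((F.le l) _ (hs l))) _).trans ?_
  refine EventuallyEq.trans ?_ (condExp_finsetSum
    (fun l hl => integrable_condExp.indicator ((F.le l) _ (hs l))) _).symm
  refine eventuallyEq_sum fun l hl => ?_
  have h1 := condExp_indicator (hi l hl) (hs l)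
  refine (condExp_condExp_of_le (F.mono (Finset.mem_Ico.1 hl).1) (F.le l)).symm.trans ?_
  exact condExp_congr_ae h1

/-- The gain of a stopping rule, in terms of the defect of the dynamic programming equation. -/
theorem condExp_stopped_gain {c V : ℕ → Ω → ℝ} {k T : ℕ} (hkT : k ≤ T)
    (hc : ∀ l, k < l → l ≤ T → Integrable (c l) μ)
    (hV : ∀ l, k ≤ l → l ≤ T → Integrable (V l) μ)
    (hVm : ∀ l, k ≤ l → l ≤ T → StronglyMeasurable[F l] (V l))
    {τ : Ω → ℕ} (hτ : ∀ j, MeasurableSet[F j] {ω | τ ω ≤ j})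
    (hτk : ∀ ω, k ≤ τ ω ∧ τ ω ≤ T) :
    μ[fun ω => ∑ l ∈ Finset.Ioc k T, c l ω * (if l ≤ τ ω then 1 else 0) + V (τ ω) ω | F k] =ᵐ[μ]
      fun ω => V k ω + (μ[fun ω => ∑ l ∈ Finset.Ico k T, (if l < τ ω then 1 else 0) *
        ((μ[fun ω => c (l + 1) ω + V (l + 1) ω | F l]) ω - V l ω) | F k]) ω := by
  -- `Y` is the cash flow received so far plus the candidate value; its one-step conditional drift
  -- is the defect of the dynamic programming equation.
  set Y : ℕ → Ω → ℝ := fun l ω => ∑ j ∈ Finset.Ioc k l, c j ω + V l ω with hYdef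
  have hYi : ∀ l, k ≤ l → l ≤ T → Integrable (Y l) μ := fun l h1 h2 =>
    (integrable_finsetSum _ fun j hj => hc j (Finset.mem_Ioc.1 hj).1
      ((Finset.mem_Ioc.1 hj).2.trans h2)).add (hV l h1 h2)
  have key := condExp_stopped_sub (μ := μ) (F := F) hkT hYi hτ
  have e1 : (fun ω => ∑ l ∈ Finset.Ioc k T, c l ω * (if l ≤ τ ω then 1 else 0) + V (τ ω) ω)
      = (fun ω => Y (min T (τ ω)) ω - Y (min k (τ ω)) ω) + V k := by
    funext ω
    obtain ⟨h1, h2⟩ := hτk ω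
    simp only [hYdef, Pi.add_apply, min_eq_right h2, min_eq_left h1, Finset.Ioc_self,
      Finset.sum_empty, zero_add, sub_add_cancel, mul_ite, mul_one, mul_zero]
    rw [← Finset.sum_filter]
    congr 2
    ext j
    simp only [Finset.mem_filter, Finset.mem_Ioc]
    omega
  have hstep : ∀ l ∈ Finset.Ico k T, μ[Y (l + 1) - Y l | F l] =ᵐ[μ]
      fun ω => (μ[fun ω => c (l + 1) ω + V (l + 1) ω | F l]) ω - V l ω := by
    intro l hl
    obtain ⟨h1, h2⟩ := Finset.mem_Ico.1 hl
    have : Y (l + 1) - Y l = (fun ω => c (l + 1) ω + V (l + 1) ω) - V l := by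
      funext ω
      simp only [hYdef, Pi.sub_apply]
      rw [← Finset.sum_Ioc_consecutive (fun j => c j ω) h1 (Nat.le_succ l)]
      simp
      ring
    rw [this]
    have h3 := condExp_sub (m := F l) ((hc (l + 1) (by omega) (by omega)).add
      (hV (l + 1) (by omega) (by omega))) (hV l h1 h2.le)
    have h4 := condExp_of_stronglyMeasurable (F.le l) (hVm l h1 h2.le) (hV l h1 h2.le)
    refine h3.trans (ae_of_all _ fun ω => ?_)
    simp only [Pi.sub_apply, h4]
    rfl
  have e2 : (fun ω => ∑ l ∈ Finset.Ico k T, (if l < τ ω then 1 else 0) *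
        (μ[Y (l + 1) - Y l | F l]) ω) =ᵐ[μ]
      fun ω => ∑ l ∈ Finset.Ico k T, (if l < τ ω then 1 else 0) *
        ((μ[fun ω => c (l + 1) ω + V (l + 1) ω | F l]) ω - V l ω) := by
    have : ∀ᵐ ω ∂μ, ∀ l ∈ Finset.Ico k T, (μ[Y (l + 1) - Y l | F l]) ω
        = (μ[fun ω => c (l + 1) ω + V (l + 1) ω | F l]) ω - V l ω :=
      (Finset.eventually_all _).2 hstep
    filter_upwards [this] with ω hω
    exact Finset.sum_congr rfl fun l hl => by rw [hω l hl]
  have hint : Integrable (fun ω => Y (min T (τ ω)) ω - Y (min k (τ ω)) ω) μ := by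
    have : (fun ω => Y (min T (τ ω)) ω - Y (min k (τ ω)) ω)
        = ∑ l ∈ Finset.Ico k T, {ω | l < τ ω}.indicator (Y (l + 1) - Y l) := by
      funext ω
      rw [stopped_sub_eq_sum (fun l => Y l ω) _ _ _ hkT, Finset.sum_apply]
      refine Finset.sum_congr rfl fun l _ => ?_
      by_cases h : l < τ ω <;> simp [h]
    rw [this]
    refine integrable_finsetSum' _ fun l hl => ?_
    obtain ⟨h1, h2⟩ := Finset.mem_Ico.1 hl
    exact ((hYi _ (by omega) (by omega)).sub (hYi _ h1 (by omega))).indicator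
      ((F.le l) _ (measurableSet_lt_of_stopping (hτ l)))
  rw [e1]
  have h5 := condExp_add (m := F k) hint (hV k le_rfl hkT)
  have h6 := condExp_of_stronglyMeasurable (F.le k) (hVm k le_rfl hkT) (hV k le_rfl hkT)
  filter_upwards [h5, key, condExp_congr_ae (m := F k) e2] with ω a1 a2 a3
  rw [a1, Pi.add_apply, a2, a3, h6, add_comm]

theorem integrable_stopped {V : ℕ → Ω → ℝ} {k T : ℕ}
    (hV : ∀ l, k ≤ l → l ≤ T → Integrable (V l) μ)
    {τ : Ω → ℕ} (hτ : Measurable τ) (hτk : ∀ ω, k ≤ τ ω ∧ τ ω ≤ T) :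
    Integrable (fun ω => V (τ ω) ω) μ := by
  have : (fun ω => V (τ ω) ω) = ∑ l ∈ Finset.Icc k T, {ω | τ ω = l}.indicator (V l) := by
    funext ω
    rw [Finset.sum_apply, Finset.sum_eq_single (τ ω)]
    · simp
    · intro b _ hb
      simp [Ne.symm hb]
    · intro h
      exact absurd (Finset.mem_Icc.2 (hτk ω)) h
  rw [this]
  refine integrable_finsetSum' _ fun l hl => ?_
  exact (hV l (Finset.mem_Icc.1 hl).1 (Finset.mem_Icc.1 hl).2).indicator
    (hτ (measurableSet_singleton l))

theorem measurable_of_stopping {τ : Ω → ℕ} (hτ : ∀ j, MeasurableSet[F j] {ω | τ ω ≤ j}) :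
    Measurable τ :=
  measurable_of_Iic fun j => F.le j _ (hτ j)

theorem integrable_stopped_sum {c : ℕ → Ω → ℝ} {k T : ℕ}
    (hc : ∀ l, k < l → l ≤ T → Integrable (c l) μ) {τ : Ω → ℕ} (hτ : Measurable τ) :
    Integrable (fun ω => ∑ l ∈ Finset.Ioc k T, c l ω * (if l ≤ τ ω then 1 else 0)) μ := by
  refine integrable_finsetSum _ fun l hl => ?_
  have : (fun ω => c l ω * (if l ≤ τ ω then 1 else 0)) = {ω | l ≤ τ ω}.indicator (c l) := by
    funext ω
    by_cases h : l ≤ τ ω <;> simp [h]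
  rw [this]
  exact (hc l (Finset.mem_Ioc.1 hl).1 (Finset.mem_Ioc.1 hl).2).indicator
    (measurableSet_le measurable_const hτ)

/-- Verification theorem of optimal stopping: the upper bound. -/
theorem condExp_stopped_sum_le {c V : ℕ → Ω → ℝ} {k T : ℕ} (hkT : k ≤ T)
    (hc : ∀ l, k < l → l ≤ T → Integrable (c l) μ)
    (hV : ∀ l, k ≤ l → l ≤ T → Integrable (V l) μ)
    (hVm : ∀ l, k ≤ l → l ≤ T → StronglyMeasurable[F l] (V l))
    (hpos : ∀ l, k ≤ l → l ≤ T → ∀ ω, 0 ≤ V l ω)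
    (hstep : ∀ l, k ≤ l → l < T → μ[fun ω => c (l + 1) ω + V (l + 1) ω | F l] ≤ᵐ[μ] V l)
    {τ : Ω → ℕ} (hτ : ∀ j, MeasurableSet[F j] {ω | τ ω ≤ j})
    (hτk : ∀ ω, k ≤ τ ω ∧ τ ω ≤ T) :
    μ[fun ω => ∑ l ∈ Finset.Ioc k T, c l ω * (if l ≤ τ ω then 1 else 0) | F k] ≤ᵐ[μ] V k := by
  have hτm := measurable_of_stopping hτ
  have h1 := condExp_stopped_gain hkT hc hV hVm hτ hτk
  have h2 : μ[fun ω => ∑ l ∈ Finset.Ioc k T, c l ω * (if l ≤ τ ω then 1 else 0) | F k] ≤ᵐ[μ]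
      μ[fun ω => ∑ l ∈ Finset.Ioc k T, c l ω * (if l ≤ τ ω then 1 else 0) + V (τ ω) ω | F k] := by
    refine condExp_mono (integrable_stopped_sum hc hτm)
      ((integrable_stopped_sum hc hτm).add (integrable_stopped hV hτm hτk))
      (ae_of_all _ fun ω => ?_)
    have := hpos (τ ω) (hτk ω).1 (hτk ω).2 ω
    simp only
    linarith
  have h3 : μ[fun ω => ∑ l ∈ Finset.Ico k T, (if l < τ ω then 1 else 0) *
        ((μ[fun ω => c (l + 1) ω + V (l + 1) ω | F l]) ω - V l ω) | F k] ≤ᵐ[μ] 0 := by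
    refine condExp_nonpos ?_
    have : ∀ᵐ ω ∂μ, ∀ l ∈ Finset.Ico k T,
        (μ[fun ω => c (l + 1) ω + V (l + 1) ω | F l]) ω ≤ V l ω :=
      (Finset.eventually_all _).2 fun l hl =>
        hstep l (Finset.mem_Ico.1 hl).1 (Finset.mem_Ico.1 hl).2
    filter_upwards [this] with ω hω
    refine Finset.sum_nonpos fun l hl => ?_
    have := hω l hl
    split_ifs <;> linarith
  filter_upwards [h1, h2, h3] with ω a1 a2 a3
  simp only [Pi.zero_apply] at a3
  linarith

/-- Verification theorem of optimal stopping: the optimal rule. -/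
theorem condExp_stopped_sum_eq {c V : ℕ → Ω → ℝ} {k T : ℕ} (hkT : k ≤ T)
    (hc : ∀ l, k < l → l ≤ T → Integrable (c l) μ)
    (hV : ∀ l, k ≤ l → l ≤ T → Integrable (V l) μ)
    (hVm : ∀ l, k ≤ l → l ≤ T → StronglyMeasurable[F l] (V l))
    {τ : Ω → ℕ} (hτ : ∀ j, MeasurableSet[F j] {ω | τ ω ≤ j})
    (hτk : ∀ ω, k ≤ τ ω ∧ τ ω ≤ T) (hend : ∀ ω, V (τ ω) ω = 0)
    (hstep : ∀ l, k ≤ l → l < T → ∀ᵐ ω ∂μ, l < τ ω →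
      (μ[fun ω => c (l + 1) ω + V (l + 1) ω | F l]) ω = V l ω) :
    μ[fun ω => ∑ l ∈ Finset.Ioc k T, c l ω * (if l ≤ τ ω then 1 else 0) | F k] =ᵐ[μ] V k := by
  have h1 := condExp_stopped_gain hkT hc hV hVm hτ hτk
  simp only [hend, add_zero] at h1
  have h3 : μ[fun ω => ∑ l ∈ Finset.Ico k T, (if l < τ ω then 1 else 0) *
        ((μ[fun ω => c (l + 1) ω + V (l + 1) ω | F l]) ω - V l ω) | F k] =ᵐ[μ] 0 := by
    have h4 : (fun ω => ∑ l ∈ Finset.Ico k T, (if l < τ ω then 1 else 0) *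
        ((μ[fun ω => c (l + 1) ω + V (l + 1) ω | F l]) ω - V l ω)) =ᵐ[μ] 0 := by
      have : ∀ᵐ ω ∂μ, ∀ l ∈ Finset.Ico k T, l < τ ω →
          (μ[fun ω => c (l + 1) ω + V (l + 1) ω | F l]) ω = V l ω :=
        (Finset.eventually_all _).2 fun l hl =>
          hstep l (Finset.mem_Ico.1 hl).1 (Finset.mem_Ico.1 hl).2
      filter_upwards [this] with ω hω
      refine Finset.sum_eq_zero fun l hl => ?_
      have := hω l hl
      split_ifs with h
      · rw [this h]
        ring
      · ring
    refine (condExp_congr_ae h4).trans ?_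
    rw [condExp_zero]
  filter_upwards [h1, h3] with ω a1 a3
  rw [a1, a3]
  simp

end Stopping

/-! ### Poisson distributions -/

/-- The generating function of the Poisson law at `-1`; only the parity of `N` matters for the
regime. -/
theorem integral_neg_one_pow_poissonMeasure (r : ℝ≥0) :
    ∫ n, (-1 : ℝ) ^ n ∂(poissonMeasure r) = Real.exp (-2 * (r : ℝ)) := by
  rw [integral_poissonMeasure]
  have h : ∀ n : ℕ, (Real.exp (-(r : ℝ)) * (r : ℝ) ^ n / (n.factorial : ℝ)) • (-1 : ℝ) ^ n
      = Real.exp (-(r : ℝ)) * ((-(r : ℝ)) ^ n / (n.factorial : ℝ)) := by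
    intro n
    rw [neg_pow, smul_eq_mul]
    ring
  simp_rw [h]
  rw [tsum_mul_left, ← congrFun (NormedSpace.exp_eq_tsum_div (𝔸 := ℝ)) (-(r : ℝ)),
    ← Real.exp_eq_exp_ℝ, ← Real.exp_add]
  congr 1
  ring

theorem poissonMeasure_real_even (r : ℝ≥0) :
    (poissonMeasure r).real {n | Even n} = (1 + Real.exp (-2 * (r : ℝ))) / 2 := by
  have hm : MeasurableSet {n : ℕ | Even n} := MeasurableSet.of_discrete
  have h1 : ∫ n, (-1 : ℝ) ^ n ∂(poissonMeasure r)
      = 2 * (poissonMeasure r).real {n | Even n} - 1 := by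
    have : (fun n : ℕ => (-1 : ℝ) ^ n)
        = fun n => 2 * {n : ℕ | Even n}.indicator (fun _ => (1 : ℝ)) n - 1 := by
      funext n
      by_cases h : Even n
      · simp [h]
        norm_num
      · simp [h, Nat.not_even_iff_odd.1 h]
    rw [this, integral_sub, integral_const_mul, integral_indicator hm]
    · simp
    · exact ((integrable_const _).indicator hm).const_mul _
    · exact integrable_const _
  rw [integral_neg_one_pow_poissonMeasure] at h1
  linarith

/-! ### First times -/

/-- First times are compared, and shown to be stopping times, only through the events `{≤ n}`. Dates
beyond the cap `T` that satisfy `p` are harmless. -/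
theorem sInf_union_singleton_le_iff (p : ℕ → Prop) (T n : ℕ) :
    sInf ({l | p l} ∪ {T}) ≤ n ↔ (∃ l ≤ n, p l) ∨ T ≤ n := by
  constructor
  · intro h
    rcases Nat.sInf_mem (s := {l | p l} ∪ {T}) ⟨T, Or.inr rfl⟩ with h1 | h1
    · exact Or.inl ⟨_, h, h1⟩
    · exact Or.inr (h1 ▸ h)
  · rintro (⟨l, hl, hp⟩ | h)
    · exact (Nat.sInf_le (Or.inl hp)).trans hl
    · exact (Nat.sInf_le (Or.inr rfl)).trans h

theorem sInf_union_singleton_le (p : ℕ → Prop) (T : ℕ) : sInf ({l | p l} ∪ {T}) ≤ T :=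
  Nat.sInf_le (Or.inr rfl)

theorem sInf_union_singleton_spec (p : ℕ → Prop) (T : ℕ) :
    p (sInf ({l | p l} ∪ {T})) ∨ sInf ({l | p l} ∪ {T}) = T :=
  Nat.sInf_mem (s := {l | p l} ∪ {T}) ⟨T, Or.inr rfl⟩

theorem not_of_lt_sInf_union_singleton {p : ℕ → Prop} {T l : ℕ}
    (h : l < sInf ({l | p l} ∪ {T})) : ¬ p l :=
  fun hp => absurd (Nat.sInf_le (Or.inl hp)) (not_le.2 h)

theorem le_sInf_union_singleton {p : ℕ → Prop} {T k : ℕ} (hk : k ≤ T) (hp : ∀ l, p l → k ≤ l) :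
    k ≤ sInf ({l | p l} ∪ {T}) := by
  rcases sInf_union_singleton_spec p T with h | h
  · exact hp _ h
  · exact hk.trans_eq h.symm

theorem sInf_union_singleton_congr {p q : ℕ → Prop} {T : ℕ} (h : ∀ l < T, p l ↔ q l) :
    sInf ({l | p l} ∪ {T}) = sInf ({l | q l} ∪ {T}) := by
  refine eq_of_forall_ge_iff fun n => ?_
  rw [sInf_union_singleton_le_iff, sInf_union_singleton_le_iff]
  by_cases hn : T ≤ n
  · simp [hn]
  · simp only [hn, or_false]
    exact exists_congr fun l => and_congr_right fun hl => h l (by omega)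

/-! ### Regime indicators -/

@[simp] theorem dn_one : dn 1 = 0 := by simp [dn]
@[simp] theorem dn_neg_one : dn (-1) = 1 := by simp [dn]
@[simp] theorem up_one : up 1 = 1 := by simp [up]
@[simp] theorem up_neg_one : up (-1) = 0 := by norm_num [up]

/-! ### The trader's model -/

section Trader

variable {T : ℕ}

/-- The path of the increments of the jump counter before date `l`. -/
def pastPath (l : ℕ) (x : Fin T → ℕ) : Fin T → ℕ := fun j => if (j : ℕ) < l then x j else 0

theorem pastPath_pastPath {l n : ℕ} (h : l ≤ n) (x : Fin T → ℕ) :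
    pastPath l (pastPath n x) = pastPath l x := by
  funext j
  simp only [pastPath]
  split_ifs with h1 h2
  · rfl
  · omega
  · rfl

/-- The filtration generated by the increments of the jump counter. -/
def traderFiltration (T : ℕ) :
    Filtration ℕ (MeasurableSpace.pi : MeasurableSpace (Fin T → ℕ)) where
  seq l := MeasurableSpace.comap (pastPath l) MeasurableSpace.pi
  mono' := by
    rintro l n h _ ⟨s, _, rfl⟩
    refine ⟨pastPath l ⁻¹' s, MeasurableSet.of_discrete, ?_⟩
    ext x
    simp [pastPath_pastPath h]
  le' _ := fun _ _ => MeasurableSet.of_discrete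

/-- The space of increments is countable and discrete, so belonging to the filtration only means
being insensitive to the increments from `l` on. -/
theorem measurableSet_traderFiltration {l : ℕ} {s : Set (Fin T → ℕ)}
    (hs : ∀ x, pastPath l x ∈ s ↔ x ∈ s) : MeasurableSet[traderFiltration T l] s :=
  ⟨s, MeasurableSet.of_discrete, Set.ext hs⟩

theorem stronglyMeasurable_traderFiltration {l : ℕ} {f : (Fin T → ℕ) → ℝ}
    (hf : ∀ x, f (pastPath l x) = f x) : StronglyMeasurable[traderFiltration T l] f := by
  have h : Measurable[traderFiltration T l] f := fun s _ =>
    measurableSet_traderFiltration fun x => by simp [hf]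
  exact h.stronglyMeasurable

instance (ν : ℕ → ℝ) : IsProbabilityMeasure (traderLaw T ν) := by
  unfold traderLaw
  infer_instance

theorem integrable_traderLaw (ν : ℕ → ℝ) {f : (Fin T → ℕ) → ℝ} {C : ℝ} (hf : ∀ x, |f x| ≤ C) :
    Integrable f (traderLaw T ν) :=
  Integrable.of_bound (Measurable.of_discrete.aestronglyMeasurable) C
    (ae_of_all _ fun x => by simpa using hf x)

theorem traderLaw_congr {ν ν' : ℕ → ℝ} (h : ∀ j < T, ν j = ν' j) :
    traderLaw T ν = traderLaw T ν' := by
  unfold traderLaw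
  congr 1
  funext j
  rw [h j j.2]

/-- The coordinates are independent under a product measure, and the past is a function of the
coordinates before `l`, extended by zero. -/
theorem traderLaw_indep (ν : ℕ → ℝ) (l : Fin T) (A : Set (Fin T → ℕ))
    (hA : MeasurableSet[traderFiltration T l] A) :
    traderLaw T ν (A ∩ {x | x l = 0}) = traderLaw T ν A * traderLaw T ν {x | x l = 0} := by
  obtain ⟨A', hA', rfl⟩ := hA
  have h := (iIndepFun_pi (μ := fun j : Fin T => poissonMeasure (ν j).toNNReal)
    (X := fun _ n => n) (fun _ => aemeasurable_id))
  have h2 := h.indepFun_finset (Finset.univ.filter fun j => j < l) {l}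
    (by simp +contextual [Finset.disjoint_left, ne_of_lt]) (fun j => measurable_pi_apply j)
  have h3 := h2.measure_inter_preimage_eq_mul
    {y | (fun j : Fin T => if hj : j < l then y ⟨j, by simp [hj]⟩ else 0) ∈ A'}
    {y | y ⟨l, by simp⟩ = 0} MeasurableSet.of_discrete MeasurableSet.of_discrete
  have e : pastPath (l : ℕ) ⁻¹' A' = (fun (a : Fin T → ℕ) (i : Finset.univ.filter fun j => j < l) =>
      a i) ⁻¹' {y | (fun j : Fin T => if hj : j < l then y ⟨j, by simp [hj]⟩ else 0) ∈ A'} := by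
    ext x
    simp only [Set.mem_preimage, Set.mem_ofPred_eq, dite_eq_ite]
    rfl
  rw [e]
  exact h3

/-- Nonnegativity is needed because `traderLaw` truncates negative intensities to zero. -/
theorem traderLaw_no_jump (ν : ℕ → ℝ) (l : Fin T) (hν : 0 ≤ ν l) :
    (traderLaw T ν).real {x | x l = 0} = Real.exp (-ν l) := by
  have : {x : Fin T → ℕ | x l = 0} = Function.eval l ⁻¹' {0} := rfl
  have h := (measurePreserving_eval (fun j : Fin T => poissonMeasure (ν j).toNNReal) l)
  rw [this, traderLaw, h.measureReal_preimage (measurableSet_singleton _).nullMeasurableSet,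
    poissonMeasure_real_singleton]
  simp [hν]

theorem traderRegime_eq (k : ℕ) (i : ℤ) (l : ℕ) (x : Fin T → ℕ) :
    traderRegime k i l x = 1 ∨ traderRegime k i l x = -1 := by
  unfold traderRegime
  split_ifs <;> simp

theorem traderRegime_neg_one (k l : ℕ) (x : Fin T → ℕ) : traderRegime k (-1) l x = -1 := by
  norm_num [traderRegime]

theorem traderRegime_self {k : ℕ} {i : ℤ} (hi : i = 1 ∨ i = -1) (x : Fin T → ℕ) :
    traderRegime k i k x = i := by
  rcases hi with rfl | rfl
  · unfold traderRegime
    rw [if_pos]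
    refine ⟨rfl, Finset.sum_eq_zero fun j _ => if_neg ?_⟩
    omega
  · exact traderRegime_neg_one _ _ _

theorem traderRegime_congr {k : ℕ} {i : ℤ} {l : ℕ} {x y : Fin T → ℕ}
    (h : ∀ j : Fin T, k ≤ (j : ℕ) → (j : ℕ) < l → x j = y j) :
    traderRegime k i l x = traderRegime k i l y := by
  unfold traderRegime
  congr 4
  funext j
  split_ifs with hj
  · exact h j hj.1 hj.2
  · rfl

theorem traderRegime_pastPath {k : ℕ} {i : ℤ} {l n : ℕ} (hl : l ≤ n) (x : Fin T → ℕ) :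
    traderRegime k i l (pastPath n x) = traderRegime k i l x :=
  traderRegime_congr fun j _ h => by simp [pastPath, h.trans_le hl]

theorem traderRegime_succ {k : ℕ} {i : ℤ} (l : Fin T) (hkl : k ≤ l) (x : Fin T → ℕ) :
    traderRegime k i (l + 1) x = if x l = 0 then traderRegime k i l x else -1 := by
  have h : (∑ j : Fin T, if k ≤ (j : ℕ) ∧ (j : ℕ) < l + 1 then x j else 0)
      = (∑ j : Fin T, if k ≤ (j : ℕ) ∧ (j : ℕ) < l then x j else 0) + x l := by
    have : x l = ∑ j : Fin T, if j = l then x j else 0 := by simp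
    rw [this, ← Finset.sum_add_distrib]
    refine Finset.sum_congr rfl fun j _ => ?_
    rcases lt_trichotomy j l with hj | rfl | hj
    · have : (j : ℕ) < l := hj
      simp [hj.ne, this, this.trans (Nat.lt_succ_self _)]
    · simp [hkl]
    · have : (l : ℕ) < j := hj
      simp [hj.ne', show ¬ (j : ℕ) < l + 1 by omega, show ¬ (j : ℕ) < l by omega]
  unfold traderRegime
  rw [h]
  by_cases hx : x l = 0 <;> simp [hx]

/-- The value function of the callable asset in the trader's model. -/
noncomputable def traderStateFn (ν : ℕ → ℝ) (T l : ℕ) (i : ℤ) : ℝ :=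
  if i = 1 then traderFn ν T l else (T : ℝ) - l

theorem traderFn_nonneg (ν : ℕ → ℝ) (T l : ℕ) : 0 ≤ traderFn ν T l := by
  rw [traderFn]
  split_ifs
  · exact le_max_left _ _
  · exact le_rfl

theorem traderStateFn_nonneg (ν : ℕ → ℝ) {T l : ℕ} (hl : l ≤ T) (i : ℤ) :
    0 ≤ traderStateFn ν T l i := by
  unfold traderStateFn
  split_ifs
  · exact traderFn_nonneg _ _ _
  · have : (l : ℝ) ≤ T := by exact_mod_cast hl
    linarith

theorem traderStateFn_terminal (ν : ℕ → ℝ) (T : ℕ) (i : ℤ) : traderStateFn ν T T i = 0 := by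
  unfold traderStateFn
  rw [traderFn]
  simp

theorem integrable_regime (ν : ℕ → ℝ) (k : ℕ) (i : ℤ) (l : ℕ) (h : ℤ → ℝ) :
    Integrable (fun x : Fin T → ℕ => h (traderRegime k i l x)) (traderLaw T ν) :=
  integrable_traderLaw ν (C := max |h 1| |h (-1)|) fun x => by
    rcases traderRegime_eq k i l x with e | e <;> simp [e]

/-- One step of the absorbing chain: without a jump the regime is unchanged, and after a jump it is
`-1` whatever it was. -/
theorem condExp_traderRegime_succ (ν : ℕ → ℝ) {k : ℕ} {i : ℤ} (l : Fin T) (hkl : k ≤ l)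
    (h : ℤ → ℝ) :
    (traderLaw T ν)[fun x => h (traderRegime k i (l + 1) x) | traderFiltration T l]
      =ᵐ[traderLaw T ν] fun x => (traderLaw T ν).real {x | x l = 0} * h (traderRegime k i l x)
        + (1 - (traderLaw T ν).real {x | x l = 0}) * h (-1) := by
  have h1 := condExp_ite_of_indep (μ := traderLaw T ν) (B := {x | x l = 0})
    ((traderFiltration T).le l) MeasurableSet.of_discrete (traderLaw_indep ν l)
    (a := fun x => h (traderRegime k i l x)) (b := fun _ => h (-1))
    (stronglyMeasurable_traderFiltration fun x => by rw [traderRegime_pastPath le_rfl])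
    stronglyMeasurable_const (integrable_regime _ _ _ _ _) (integrable_const _)
  convert h1 using 2
  funext x
  rw [traderRegime_succ l hkl]
  simp only [Set.mem_ofPred_eq]
  split_ifs <;> rfl

/-- The inequality serves the upper bound of the verification theorem, the equality where the value
is nonzero serves the optimal rule. The intensities matter only if the starting regime is `1`:
calibration in the regime `-1` may produce negative ones, but that regime is absorbing and the value
there is simply the number of remaining dates. -/
theorem traderStateFn_step (ν : ℕ → ℝ) {k : ℕ} {i : ℤ} (hi : i = 1 ∨ i = -1)
    (hν : i = 1 → ∀ j < T, 0 ≤ ν j) (l : ℕ) (hkl : k ≤ l) (hl : l < T) :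
    ∀ᵐ x ∂(traderLaw T ν),
      ((traderLaw T ν)[fun x => dn (traderRegime k i (l + 1) x) - up (traderRegime k i (l + 1) x)
          + traderStateFn ν T (l + 1) (traderRegime k i (l + 1) x) | traderFiltration T l]) x
        ≤ traderStateFn ν T l (traderRegime k i l x) ∧
      (traderStateFn ν T l (traderRegime k i l x) ≠ 0 →
        ((traderLaw T ν)[fun x => dn (traderRegime k i (l + 1) x) - up (traderRegime k i (l + 1) x)
          + traderStateFn ν T (l + 1) (traderRegime k i (l + 1) x) | traderFiltration T l]) x
        = traderStateFn ν T l (traderRegime k i l x)) := by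
  have h := condExp_traderRegime_succ ν (i := i) ⟨l, hl⟩ hkl
    (fun j => dn j - up j + traderStateFn ν T (l + 1) j)
  filter_upwards [h] with x hx
  rw [hx]
  rcases traderRegime_eq k i l x with e | e
  · have hi1 : i = 1 := by
      rcases hi with h | h
      · exact h
      · rw [h, traderRegime_neg_one] at e
        norm_num at e
    rw [traderLaw_no_jump ν ⟨l, hl⟩ (hν hi1 l hl), e]
    have h2 : traderStateFn ν T l 1 = max 0 (Real.exp (-ν l) * (-1 + traderFn ν T (l + 1))
      + (1 - Real.exp (-ν l)) * (1 + ((T : ℝ) - ((l : ℝ) + 1)))) := by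
      unfold traderStateFn
      rw [if_pos rfl, traderFn, if_pos hl]
    have h3 : Real.exp (-ν l) * (dn 1 - up 1 + traderStateFn ν T (l + 1) 1)
        + (1 - Real.exp (-ν l)) * (dn (-1) - up (-1) + traderStateFn ν T (l + 1) (-1))
        = Real.exp (-ν l) * (-1 + traderFn ν T (l + 1))
      + (1 - Real.exp (-ν l)) * (1 + ((T : ℝ) - ((l : ℝ) + 1))) := by
      norm_num [traderStateFn]
    dsimp only
    rw [h2, h3]
    refine ⟨le_max_right _ _, fun hne => ?_⟩
    rcases max_choice 0 (Real.exp (-ν l) * (-1 + traderFn ν T (l + 1))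
      + (1 - Real.exp (-ν l)) * (1 + ((T : ℝ) - ((l : ℝ) + 1)))) with h4 | h4
    · exact absurd h4 hne
    · exact h4.symm
  · rw [e]
    have h5 : ∀ p : ℝ, p * (dn (-1) - up (-1) + traderStateFn ν T (l + 1) (-1))
        + (1 - p) * (dn (-1) - up (-1) + traderStateFn ν T (l + 1) (-1))
        = traderStateFn ν T l (-1) := by
      intro p
      norm_num [traderStateFn]
      ring
    rw [h5]
    exact ⟨le_rfl, fun _ => rfl⟩

theorem integrable_rewards (ν : ℕ → ℝ) (k : ℕ) (i : ℤ) (l : ℕ) :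
    Integrable (fun x : Fin T → ℕ => dn (traderRegime k i l x) - up (traderRegime k i l x))
      (traderLaw T ν) :=
  integrable_regime ν k i l fun j => dn j - up j

theorem IsTraderRule.measurableSet {k : ℕ} {θ : (Fin T → ℕ) → ℕ} (hθ : IsTraderRule T k θ)
    (j : ℕ) : MeasurableSet[traderFiltration T j] {x | θ x ≤ j} :=
  measurableSet_traderFiltration fun x => hθ.2 j _ _ fun i _ hi => by simp [pastPath, hi]

theorem isTraderRule_sInf {k : ℕ} (hk : k ≤ T) {p : ℕ → (Fin T → ℕ) → Prop}
    (hp : ∀ (l : ℕ) (x y : Fin T → ℕ),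
      (∀ j : Fin T, k ≤ (j : ℕ) → (j : ℕ) < l → x j = y j) → (p l x ↔ p l y)) :
    IsTraderRule T k fun x => sInf ({l | k ≤ l ∧ p l x} ∪ {T}) := by
  refine ⟨fun x => ⟨le_sInf_union_singleton hk fun l hl => hl.1, sInf_union_singleton_le _ _⟩,
    fun l x y h => ?_⟩
  simp only [sInf_union_singleton_le_iff]
  refine or_congr (exists_congr fun n => and_congr_right fun hn => and_congr_right fun _ => ?_)
    Iff.rfl
  exact hp n x y fun j h1 h2 => h j h1 (h2.trans_le hn)

/-- The expected cash flow in the trader's model, called according to the rule `θ`. -/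
noncomputable def traderGain (ν : ℕ → ℝ) (k : ℕ) (i : ℤ) (θ : (Fin T → ℕ) → ℕ) : ℝ :=
  ∫ x, ∑ l ∈ Finset.Ioc k T, (dn (traderRegime k i l x) - up (traderRegime k i l x)) *
      (if l ≤ θ x then 1 else 0) ∂(traderLaw T ν)

theorem integral_traderStateFn_self (ν : ℕ → ℝ) {k : ℕ} {i : ℤ} (hi : i = 1 ∨ i = -1) :
    ∫ x : Fin T → ℕ, traderStateFn ν T k (traderRegime k i k x) ∂(traderLaw T ν)
      = traderStateFn ν T k i := by
  simp [traderRegime_self hi]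

theorem stronglyMeasurable_regime (k : ℕ) (i : ℤ) (l : ℕ) (h : ℤ → ℝ) :
    StronglyMeasurable[traderFiltration T l] fun x => h (traderRegime k i l x) :=
  stronglyMeasurable_traderFiltration fun x => by rw [traderRegime_pastPath le_rfl]

/-- The conditional verification theorem at date `k`, integrated; the starting state is
deterministic, so the integral of the value is the value. -/
theorem traderGain_le (ν : ℕ → ℝ) {k : ℕ} (hk : k ≤ T) {i : ℤ} (hi : i = 1 ∨ i = -1)
    (hν : i = 1 → ∀ j < T, 0 ≤ ν j) {θ : (Fin T → ℕ) → ℕ} (hθ : IsTraderRule T k θ) :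
    traderGain ν k i θ ≤ traderStateFn ν T k i := by
  have h := condExp_stopped_sum_le (μ := traderLaw T ν) (F := traderFiltration T) (τ := θ)
    (c := fun l x => dn (traderRegime k i l x) - up (traderRegime k i l x))
    (V := fun l x => traderStateFn ν T l (traderRegime k i l x)) hk
    (fun l _ _ => integrable_rewards ν k i l) (fun l _ _ => integrable_regime ν k i l _)
    (fun l _ _ => stronglyMeasurable_regime k i l _)
    (fun l _ hl x => traderStateFn_nonneg ν hl _)
    (fun l h1 h2 => (traderStateFn_step ν hi hν l h1 h2).mono fun x hx => hx.1)
    hθ.measurableSet hθ.1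
  rw [← integral_traderStateFn_self (T := T) ν hi, traderGain,
    ← integral_condExp ((traderFiltration T).le k)]
  exact integral_mono_ae integrable_condExp (integrable_regime ν k i k _) h

theorem traderGain_eq (ν : ℕ → ℝ) {k : ℕ} (hk : k ≤ T) {i : ℤ} (hi : i = 1 ∨ i = -1)
    (hν : i = 1 → ∀ j < T, 0 ≤ ν j) :
    traderGain ν k i (fun x : Fin T → ℕ =>
      sInf ({l | k ≤ l ∧ traderStateFn ν T l (traderRegime k i l x) = 0} ∪ {T}))
      = traderStateFn ν T k i := by
  have hθ : IsTraderRule T k (fun x : Fin T → ℕ =>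
      sInf ({l | k ≤ l ∧ traderStateFn ν T l (traderRegime k i l x) = 0} ∪ {T})) :=
    isTraderRule_sInf hk fun l x y h => by rw [traderRegime_congr h]
  have h := condExp_stopped_sum_eq (μ := traderLaw T ν) (F := traderFiltration T)
    (c := fun l x => dn (traderRegime k i l x) - up (traderRegime k i l x))
    (V := fun l x => traderStateFn ν T l (traderRegime k i l x)) hk
    (fun l _ _ => integrable_rewards ν k i l) (fun l _ _ => integrable_regime ν k i l _)
    (fun l _ _ => stronglyMeasurable_regime k i l _) hθ.measurableSet hθ.1
    (fun x => by
      rcases sInf_union_singleton_spec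
        (fun l => k ≤ l ∧ traderStateFn ν T l (traderRegime k i l x) = 0) T with h | h
      · exact h.2
      · rw [h]
        exact traderStateFn_terminal _ _ _)
    (fun l h1 h2 => (traderStateFn_step ν hi hν l h1 h2).mono fun x hx hl =>
      hx.2 fun h0 => not_of_lt_sInf_union_singleton hl ⟨h1, h0⟩)
  rw [← integral_traderStateFn_self (T := T) ν hi, traderGain,
    ← integral_condExp ((traderFiltration T).le k)]
  exact integral_congr_ae h

/-- Every rule gains at most the value function, and the first zero of that function is an
admissible rule that attains it. -/
theorem traderValue_eq (ν : ℕ → ℝ) {k : ℕ} (hk : k ≤ T) {i : ℤ} (hi : i = 1 ∨ i = -1)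
    (hν : i = 1 → ∀ j < T, 0 ≤ ν j) : traderValue T ν k i = traderStateFn ν T k i := by
  have hle : ∀ θ : {θ : (Fin T → ℕ) → ℕ // IsTraderRule T k θ},
      traderGain ν k i θ.1 ≤ traderStateFn ν T k i := fun θ => traderGain_le ν hk hi hν θ.2
  have : Nonempty {θ : (Fin T → ℕ) → ℕ // IsTraderRule T k θ} :=
    ⟨⟨fun _ => T, fun _ => ⟨hk, le_rfl⟩, fun _ _ _ _ => Iff.rfl⟩⟩
  refine le_antisymm (ciSup_le hle) ?_
  rw [← traderGain_eq ν hk hi hν]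
  exact le_ciSup (f := fun θ : {θ : (Fin T → ℕ) → ℕ // IsTraderRule T k θ} =>
    traderGain ν k i θ.1) ⟨_, Set.forall_mem_range.2 hle⟩
    ⟨_, isTraderRule_sInf (p := fun l x => traderStateFn ν T l (traderRegime k i l x) = 0) hk
      fun l x y h => by rw [traderRegime_congr h]⟩

theorem traderValue_congr {ν ν' : ℕ → ℝ} (h : ∀ j < T, ν j = ν' j) (k : ℕ) (i : ℤ) :
    traderValue T ν k i = traderValue T ν' k i := by
  unfold traderValue
  rw [traderLaw_congr h]

/-- The trader's rule is the first zero of the optimal value; by `traderValue_eq` this is the first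
zero of the value function, the rule shown to be optimal in `traderGain_eq`. -/
theorem traderGain_traderRule (ν : ℕ → ℝ) {k : ℕ} (hk : k ≤ T) (hν : ∀ j < T, 0 ≤ ν j) :
    traderGain ν k 1 (traderRule ν k 1 : (Fin T → ℕ) → ℕ) = traderValue T ν k 1 := by
  rw [traderValue_eq ν hk (Or.inl rfl) fun _ => hν,
    ← traderGain_eq ν hk (Or.inl rfl) fun _ => hν]
  congr 1
  funext x
  refine sInf_union_singleton_congr fun l hl => and_congr_right fun _ => ?_
  rw [traderValue_eq ν hl.le (traderRegime_eq k 1 l x) fun _ => hν]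

/-- The chain is still in the regime `1` when none of the first `l` independent increments is a
jump; their no-jump probabilities multiply. -/
theorem integral_up_traderRegime (ν : ℕ → ℝ) (hν : ∀ j < T, 0 ≤ ν j) (l : ℕ) (hl : l ≤ T) :
    ∫ x : Fin T → ℕ, up (traderRegime 0 1 l x) ∂(traderLaw T ν)
      = Real.exp (-∑ j ∈ Finset.range l, ν j) := by
  induction l with
  | zero => simp [traderRegime_self]
  | succ l ih =>
    have h := condExp_traderRegime_succ ν (k := 0) (i := 1) ⟨l, hl⟩ (Nat.zero_le _) up
    rw [← integral_condExp ((traderFiltration T).le l), integral_congr_ae h,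
      traderLaw_no_jump ν ⟨l, hl⟩ (hν l hl)]
    simp only [up_neg_one, mul_zero, add_zero]
    rw [integral_const_mul, ih (by omega), Finset.sum_range_succ, ← Real.exp_add]
    congr 1
    ring

theorem integral_dn_traderRegime (ν : ℕ → ℝ) (hν : ∀ j < T, 0 ≤ ν j) (l : ℕ) (hl : l ≤ T) :
    ∫ x : Fin T → ℕ, dn (traderRegime 0 1 l x) ∂(traderLaw T ν)
      = 1 - Real.exp (-∑ j ∈ Finset.range l, ν j) := by
  rw [← integral_up_traderRegime ν hν l hl]
  have : ∀ x : Fin T → ℕ, dn (traderRegime 0 1 l x) = 1 - up (traderRegime 0 1 l x) := by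
    intro x
    rcases traderRegime_eq 0 1 l x with e | e <;> simp [e]
  simp_rw [this]
  rw [integral_sub (integrable_const _) (integrable_regime ν 0 1 l up)]
  simp

end Trader

namespace Market

variable {Ω : Type*} [m0 : MeasurableSpace Ω] {μ : Measure Ω} (M : Market μ)

/-! ### The regime process -/

theorem I_eq (k : ℕ) (ω : Ω) : M.I k ω = 1 ∨ M.I k ω = -1 :=
  neg_one_pow_eq_or ℤ _

theorem measurable_N_filtration {j k : ℕ} (hjk : j ≤ k) : Measurable[M.𝓕 k] (M.N j) := by
  have h1 : MeasurableSpace.comap (M.N j) inferInstance ≤ M.𝓕 k := by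
    refine le_trans ?_ (le_sup_left : Filtration.natural M.N
      (fun k => (M.measurable_N k).stronglyMeasurable) k ≤ M.𝓕 k)
    exact le_iSup₂_of_le j hjk le_rfl
  intro s _
  exact h1 _ ⟨s, trivial, rfl⟩

theorem measurable_I_filtration {j k : ℕ} (hjk : j ≤ k) : Measurable[M.𝓕 k] (M.I j) :=
  (Measurable.of_discrete (f := fun n : ℕ => (-1 : ℤ) ^ n)).comp (M.measurable_N_filtration hjk)

/-- The increment of `N` after date `l`. -/
def incr (l : ℕ) (ω : Ω) : ℕ := M.N (l + 1) ω - M.N l ω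

theorem measurable_incr (l : ℕ) : Measurable (M.incr l) :=
  (M.measurable_N (l + 1)).sub (M.measurable_N l)

theorem N_eq_sum_incr {j : ℕ} (hj : j ≤ M.T) :
    ∀ᵐ ω ∂μ, M.N j ω = ∑ i ∈ Finset.range j, M.incr i ω := by
  induction j with
  | zero => simpa using M.N_zero
  | succ j ih =>
    filter_upwards [ih (by omega), M.N_mono j (by omega)] with ω h1 h2
    rw [Finset.sum_range_succ, ← h1, incr]
    omega

theorem I_zero : ∀ᵐ ω ∂μ, M.I 0 ω = 1 := by
  filter_upwards [M.N_zero] with ω h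
  simp [I, h]

/-- An even increment leaves the sign unchanged, an odd one reverses it. The statement is almost
sure because monotonicity of `N` is, and the increment is a truncated difference. -/
theorem I_succ {k : ℕ} (hk : k < M.T) :
    ∀ᵐ ω ∂μ, M.I (k + 1) ω = if Even (M.incr k ω) then M.I k ω else -M.I k ω := by
  filter_upwards [M.N_mono k hk] with ω h
  have : M.N (k + 1) ω = M.N k ω + M.incr k ω := by
    rw [incr]
    omega
  rw [I, this, pow_add]
  split_ifs with he
  · rw [he.neg_one_pow, mul_one]
    rfl
  · rw [(Nat.not_even_iff_odd.1 he).neg_one_pow, mul_neg_one]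
    rfl

theorem real_even_incr {k : ℕ} (hk : k < M.T) :
    μ.real {ω | Even (M.incr k ω)} = evenProb M.γ (k + 1) := by
  have h := poissonMeasure_real_even (M.γ k)
  rw [← M.law_incr k hk, show (fun ω => M.N (k + 1) ω - M.N k ω) = M.incr k from rfl,
    measureReal_def, Measure.map_apply (M.measurable_incr k) MeasurableSet.of_discrete,
    ← measureReal_def] at h
  exact h

theorem oddProb_eq (γ : ℕ → ℝ≥0) (l : ℕ) : oddProb γ l = 1 - evenProb γ l := by
  unfold oddProb evenProb
  ring

/-- Up to null events, the information at date `k` is that of the past increments. -/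
theorem filtration_le {k : ℕ} (hk : k ≤ M.T) :
    M.𝓕 k ≤ eventuallyMeasurableSpace (MeasurableSpace.comap
      (fun ω (i : (Finset.univ.filter fun i : Fin M.T => (i : ℕ) < k)) => M.incr i ω)
      MeasurableSpace.pi) (ae μ) := by
  refine sup_le (iSup₂_le fun j hj => ?_) (MeasurableSpace.generateFrom_le ?_)
  · rintro _ ⟨s, _, rfl⟩
    -- `N j` is replaced by the sum of the increments before `j`, to which it is almost surely
    -- equal.
    refine ⟨(fun ω => ∑ i : Fin M.T, if (i : ℕ) < j then M.incr i ω else 0) ⁻¹' s,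
      ⟨(fun y => ∑ i : Fin M.T, if h : (i : ℕ) < j then
        y ⟨i, by simp; omega⟩ else 0) ⁻¹' s, MeasurableSet.of_discrete, ?_⟩, ?_⟩
    · ext ω
      simp
    · refine Filter.eventuallyEq_set.2 ?_
      filter_upwards [M.N_eq_sum_incr (hj.trans hk)] with ω h
      have : ∑ i ∈ Finset.range j, M.incr i ω
          = ∑ i : Fin M.T, if (i : ℕ) < j then M.incr i ω else 0 := by
        rw [Fin.sum_univ_eq_sum_range (fun i => if i < j then M.incr i ω else 0),
          ← Finset.sum_filter]
        congr 1
        ext i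
        simp
        omega
      rw [Set.mem_preimage, Set.mem_preimage, h, this]
  · rintro s ⟨_, hs⟩
    -- A null event is almost everywhere equal to the empty set.
    exact ⟨∅, @MeasurableSet.empty _ (MeasurableSpace.comap _ _), by simpa [ae_eq_empty] using hs⟩

/-- An event of `𝓕 k` is almost everywhere an event of the increments before `k`, and the product
formula is insensitive to null sets. -/
theorem indep_incr_past {k : ℕ} (hk : k < M.T) (S : Set ℕ) (A : Set Ω)
    (hA : MeasurableSet[M.𝓕 k] A) :
    μ (A ∩ M.incr k ⁻¹' S) = μ A * μ (M.incr k ⁻¹' S) := by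
  obtain ⟨_, ⟨A', _, rfl⟩, hAA⟩ := M.filtration_le hk.le _ hA
  have h := M.indep_incr.indepFun_finset (Finset.univ.filter fun i : Fin M.T => (i : ℕ) < k)
    {⟨k, hk⟩} (by
      rw [Finset.disjoint_left]
      intro a ha hb
      rw [Finset.mem_singleton.1 hb] at ha
      simp at ha) (fun i => M.measurable_incr i)
  have h3 := h.measure_inter_preimage_eq_mul A' {y | y ⟨⟨k, hk⟩, by simp⟩ ∈ S}
    MeasurableSet.of_discrete MeasurableSet.of_discrete
  rw [measure_congr (hAA.inter (ae_eq_refl (M.incr k ⁻¹' S))), measure_congr hAA]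
  exact h3

/-! ### Functions of the path of the regime -/

/-- The path of the regime up to date `k`, as the set of the dates in the extreme regime. -/
def path (k : ℕ) (ω : Ω) : Finset ℕ := (Finset.range (k + 1)).filter fun j => M.I j ω = -1

theorem mem_path {k j : ℕ} {ω : Ω} : j ∈ M.path k ω ↔ j ≤ k ∧ M.I j ω = -1 := by
  simp [path]

theorem path_subset (k : ℕ) (ω : Ω) : M.path k ω ∈ (Finset.range (k + 1)).powerset := by
  simp [path]

theorem path_filter {j k : ℕ} (h : j ≤ k) (ω : Ω) :
    (M.path k ω).filter (· ≤ j) = M.path j ω := by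
  ext i
  simp only [Finset.mem_filter, mem_path]
  constructor
  · rintro ⟨⟨h1, h2⟩, h3⟩
    exact ⟨h3, h2⟩
  · rintro ⟨h1, h2⟩
    exact ⟨⟨h1.trans h, h2⟩, h1⟩

/-- The regime at date `j` along a path. -/
def regimeOf (j : ℕ) (s : Finset ℕ) : ℤ := if j ∈ s then -1 else 1

theorem I_eq_regimeOf {j k : ℕ} (h : j ≤ k) (ω : Ω) : M.I j ω = regimeOf j (M.path k ω) := by
  unfold regimeOf
  rcases M.I_eq j ω with e | e
  · rw [if_neg, e]
    rw [mem_path, e]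
    norm_num
  · rw [if_pos, e]
    exact M.mem_path.2 ⟨h, e⟩

theorem path_succ (k : ℕ) (ω : Ω) :
    M.path (k + 1) ω = if M.I (k + 1) ω = -1 then insert (k + 1) (M.path k ω) else M.path k ω := by
  ext j
  split_ifs with h
  · simp only [mem_path, Finset.mem_insert]
    constructor
    · rintro ⟨h1, h2⟩
      rcases Nat.le_succ_iff.1 h1 with h3 | h3
      · exact Or.inr ⟨h3, h2⟩
      · exact Or.inl h3
    · rintro (rfl | ⟨h1, h2⟩)
      · exact ⟨le_rfl, h⟩
      · exact ⟨by omega, h2⟩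
  · simp only [mem_path]
    constructor
    · rintro ⟨h1, h2⟩
      rcases Nat.le_succ_iff.1 h1 with h3 | rfl
      · exact ⟨h3, h2⟩
      · exact absurd h2 h
    · rintro ⟨h1, h2⟩
      exact ⟨by omega, h2⟩

theorem measurableSet_path (k : ℕ) (s : Finset ℕ) :
    MeasurableSet[M.𝓕 k] {ω | M.path k ω = s} := by
  have : {ω | M.path k ω = s} = ⋂ j : ℕ, {ω | j ∈ M.path k ω ↔ j ∈ s} := by
    ext ω
    simp [Finset.ext_iff]
  rw [this]
  refine MeasurableSet.iInter fun j => ?_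
  by_cases hj : j ≤ k
  · have h2 : MeasurableSet[M.𝓕 k] {ω | M.I j ω = -1} :=
      M.measurable_I_filtration hj (measurableSet_singleton _)
    by_cases hs : j ∈ s
    · have : {ω | j ∈ M.path k ω ↔ j ∈ s} = {ω | M.I j ω = -1} := by
        ext ω
        simp [mem_path, hj, hs]
      exact this ▸ h2
    · have : {ω | j ∈ M.path k ω ↔ j ∈ s} = {ω | M.I j ω = -1}ᶜ := by
        ext ω
        simp [mem_path, hj, hs]
      exact this ▸ h2.compl
  · simp [mem_path, hj]

theorem stronglyMeasurable_path (k : ℕ) (f : Finset ℕ → ℝ) :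
    StronglyMeasurable[M.𝓕 k] fun ω => f (M.path k ω) := by
  have h : Measurable[M.𝓕 k] fun ω => f (M.path k ω) := by
    intro t _
    have : (fun ω => f (M.path k ω)) ⁻¹' t
        = ⋃ s ∈ {s | f s ∈ t}, {ω | M.path k ω = s} := by
      ext ω
      simp
    rw [this]
    exact MeasurableSet.biUnion (Set.to_countable _) fun s _ => M.measurableSet_path k s
  exact h.stronglyMeasurable

/-- There are finitely many paths up to `k`, so any function of the path is bounded. -/
theorem integrable_path [IsProbabilityMeasure μ] (k : ℕ) (f : Finset ℕ → ℝ) :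
    Integrable (fun ω => f (M.path k ω)) μ :=
  Integrable.of_bound (((M.stronglyMeasurable_path k f).mono (M.𝓕.le k)).aestronglyMeasurable)
    (∑ s ∈ (Finset.range (k + 1)).powerset, |f s|) (ae_of_all _ fun ω =>
      Finset.single_le_sum (f := fun s => |f s|) (fun _ _ => abs_nonneg _) (M.path_subset k ω))

/-- One step of the regime process. -/
theorem condExp_path_step [IsProbabilityMeasure μ] {k : ℕ} (hk : k < M.T)
    (f : Finset ℕ → ℤ → ℝ) :
    μ[fun ω => f (M.path k ω) (M.I (k + 1) ω) | M.𝓕 k] =ᵐ[μ]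
      fun ω => evenProb M.γ (k + 1) * f (M.path k ω) (M.I k ω)
        + oddProb M.γ (k + 1) * f (M.path k ω) (-M.I k ω) := by
  have hstay : (fun ω => f (M.path k ω) (M.I k ω))
      = fun ω => (fun s => f s (regimeOf k s)) (M.path k ω) := by
    funext ω
    rw [M.I_eq_regimeOf le_rfl]
  have hflip : (fun ω => f (M.path k ω) (-M.I k ω))
      = fun ω => (fun s => f s (-regimeOf k s)) (M.path k ω) := by
    funext ω
    rw [M.I_eq_regimeOf le_rfl]
  -- The next regime chooses between staying and flipping according to the parity of an increment
  -- independent of `𝓕 k`; both outcomes are functions of the path.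
  have h := condExp_ite_of_indep (μ := μ) (M.𝓕.le k) (B := {ω | Even (M.incr k ω)})
    (M.measurable_incr k (MeasurableSet.of_discrete (s := {n | Even n})))
    (fun A hA => M.indep_incr_past hk {n | Even n} A hA)
    (a := fun ω => f (M.path k ω) (M.I k ω)) (b := fun ω => f (M.path k ω) (-M.I k ω))
    (hstay ▸ M.stronglyMeasurable_path k fun s => f s (regimeOf k s))
    (hflip ▸ M.stronglyMeasurable_path k fun s => f s (-regimeOf k s))
    (hstay ▸ M.integrable_path k fun s => f s (regimeOf k s))
    (hflip ▸ M.integrable_path k fun s => f s (-regimeOf k s))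
  rw [M.real_even_incr hk, ← oddProb_eq] at h
  refine (condExp_congr_ae ?_).trans h
  filter_upwards [M.I_succ hk] with ω hω
  rw [hω]
  by_cases he : Even (M.incr k ω) <;> simp [he]

theorem condExp_regime_step [IsProbabilityMeasure μ] {k : ℕ} (hk : k < M.T) (f : ℤ → ℝ) :
    μ[fun ω => f (M.I (k + 1) ω) | M.𝓕 k] =ᵐ[μ]
      fun ω => evenProb M.γ (k + 1) * f (M.I k ω) + oddProb M.γ (k + 1) * f (-M.I k ω) :=
  M.condExp_path_step hk fun _ => f

/-- `X` is almost surely a function of the path of the regime up to date `k`. -/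
def Known {β : Type*} (k : ℕ) (X : Ω → β) : Prop :=
  ∃ f : Finset ℕ → β, ∀ᵐ ω ∂μ, X ω = f (M.path k ω)

namespace Known

variable {M} {β β' β'' : Type*} {k n : ℕ}

theorem const (c : β) : M.Known k fun _ => c := ⟨fun _ => c, ae_of_all _ fun _ => rfl⟩

theorem congr {X Y : Ω → β} (hX : M.Known k X) (h : ∀ᵐ ω ∂μ, Y ω = X ω) : M.Known k Y := by
  obtain ⟨f, hf⟩ := hX
  refine ⟨f, ?_⟩
  filter_upwards [hf, h] with ω h1 h2
  rw [h2, h1]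

theorem map {X : Ω → β} (hX : M.Known k X) (g : β → β') : M.Known k fun ω => g (X ω) := by
  obtain ⟨f, hf⟩ := hX
  exact ⟨fun s => g (f s), hf.mono fun ω h => congrArg g h⟩

theorem map₂ {X : Ω → β} {Y : Ω → β'} (hX : M.Known k X) (hY : M.Known k Y)
    (g : β → β' → β'') : M.Known k fun ω => g (X ω) (Y ω) := by
  obtain ⟨f, hf⟩ := hX
  obtain ⟨f', hf'⟩ := hY
  refine ⟨fun s => g (f s) (f' s), ?_⟩
  filter_upwards [hf, hf'] with ω h1 h2
  rw [h1, h2]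

theorem mono {X : Ω → β} (hX : M.Known k X) (h : k ≤ n) : M.Known n X := by
  obtain ⟨f, hf⟩ := hX
  exact ⟨fun s => f (s.filter (· ≤ k)), hf.mono fun ω e => by
    simp only [M.path_filter h, e]⟩

theorem regime {j : ℕ} (h : j ≤ k) : M.Known k (M.I j) :=
  ⟨regimeOf j, ae_of_all _ fun ω => M.I_eq_regimeOf h ω⟩

theorem pi {ι : Type*} [Countable ι] {X : ι → Ω → β} (hX : ∀ j, M.Known k (X j)) :
    M.Known k fun ω j => X j ω := by
  choose f hf using hX
  exact ⟨fun s j => f j s, (ae_all_iff.2 hf).mono fun ω h => funext h⟩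

theorem add {X Y : Ω → ℝ} (hX : M.Known k X) (hY : M.Known k Y) :
    M.Known k fun ω => X ω + Y ω := hX.map₂ hY (· + ·)

theorem sub {X Y : Ω → ℝ} (hX : M.Known k X) (hY : M.Known k Y) :
    M.Known k fun ω => X ω - Y ω := hX.map₂ hY (· - ·)

theorem mul {X Y : Ω → ℝ} (hX : M.Known k X) (hY : M.Known k Y) :
    M.Known k fun ω => X ω * Y ω := hX.map₂ hY (· * ·)

theorem div {X Y : Ω → ℝ} (hX : M.Known k X) (hY : M.Known k Y) :
    M.Known k fun ω => X ω / Y ω := hX.map₂ hY (· / ·)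

theorem sum {ι : Type*} (S : Finset ι) {X : ι → Ω → ℝ} (hX : ∀ j ∈ S, M.Known k (X j)) :
    M.Known k fun ω => ∑ j ∈ S, X j ω := by
  classical
  induction S using Finset.induction_on with
  | empty => simpa using const (M := M) (0 : ℝ)
  | insert a S ha ih =>
    simp only [Finset.sum_insert ha]
    exact (hX a (Finset.mem_insert_self _ _)).add
      (ih fun j hj => hX j (Finset.mem_insert_of_mem hj))

open Classical in
theorem ite {p : Ω → Prop} {X Y : Ω → β} (hp : M.Known k p) (hX : M.Known k X)
    (hY : M.Known k Y) [∀ ω, Decidable (p ω)] : M.Known k fun ω => if p ω then X ω else Y ω :=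
  ((hp.map₂ (hX.map₂ hY Prod.mk) fun p q => if p then q.1 else q.2)).congr
    (ae_of_all _ fun ω => by simp only)

/-- A family of random variables evaluated at a random index. -/
theorem eval {X : ℕ → Ω → β} {τ : Ω → ℕ} {b : ℕ} (hτ : M.Known k τ)
    (hb : ∀ᵐ ω ∂μ, τ ω ≤ b) (hX : ∀ j ≤ b, M.Known k (X j)) :
    M.Known k fun ω => X (τ ω) ω := by
  -- Truncating the index makes the whole family known, including the dates beyond `b` about which
  -- nothing is assumed.
  have : ∀ j, M.Known k (X (min j b)) := fun j => hX _ (min_le_right _ _)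
  refine (hτ.map₂ (pi this) fun t x => x t).congr ?_
  filter_upwards [hb] with ω h
  rw [min_eq_left h]

theorem aestronglyMeasurable {X : Ω → ℝ} (hX : M.Known k X) :
    AEStronglyMeasurable[M.𝓕 k] X μ := by
  obtain ⟨f, hf⟩ := hX
  exact ⟨_, M.stronglyMeasurable_path k f, hf⟩

variable [IsProbabilityMeasure μ]

theorem integrable {X : Ω → ℝ} (hX : M.Known k X) : Integrable X μ := by
  obtain ⟨f, hf⟩ := hX
  exact (integrable_congr hf).2 (M.integrable_path k f)

theorem condExp_self {X : Ω → ℝ} (hX : M.Known k X) : μ[X | M.𝓕 k] =ᵐ[μ] X :=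
  condExp_of_aestronglyMeasurable' (M.𝓕.le k) hX.aestronglyMeasurable hX.integrable

/-- By the tower property it is enough to go from `n + 1` to `n`, and one step of the chain averages
two functions of the path up to `n`. The bound by `T` is needed because the increments are specified
only before `T`. -/
theorem condExp {X : Ω → ℝ} (hX : M.Known n X) (hn : n ≤ M.T) :
    M.Known k (μ[X | M.𝓕 k]) := by
  rcases le_total n k with h | h
  · exact (hX.mono h).congr (hX.mono h).condExp_self
  induction n, h using Nat.le_induction generalizing X with
  | base => exact hX.congr hX.condExp_self
  | succ n hkn ih =>
    obtain ⟨f, hf⟩ := hX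
    -- The longer path is the shorter one with or without the date `n + 1`, according to the next
    -- regime.
    have h1 : μ[X | M.𝓕 n] =ᵐ[μ] μ[fun ω => if M.I (n + 1) ω = -1 then f (insert (n + 1) (M.path n ω))
        else f (M.path n ω) | M.𝓕 n] := by
      refine condExp_congr_ae ?_
      filter_upwards [hf] with ω h
      rw [h, M.path_succ]
      split_ifs <;> rfl
    have h2 := h1.trans (M.condExp_path_step (k := n) (by omega)
      fun s i => if i = -1 then f (insert (n + 1) s) else f s)
    have h3 : M.Known n (μ[X | M.𝓕 n]) := by
      refine ⟨fun s => evenProb M.γ (n + 1) * (if regimeOf n s = -1 then f (insert (n + 1) s) else f s)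
        + oddProb M.γ (n + 1) * (if -regimeOf n s = -1 then f (insert (n + 1) s) else f s),
        h2.mono fun ω e => e.trans ?_⟩
      simp only [M.I_eq_regimeOf (le_refl n) ω]
    refine (ih h3 (by omega)).congr ?_
    exact (condExp_condExp_of_le (M.𝓕.mono hkn) (M.𝓕.le n)).symm

theorem condExp_mul {X Y : Ω → ℝ} (hX : M.Known k X) (hY : M.Known n Y) :
    μ[fun ω => X ω * Y ω | M.𝓕 k] =ᵐ[μ] fun ω => X ω * (μ[Y | M.𝓕 k]) ω :=
  condExp_mul_of_aestronglyMeasurable_left hX.aestronglyMeasurable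
    (((hX.mono (le_max_left k n)).mul (hY.mono (le_max_right k n))).integrable) hY.integrable

theorem condExp_add {X Y : Ω → ℝ} (hX : M.Known n X) (hY : M.Known n Y) :
    μ[fun ω => X ω + Y ω | M.𝓕 k] =ᵐ[μ] fun ω => (μ[X | M.𝓕 k]) ω + (μ[Y | M.𝓕 k]) ω :=
  MeasureTheory.condExp_add hX.integrable hY.integrable _

theorem condExp_sub {X Y : Ω → ℝ} (hX : M.Known n X) (hY : M.Known n Y) :
    μ[fun ω => X ω - Y ω | M.𝓕 k] =ᵐ[μ] fun ω => (μ[X | M.𝓕 k]) ω - (μ[Y | M.𝓕 k]) ω :=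
  MeasureTheory.condExp_sub hX.integrable hY.integrable _

theorem condExp_sum {ι : Type*} (S : Finset ι) {X : ι → Ω → ℝ} (hX : ∀ j ∈ S, M.Known n (X j)) :
    μ[fun ω => ∑ j ∈ S, X j ω | M.𝓕 k] =ᵐ[μ] fun ω => ∑ j ∈ S, (μ[X j | M.𝓕 k]) ω := by
  have h := condExp_finsetSum (μ := μ) (s := S) (f := X) (fun j hj => (hX j hj).integrable) (M.𝓕 k)
  convert h using 1
  · congr 1
    funext ω
    simp
  · funext ω
    simp

theorem condExp_le {X : Ω → ℝ} (hkn : k ≤ n) :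
    μ[μ[X | M.𝓕 n] | M.𝓕 k] =ᵐ[μ] μ[X | M.𝓕 k] :=
  condExp_condExp_of_le (M.𝓕.mono hkn) (M.𝓕.le n)

end Known

end Market

/-! ### The fair pricing function -/

theorem evenProb_nonneg (γ : ℕ → ℝ≥0) (l : ℕ) : 0 ≤ evenProb γ l := by
  unfold evenProb
  positivity

theorem oddProb_nonneg (γ : ℕ → ℝ≥0) (l : ℕ) : 0 ≤ oddProb γ l := by
  have : Real.exp (-2 * (γ (l - 1) : ℝ)) ≤ 1 :=
    Real.exp_le_one_iff.2 (by have := (γ (l - 1)).2; simp)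
  unfold oddProb
  linarith

theorem evenProb_sub_oddProb (γ : ℕ → ℝ≥0) (l : ℕ) :
    evenProb γ (l + 1) - oddProb γ (l + 1) = Real.exp (-2 * (γ l : ℝ)) := by
  simp only [evenProb, oddProb, Nat.add_sub_cancel]
  ring

theorem fairFn_terminal (γ : ℕ → ℝ≥0) (T : ℕ) (i : ℤ) : fairFn γ T T i = 0 := by
  rw [fairFn]
  simp

theorem fairFn_one (γ : ℕ → ℝ≥0) {T k : ℕ} (hk : k < T) :
    fairFn γ T k 1 = max 0 (-Real.exp (-2 * (γ k : ℝ)) + evenProb γ (k + 1) * fairFn γ T (k + 1) 1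
        + oddProb γ (k + 1) * fairFn γ T (k + 1) (-1)) := by
  rw [fairFn, if_pos hk, if_pos rfl]

theorem fairFn_neg_one (γ : ℕ → ℝ≥0) {T k : ℕ} (hk : k < T) :
    fairFn γ T k (-1) = Real.exp (-2 * (γ k : ℝ)) + oddProb γ (k + 1) * fairFn γ T (k + 1) 1
        + evenProb γ (k + 1) * fairFn γ T (k + 1) (-1) := by
  rw [fairFn, if_pos hk, if_neg (by norm_num)]

theorem fairFn_nonneg (γ : ℕ → ℝ≥0) {T k : ℕ} (hk : k ≤ T) :
    0 ≤ fairFn γ T k 1 ∧ 0 ≤ fairFn γ T k (-1) := by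
  induction hk using Nat.decreasingInduction with
  | self => simp [fairFn_terminal]
  | of_succ k hk ih =>
    rw [fairFn_one γ hk, fairFn_neg_one γ hk]
    refine ⟨le_max_left _ _, ?_⟩
    have := mul_nonneg (oddProb_nonneg γ (k + 1)) ih.1
    have := mul_nonneg (evenProb_nonneg γ (k + 1)) ih.2
    positivity

/-- The expected next coupon `exp (-2γ_k)` is positive and the continuation values are nonnegative.
So after the switch a zero of `Q` before `T` can occur only in the normal regime. -/
theorem fairFn_neg_one_pos (γ : ℕ → ℝ≥0) {T k : ℕ} (hk : k < T) : 0 < fairFn γ T k (-1) := by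
  obtain ⟨h1, h2⟩ := fairFn_nonneg γ (Nat.succ_le_of_lt hk)
  rw [fairFn_neg_one γ hk]
  have := mul_nonneg (oddProb_nonneg γ (k + 1)) h1
  have := mul_nonneg (evenProb_nonneg γ (k + 1)) h2
  positivity

/-- Two essential suprema dominate each other, so the chosen version does not matter. -/
theorem IsEssSup.essSupOf_ae_eq {Ω : Type*} [MeasurableSpace Ω] {μ : Measure Ω}
    {S : Set (Ω → ℝ)} {g : Ω → ℝ} (hg : IsEssSup μ S g) : essSupOf μ S =ᵐ[μ] g := by
  have h : ∃ g, IsEssSup μ S g := ⟨g, hg⟩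
  have h1 := h.choose_spec
  rw [essSupOf, dif_pos h]
  exact (h1.least g hg.measurable hg.upper).antisymm (hg.least _ h1.measurable h1.upper)

/-! ### The calibrated intensities -/

theorem normalPrice_lt_one (γ : ℕ → ℝ≥0) (k l : ℕ) : normalPrice γ k l < 1 := by
  have h := Real.exp_pos (-2 * ∑ j ∈ Finset.Ico k l, (γ j : ℝ))
  unfold normalPrice
  linarith

theorem normalPrice_mono (γ : ℕ → ℝ≥0) (k : ℕ) {l n : ℕ} (h : l ≤ n) :
    normalPrice γ k l ≤ normalPrice γ k n := by
  have h1 : ∑ j ∈ Finset.Ico k l, (γ j : ℝ) ≤ ∑ j ∈ Finset.Ico k n, (γ j : ℝ) :=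
    Finset.sum_le_sum_of_subset_of_nonneg (Finset.Ico_subset_Ico_right h) fun j _ _ => (γ j).2
  have h2 : Real.exp (-2 * ∑ j ∈ Finset.Ico k n, (γ j : ℝ))
      ≤ Real.exp (-2 * ∑ j ∈ Finset.Ico k l, (γ j : ℝ)) := Real.exp_le_exp.2 (by linarith)
  unfold normalPrice
  linarith

theorem normalPrice_of_le (γ : ℕ → ℝ≥0) {k l : ℕ} (h : l ≤ k) : normalPrice γ k l = 0 := by
  simp [normalPrice, Finset.Ico_eq_empty_of_le h]

/-- The cumulated intensity is set to `0` up to `k`, so only the prices at dates in `(k, T]` enter.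
-/
theorem calibIntensity_congr {p p' : ℕ → ℝ} {k T : ℕ} (h : ∀ l, k < l → l ≤ T → p l = p' l)
    {j : ℕ} (hj : j < T) : calibIntensity p k j = calibIntensity p' k j := by
  have hc : ∀ l ≤ T, (if l ≤ k then (0 : ℝ) else -Real.log (1 - p l))
      = if l ≤ k then (0 : ℝ) else -Real.log (1 - p' l) := by
    intro l hl
    split_ifs with h1
    · rfl
    · rw [h l (by omega) hl]
  simp only [calibIntensity, hc _ hj.le, hc _ (Nat.succ_le_of_lt hj)]

/-- The intensities of the trader's model calibrated at date `k` in the normal regime. -/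
noncomputable def normalIntensity (γ : ℕ → ℝ≥0) (k : ℕ) : ℕ → ℝ :=
  calibIntensity (normalPrice γ k) k

/-- The cut-off at `k` can be dropped: the closed-form price vanishes for `l ≤ k`, and so does its
logarithmic term. The intensities then telescope. -/
theorem normalIntensity_eq (γ : ℕ → ℝ≥0) (k j : ℕ) :
    normalIntensity γ k j
      = -Real.log (1 - normalPrice γ k (j + 1)) - -Real.log (1 - normalPrice γ k j) := by
  have hc : ∀ l, (if l ≤ k then (0 : ℝ) else -Real.log (1 - normalPrice γ k l))
      = -Real.log (1 - normalPrice γ k l) := by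
    intro l
    split_ifs with h1
    · simp [normalPrice_of_le γ h1]
    · rfl
  simp only [normalIntensity, calibIntensity, hc]

/-- Seen from the normal regime, the prices of the binary options increase with their maturity and
stay below `1`. -/
theorem normalIntensity_nonneg (γ : ℕ → ℝ≥0) (k j : ℕ) : 0 ≤ normalIntensity γ k j := by
  rw [normalIntensity_eq]
  have h1 := normalPrice_mono γ k (Nat.le_succ j)
  have h2 := normalPrice_lt_one γ k (j + 1)
  have := Real.log_le_log (by linarith : 0 < 1 - normalPrice γ k (j + 1))
    (by linarith : 1 - normalPrice γ k (j + 1) ≤ 1 - normalPrice γ k j)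
  linarith

/-- The calibration identity at date `0`: the trader's probability of no jump before `l` is the fair
probability of the normal regime at `l`. -/
theorem exp_neg_sum_normalIntensity (γ : ℕ → ℝ≥0) (l : ℕ) :
    Real.exp (-∑ j ∈ Finset.range l, normalIntensity γ 0 j) = 1 - normalPrice γ 0 l := by
  simp_rw [normalIntensity_eq]
  rw [Finset.sum_range_sub (fun j => -Real.log (1 - normalPrice γ 0 j)),
    normalPrice_of_le γ le_rfl]
  have := normalPrice_lt_one γ 0 l
  simp [Real.exp_log (by linarith : 0 < 1 - normalPrice γ 0 l)]

/-- The trader's price at date `k`, as a function of the regime. -/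
noncomputable def traderPrice (γ : ℕ → ℝ≥0) (T k : ℕ) (i : ℤ) : ℝ :=
  traderStateFn (normalIntensity γ k) T k i

theorem traderPrice_one (γ : ℕ → ℝ≥0) (T k : ℕ) :
    traderPrice γ T k 1 = traderFn (normalIntensity γ k) T k := by
  simp [traderPrice, traderStateFn]

/-- The numerator of the hedging ratio `a_0(l)`, in the trader's model with intensities `ν`. -/
noncomputable def traderNumA (ν : ℕ → ℝ) (T l : ℕ) : ℝ :=
  ∫ x : Fin T → ℕ, dn (traderRegime 0 1 l x) *
    (if l ≤ traderRule ν 0 1 x then 1 else 0) ∂(traderLaw T ν)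

/-- The numerator of the hedging ratio `b_0(l)`, in the trader's model with intensities `ν`. -/
noncomputable def traderNumB (ν : ℕ → ℝ) (T l : ℕ) : ℝ :=
  ∫ x : Fin T → ℕ, up (traderRegime 0 1 l x) *
    (if l ≤ traderRule ν 0 1 x then 1 else 0) ∂(traderLaw T ν)

theorem traderRule_congr {T : ℕ} {ν ν' : ℕ → ℝ} (h : ∀ j < T, ν j = ν' j) (k : ℕ) (i : ℤ) :
    (traderRule ν k i : (Fin T → ℕ) → ℕ) = traderRule ν' k i := by
  funext x
  simp only [traderRule, traderValue_congr h]

theorem dn_nonneg (i : ℤ) : 0 ≤ dn i := by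
  unfold dn
  split_ifs <;> norm_num

theorem integrable_regime_called (ν : ℕ → ℝ) (T l : ℕ) (h : ℤ → ℝ) (θ : (Fin T → ℕ) → ℕ) :
    Integrable (fun x : Fin T → ℕ => h (traderRegime 0 1 l x) * (if l ≤ θ x then 1 else 0))
      (traderLaw T ν) :=
  integrable_traderLaw ν (C := max |h 1| |h (-1)|) fun x => by
    rcases traderRegime_eq 0 1 l x with e | e <;> split_ifs <;> simp [e]

/-- In particular, the numerator of `a_0(l)` vanishes when its denominator does. -/
theorem traderNumA_div_mul (γ : ℕ → ℝ≥0) {T l : ℕ} (hl : l ≤ T) :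
    traderNumA (normalIntensity γ 0) T l / normalPrice γ 0 l * normalPrice γ 0 l
      = traderNumA (normalIntensity γ 0) T l := by
  refine div_mul_cancel_of_imp fun h0 => ?_
  have h1 : traderNumA (normalIntensity γ 0) T l ≤ normalPrice γ 0 l := by
    -- By calibration the trader's probability of the extreme regime at `l` is the market price; it
    -- dominates the numerator, whose integrand carries the extra factor `1_{l ≤ θ}`.
    have h2 := integral_dn_traderRegime (normalIntensity γ 0)
      (fun j _ => normalIntensity_nonneg γ 0 j) l hl
    rw [exp_neg_sum_normalIntensity, sub_sub_cancel] at h2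
    rw [← h2]
    refine integral_mono (integrable_regime_called _ _ _ _ _) (integrable_regime _ _ _ _ dn)
      fun x => ?_
    have := dn_nonneg (traderRegime 0 1 l x)
    simp only
    split_ifs <;> linarith
  refine le_antisymm (h0 ▸ h1) (integral_nonneg fun x => ?_)
  have := dn_nonneg (traderRegime 0 1 l x)
  simp only [Pi.zero_apply]
  split_ifs <;> linarith

/-- The terms are the trader's expected called coupons, so they add up to the gain of the trader's
rule, which is optimal in that model. -/
theorem sum_traderNum (γ : ℕ → ℝ≥0) (T : ℕ) :
    ∑ l ∈ Finset.Ioc 0 T, (traderNumA (normalIntensity γ 0) T l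
      - traderNumB (normalIntensity γ 0) T l) = traderPrice γ T 0 1 := by
  have hν : ∀ j < T, 0 ≤ normalIntensity γ 0 j := fun j _ => normalIntensity_nonneg γ 0 j
  rw [traderPrice, ← traderValue_eq (T := T) _ (Nat.zero_le T) (Or.inl rfl) fun _ => hν,
    ← traderGain_traderRule _ (Nat.zero_le T) hν, traderGain, integral_finsetSum]
  · refine Finset.sum_congr rfl fun l _ => ?_
    rw [traderNumA, traderNumB, ← integral_sub (integrable_regime_called _ _ _ _ _)
      (integrable_regime_called _ _ _ _ _)]
    simp_rw [sub_mul]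
  · intro l _
    exact integrable_regime_called _ _ _ (fun i => dn i - up i) _

/-! ### The fair callable value and its pricing function -/

namespace Market

variable {Ω : Type*} [m0 : MeasurableSpace Ω] {μ : Measure Ω} (M : Market μ)

theorem measurableSet_path_prop (k : ℕ) (p : Finset ℕ → Prop) :
    MeasurableSet[M.𝓕 k] {ω | p (M.path k ω)} := by
  have : {ω | p (M.path k ω)} = ⋃ s ∈ {s | p s}, {ω | M.path k ω = s} := by
    ext ω
    simp
  rw [this]
  exact MeasurableSet.biUnion (Set.to_countable _) fun s _ => M.measurableSet_path k s

theorem known_fun_regime (k : ℕ) (f : ℤ → ℝ) : M.Known k fun ω => f (M.I k ω) :=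
  (Known.regime le_rfl).map f

theorem stronglyMeasurable_fun_regime (k : ℕ) (f : ℤ → ℝ) :
    StronglyMeasurable[M.𝓕 k] fun ω => f (M.I k ω) := by
  have : (fun ω => f (M.I k ω)) = fun ω => (fun s => f (regimeOf k s)) (M.path k ω) := by
    funext ω
    rw [M.I_eq_regimeOf le_rfl]
  rw [this]
  exact M.stronglyMeasurable_path k fun s => f (regimeOf k s)

variable [IsProbabilityMeasure μ]

/-- The dynamic programming equation along the chain: the expected next coupon is `v - u = -exp
(-2γ_k)` in the normal regime and its opposite in the extreme one. As in the trader's model, the two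
parts serve the upper bound and the optimal rule. -/
theorem fairFn_step {k : ℕ} (hk : k < M.T) :
    ∀ᵐ ω ∂μ,
      (μ[fun ω => dn (M.I (k + 1) ω) - up (M.I (k + 1) ω)
        + fairFn M.γ M.T (k + 1) (M.I (k + 1) ω) | M.𝓕 k]) ω ≤ fairFn M.γ M.T k (M.I k ω) ∧
      (fairFn M.γ M.T k (M.I k ω) ≠ 0 →
      (μ[fun ω => dn (M.I (k + 1) ω) - up (M.I (k + 1) ω)
        + fairFn M.γ M.T (k + 1) (M.I (k + 1) ω) | M.𝓕 k]) ω = fairFn M.γ M.T k (M.I k ω)) := by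
  have h := M.condExp_regime_step hk fun i => dn i - up i + fairFn M.γ M.T (k + 1) i
  have huv := evenProb_sub_oddProb M.γ k
  filter_upwards [h] with ω hω
  rw [hω]
  rcases M.I_eq k ω with e | e
  · have h1 : evenProb M.γ (k + 1) * (dn 1 - up 1 + fairFn M.γ M.T (k + 1) 1)
        + oddProb M.γ (k + 1) * (dn (-1) - up (-1) + fairFn M.γ M.T (k + 1) (-1))
        = -Real.exp (-2 * (M.γ k : ℝ)) + evenProb M.γ (k + 1) * fairFn M.γ M.T (k + 1) 1
        + oddProb M.γ (k + 1) * fairFn M.γ M.T (k + 1) (-1) := by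
      rw [← huv]
      simp
      ring
    rw [e, h1, fairFn_one M.γ hk]
    refine ⟨le_max_right _ _, fun hne => ?_⟩
    rcases max_choice 0 (-Real.exp (-2 * (M.γ k : ℝ))
        + evenProb M.γ (k + 1) * fairFn M.γ M.T (k + 1) 1
        + oddProb M.γ (k + 1) * fairFn M.γ M.T (k + 1) (-1)) with h4 | h4
    · exact absurd h4 hne
    · exact h4.symm
  · have h1 : evenProb M.γ (k + 1) * (dn (-1) - up (-1) + fairFn M.γ M.T (k + 1) (-1))
        + oddProb M.γ (k + 1) * (dn (- -1) - up (- -1) + fairFn M.γ M.T (k + 1) (- -1))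
        = Real.exp (-2 * (M.γ k : ℝ)) + oddProb M.γ (k + 1) * fairFn M.γ M.T (k + 1) 1
        + evenProb M.γ (k + 1) * fairFn M.γ M.T (k + 1) (-1) := by
      rw [← huv]
      simp
      ring
    rw [e, h1, fairFn_neg_one M.γ hk]
    exact ⟨le_rfl, fun _ => rfl⟩

theorem fairFn_regime_nonneg {k : ℕ} (hk : k ≤ M.T) (ω : Ω) :
    0 ≤ fairFn M.γ M.T k (M.I k ω) := by
  rcases M.I_eq k ω with e | e
  · exact e ▸ (fairFn_nonneg M.γ hk).1
  · exact e ▸ (fairFn_nonneg M.γ hk).2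

/-- The first time after `k` when the fair pricing function vanishes. -/
noncomputable def firstWorthless (k : ℕ) (ω : Ω) : ℕ :=
  sInf ({l | k ≤ l ∧ fairFn M.γ M.T l (M.I l ω) = 0} ∪ {M.T})

theorem firstWorthless_stopping (k j : ℕ) :
    MeasurableSet[M.𝓕 j] {ω | M.firstWorthless k ω ≤ j} := by
  have : {ω | M.firstWorthless k ω ≤ j} = {ω | (fun s => (∃ l ≤ j, k ≤ l ∧
      fairFn M.γ M.T l (regimeOf l s) = 0) ∨ M.T ≤ j) (M.path j ω)} := by
    ext ω
    simp only [firstWorthless, sInf_union_singleton_le_iff, Set.mem_ofPred_eq]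
    refine or_congr (exists_congr fun l => and_congr_right fun hl => ?_) Iff.rfl
    rw [M.I_eq_regimeOf hl]
  rw [this]
  exact M.measurableSet_path_prop j fun s => (∃ l ≤ j, k ≤ l ∧
      fairFn M.γ M.T l (regimeOf l s) = 0) ∨ M.T ≤ j

/-- The fair callable value is given by the fair pricing function. -/
theorem Q_eq {k : ℕ} (hk : k ≤ M.T) : ∀ᵐ ω ∂μ, M.Q k ω = fairFn M.γ M.T k (M.I k ω) := by
  have hc : ∀ l, Integrable (fun ω => dn (M.I l ω) - up (M.I l ω)) μ := fun l =>
    (M.known_fun_regime l fun i => dn i - up i).integrable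
  have hV : ∀ l, Integrable (fun ω => fairFn M.γ M.T l (M.I l ω)) μ := fun l =>
    (M.known_fun_regime l _).integrable
  have hτk : ∀ ω, k ≤ M.firstWorthless k ω ∧ M.firstWorthless k ω ≤ M.T := fun ω =>
    ⟨le_sInf_union_singleton hk fun l hl => hl.1, sInf_union_singleton_le _ _⟩
  have hopt := condExp_stopped_sum_eq (μ := μ) (F := M.𝓕) (τ := M.firstWorthless k)
    (c := fun l ω => dn (M.I l ω) - up (M.I l ω)) (V := fun l ω => fairFn M.γ M.T l (M.I l ω)) hk
    (fun l _ _ => hc l) (fun l _ _ => hV l) (fun l _ _ => M.stronglyMeasurable_fun_regime l _)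
    (M.firstWorthless_stopping k) hτk
    (fun ω => by
      rcases sInf_union_singleton_spec
        (fun l => k ≤ l ∧ fairFn M.γ M.T l (M.I l ω) = 0) M.T with h | h
      · exact h.2
      · rw [firstWorthless, h]
        exact fairFn_terminal _ _ _)
    (fun l h1 h2 => (M.fairFn_step h2).mono fun ω hω hl =>
      hω.2 fun h0 => not_of_lt_sInf_union_singleton hl ⟨h1, h0⟩)
  -- The pricing function dominates every admissible gain, and it is itself such a gain, for the
  -- first time when it vanishes; hence it lies below any other bound.
  refine IsEssSup.essSupOf_ae_eq ⟨?_, ?_, ?_⟩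
  · exact ((M.stronglyMeasurable_fun_regime k _).mono (M.𝓕.le k)).measurable
  · rintro f ⟨τ, hτ, hτT, rfl⟩
    exact condExp_stopped_sum_le (μ := μ) (F := M.𝓕) (τ := τ)
      (c := fun l ω => dn (M.I l ω) - up (M.I l ω)) (V := fun l ω => fairFn M.γ M.T l (M.I l ω)) hk
      (fun l _ _ => hc l) (fun l _ _ => hV l) (fun l _ _ => M.stronglyMeasurable_fun_regime l _)
      (fun l _ hl ω => M.fairFn_regime_nonneg hl ω)
      (fun l _ h2 => (M.fairFn_step h2).mono fun ω hω => hω.1)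
      (fun j => by simpa using hτ j) hτT
  · intro h _ hh
    exact hopt.symm.le.trans (hh _ ⟨M.firstWorthless k, fun j => by
      simpa using M.firstWorthless_stopping k j, hτk, rfl⟩)

/-! ### Binary options and the trader's prices -/

/-- The conditional mean of the sign `I` is multiplied by `u - v = exp (-2γ_l)` at each step. -/
theorem binary_eq {k l : ℕ} (hkl : k ≤ l) (hl : l ≤ M.T) :
    ∀ᵐ ω ∂μ, M.binary k l ω =
      (1 - (M.I k ω : ℝ) * Real.exp (-2 * ∑ j ∈ Finset.Ico k l, (M.γ j : ℝ))) / 2 := by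
  induction l, hkl using Nat.le_induction with
  | base =>
    filter_upwards [(M.known_fun_regime k dn).condExp_self] with ω h
    rw [binary, h]
    rcases M.I_eq k ω with e | e <;> simp [e]
  | succ l hkl ih =>
    have h1 : μ[fun ω => dn (M.I (l + 1) ω) | M.𝓕 l] =ᵐ[μ] fun ω =>
        Real.exp (-2 * (M.γ l : ℝ)) * dn (M.I l ω) + oddProb M.γ (l + 1) := by
      filter_upwards [M.condExp_regime_step (k := l) (by omega) dn] with ω h
      rw [h, ← evenProb_sub_oddProb]
      rcases M.I_eq l ω with e | e <;> simp [e]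
    have h2 : μ[fun ω => Real.exp (-2 * (M.γ l : ℝ)) * dn (M.I l ω) + oddProb M.γ (l + 1) | M.𝓕 k]
        =ᵐ[μ] fun ω => Real.exp (-2 * (M.γ l : ℝ)) * M.binary k l ω + oddProb M.γ (l + 1) := by
      have h3 := (((Known.const (M := M) (k := k) (Real.exp (-2 * (M.γ l : ℝ)))).condExp_mul
        (M.known_fun_regime l dn)))
      have h4 := Known.condExp_add (k := k)
        ((M.known_fun_regime l dn).map (Real.exp (-2 * (M.γ l : ℝ)) * ·))
        (Known.const (M := M) (oddProb M.γ (l + 1)))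
      have h5 := (Known.const (M := M) (k := k) (oddProb M.γ (l + 1))).condExp_self
      filter_upwards [h3, h4, h5] with ω e3 e4 e5
      rw [e4, e3, e5]
      rfl
    have h6 : M.binary k (l + 1) =ᵐ[μ] _ :=
      (((Known.condExp_le (X := fun ω => dn (M.I (l + 1) ω)) hkl).symm.trans
        (condExp_congr_ae h1)).trans h2)
    filter_upwards [h6, ih (by omega)] with ω e1 e2
    rw [e1, e2, Finset.sum_Ico_succ_top hkl, mul_add, Real.exp_add]
    simp only [oddProb, Nat.add_sub_cancel]
    ring

theorem binary_normal {k l : ℕ} (hkl : k ≤ l) (hl : l ≤ M.T) :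
    ∀ᵐ ω ∂μ, M.I k ω = 1 → M.binary k l ω = normalPrice M.γ k l := by
  filter_upwards [M.binary_eq hkl hl] with ω h h1
  rw [h, h1, normalPrice]
  simp

theorem ν_normal {k : ℕ} :
    ∀ᵐ ω ∂μ, M.I k ω = 1 → ∀ j < M.T, M.ν k ω j = normalIntensity M.γ k j := by
  have h : ∀ᵐ ω ∂μ, ∀ l, k < l → l ≤ M.T → M.I k ω = 1 →
      M.binary k l ω = normalPrice M.γ k l := by
    refine ae_all_iff.2 fun l => ?_
    by_cases h1 : k < l ∧ l ≤ M.T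
    · filter_upwards [M.binary_normal h1.1.le h1.2] with ω hω _ _ using hω
    · exact ae_of_all _ fun ω h2 h3 => absurd ⟨h2, h3⟩ h1
  filter_upwards [h] with ω hω h1 j hj
  exact calibIntensity_congr (fun l h2 h3 => hω l h2 h3 h1) hj

/-- In the normal regime the calibrated intensities are the deterministic ones; in the extreme
regime they are irrelevant, since that state is absorbing for the trader. -/
theorem q_eq {k : ℕ} (hk : k ≤ M.T) :
    ∀ᵐ ω ∂μ, M.q k ω = traderPrice M.γ M.T k (M.I k ω) := by
  filter_upwards [M.ν_normal (k := k)] with ω h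
  rcases M.I_eq k ω with e | e
  · rw [q, e, traderValue_congr (h e), traderValue_eq _ hk (Or.inl rfl)
      fun _ j _ => normalIntensity_nonneg _ _ j]
    rfl
  · rw [q, e, traderValue_eq _ hk (Or.inr rfl) fun h => by norm_num at h]
    simp [traderPrice, traderStateFn]

theorem ratio_a_eq {l : ℕ} (hl : l ≤ M.T) : ∀ᵐ ω ∂μ,
    M.ratio_a 0 l ω = traderNumA (normalIntensity M.γ 0) M.T l / normalPrice M.γ 0 l := by
  filter_upwards [M.I_zero, M.ν_normal (k := 0), M.binary_normal (Nat.zero_le l) hl]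
    with ω h0 h1 h2
  rw [ratio_a, h0, h2 h0, traderLaw_congr (h1 h0), traderRule_congr (h1 h0)]
  rfl

theorem ratio_b_eq {l : ℕ} (hl : l ≤ M.T) : ∀ᵐ ω ∂μ,
    M.ratio_b 0 l ω = traderNumB (normalIntensity M.γ 0) M.T l / (1 - normalPrice M.γ 0 l) := by
  filter_upwards [M.I_zero, M.ν_normal (k := 0), M.binary_normal (Nat.zero_le l) hl]
    with ω h0 h1 h2
  rw [ratio_b, h0, h2 h0, traderLaw_congr (h1 h0), traderRule_congr (h1 h0)]
  rfl

theorem known_ratio_a {k l : ℕ} (hl : l ≤ M.T) : M.Known k (M.ratio_a 0 l) :=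
  (Known.const _).congr (M.ratio_a_eq hl)

theorem known_ratio_b {k l : ℕ} (hl : l ≤ M.T) : M.Known k (M.ratio_b 0 l) :=
  (Known.const _).congr (M.ratio_b_eq hl)

theorem up_eq_one_sub_dn (k : ℕ) (ω : Ω) : up (M.I k ω) = 1 - dn (M.I k ω) := by
  rcases M.I_eq k ω with e | e <;> simp [e]

/-- The cash flow at date `l` of the initial static hedge. -/
theorem known_badFlow {l : ℕ} (hl : l ≤ M.T) :
    M.Known l fun ω => M.ratio_a 0 l ω * dn (M.I l ω) - M.ratio_b 0 l ω * up (M.I l ω) :=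
  ((M.known_ratio_a hl).mul (M.known_fun_regime l dn)).sub
    ((M.known_ratio_b hl).mul (M.known_fun_regime l up))

/-- The initial static hedge replicates the trader's price. -/
theorem Pbad_zero : ∀ᵐ ω ∂μ, M.Pbad 0 ω = M.q 0 ω := by
  have hB : ∀ l ∈ Finset.Ioc 0 M.T, ∀ᵐ ω ∂μ,
      (μ[fun ω => M.ratio_a 0 l ω * dn (M.I l ω) - M.ratio_b 0 l ω * up (M.I l ω) | M.𝓕 0]) ω
        = traderNumA (normalIntensity M.γ 0) M.T l - traderNumB (normalIntensity M.γ 0) M.T l := by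
    intro l hl
    have hlT := (Finset.mem_Ioc.1 hl).2
    have h1 := (M.known_ratio_a (k := 0) hlT).condExp_mul (M.known_fun_regime l dn)
    have h2 := (M.known_ratio_b (k := 0) hlT).condExp_mul (M.known_fun_regime l up)
    have h3 := Known.condExp_sub (k := 0)
      (((M.known_ratio_a hlT).mul (M.known_fun_regime l dn)))
      ((M.known_ratio_b hlT).mul (M.known_fun_regime l up))
    have h4 : μ[fun ω => up (M.I l ω) | M.𝓕 0] =ᵐ[μ] fun ω => 1 - M.binary 0 l ω := by
      have h5 := Known.condExp_sub (k := 0) (Known.const (M := M) (k := l) (1 : ℝ))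
        (M.known_fun_regime l dn)
      have h6 := (Known.const (M := M) (k := 0) (1 : ℝ)).condExp_self
      simp_rw [M.up_eq_one_sub_dn]
      filter_upwards [h5, h6] with ω e5 e6
      rw [e5, e6]
      rfl
    filter_upwards [h1, h2, h3, h4, M.I_zero, M.binary_normal (Nat.zero_le l) hlT,
      M.ratio_a_eq hlT, M.ratio_b_eq hlT] with ω e1 e2 e3 e4 e5 e6 e7 e8
    have e9 : (μ[fun ω => dn (M.I l ω) | M.𝓕 0]) ω = normalPrice M.γ 0 l := e6 e5
    -- The hedging ratios are divided by the fair prices of the very options they multiply, so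
    -- valuation restores the trader's numerators. Where `P_0(l) = 0`, the numerator of `a_0(l)`
    -- vanishes too.
    rw [e3, e1, e2, e4, e9, e6 e5, e7, e8, traderNumA_div_mul M.γ hlT, div_mul_cancel₀]
    have := normalPrice_lt_one M.γ 0 l
    linarith
  have hsum := Known.condExp_sum (M := M) (k := 0) (n := M.T) (Finset.Ioc 0 M.T)
    fun l hl => (M.known_badFlow (Finset.mem_Ioc.1 hl).2).mono (Finset.mem_Ioc.1 hl).2
  filter_upwards [hsum, (Finset.eventually_all _).2 hB, M.q_eq (Nat.zero_le _), M.I_zero]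
    with ω e1 e2 e3 e4
  rw [Pbad, e1, Finset.sum_congr rfl e2, sum_traderNum, e3, e4]

end Market

/-! ### The transition probabilities between the partition events -/

/-- The value of `transProb` before the first visit to the extreme regime. -/
noncomputable def probBefore (γ : ℕ → ℝ≥0) (T : ℕ) (q : ℕ × ℕ) (k : ℕ) : ℝ :=
  if q.1 = T + 1 then ∏ r ∈ Finset.Icc (k + 1) T, evenProb γ r
  else if q.1 ≤ k then 0
  else if q.2 = T + 1 then
    (∏ r ∈ Finset.Ico (k + 1) q.1, evenProb γ r) * oddProb γ q.1 *
      ∏ r ∈ Finset.Icc (q.1 + 1) T, evenProb γ r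
  else (∏ r ∈ Finset.Ico (k + 1) q.1, evenProb γ r) * oddProb γ q.1 *
        (∏ r ∈ Finset.Ico (q.1 + 1) q.2, evenProb γ r) * oddProb γ q.2

/-- The value of `transProb` during the first visit to the extreme regime, started at date `l`. -/
noncomputable def probDuring (γ : ℕ → ℝ≥0) (T : ℕ) (q : ℕ × ℕ) (k l : ℕ) : ℝ :=
  if q.1 = T + 1 ∨ l ≠ q.1 then 0
  else if q.2 = T + 1 then ∏ r ∈ Finset.Icc (k + 1) T, evenProb γ r
  else if q.2 ≤ k then 0
  else (∏ r ∈ Finset.Ico (k + 1) q.2, evenProb γ r) * oddProb γ q.2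

/-- This lemma and the next two split the closed formula by the phase at date `k`: before the first
visit to the extreme regime, during it, and after it. Before it, nothing distinguishes the indices
`p`, so the weight depends on `q` and `k` only. -/
theorem transProb_of_lt (γ : ℕ → ℝ≥0) {T k : ℕ} {p q : ℕ × ℕ} (hk : k < p.1) (hkT : k ≤ T)
    (hq : q.1 < q.2 ∨ q = (T + 1, T + 1)) : transProb γ T k p q = probBefore γ T q k := by
  obtain ⟨l, m⟩ := p
  obtain ⟨lam, mu⟩ := q
  simp only [Prod.mk.injEq] at hk hq
  unfold transProb probBefore
  dsimp only
  have h1 : ∀ c : Prop, (k < min l lam ∨ min l lam ≤ k ∧ l = lam ∧ c) ↔ k < lam := by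
    intro c
    simp only [lt_min_iff, min_le_iff]
    constructor
    · rintro (h | ⟨h, rfl, _⟩)
      · exact h.2
      · omega
    · exact fun h => Or.inl ⟨hk, h⟩
  simp only [h1, hk, if_true]
  by_cases h2 : lam = T + 1
  · simp [h2]
  · simp only [h2, if_false]
    by_cases h3 : k < lam
    · simp only [h3, not_le.2 h3, if_true, if_false]
      have h4 : ¬ mu ≤ k := by omega
      simp only [h4, if_false]
    · simp [h3, not_lt.1 h3]

theorem transProb_of_le_of_lt (γ : ℕ → ℝ≥0) {T k : ℕ} {p q : ℕ × ℕ} (hk : p.1 ≤ k) (hkm : k < p.2)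
    (hq : q.1 < q.2 ∨ q = (T + 1, T + 1)) : transProb γ T k p q = probDuring γ T q k p.1 := by
  obtain ⟨l, m⟩ := p
  obtain ⟨lam, mu⟩ := q
  simp only [Prod.mk.injEq] at hk hkm hq
  unfold transProb probDuring
  dsimp only
  by_cases h2 : lam = T + 1
  · simp [h2, not_lt.2 hk]
  by_cases h3 : l = lam
  · subst h3
    by_cases h4 : mu = T + 1
    · simp [h2, h4, hk, hkm]
    -- If `mu ≤ k < m`, the visit has already outlasted `mu`, so the event with index `(l, mu)` is
    -- excluded.
    · by_cases h5 : mu ≤ k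
      · have h6 : m ≠ mu := by omega
        simp [h2, h4, h5, h6, not_lt.2 hk]
      · simp [h2, h4, h5, hk, hkm, not_le.1 h5]
  · have h7 : ¬ k < min l lam := by
      rw [lt_min_iff]
      omega
    simp [h2, h3, h7]

/-- Both dates of the visit have been observed, so the partition event is known and the weight is an
indicator. -/
theorem transProb_of_le (γ : ℕ → ℝ≥0) {T k : ℕ} {p q : ℕ × ℕ} (hp : p.1 ≤ p.2) (hk : p.2 ≤ k)
    (hkT : k ≤ T) (hq : q.1 < q.2 ∨ q = (T + 1, T + 1)) :
    transProb γ T k p q = if p = q then 1 else 0 := by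
  obtain ⟨l, m⟩ := p
  obtain ⟨lam, mu⟩ := q
  simp only [Prod.mk.injEq] at hk hp hq ⊢
  unfold transProb
  dsimp only
  have h7 : ¬ k < min l lam := by
    rw [lt_min_iff]
    omega
  have h8 : ¬ k < min m mu := by
    rw [lt_min_iff]
    omega
  have h9 : ¬ k < l := by omega
  have h10 : ¬ k < m := by omega
  by_cases h2 : lam = T + 1
  · rw [if_pos h2, if_neg h9, if_neg]
    omega
  · rw [if_neg h2]
    by_cases h3 : l = lam
    · subst h3
      by_cases h4 : m = mu
      · subst h4
        have h5 : m ≠ T + 1 := by omega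
        simp [h5, hk, hp.trans hk]
      · have : ¬ (k < min l l ∨ min l l ≤ k ∧ l = l ∧
            (k < min m mu ∨ min m mu ≤ k ∧ m = mu)) := by tauto
        simp [h4, h10, not_lt.2 (hp.trans hk), h8]
    · simp [h3, h7]

theorem prod_Icc_succ_bot {k T : ℕ} (hk : k < T) (f : ℕ → ℝ) :
    ∏ r ∈ Finset.Icc (k + 1) T, f r = f (k + 1) * ∏ r ∈ Finset.Icc (k + 1 + 1) T, f r := by
  have h : ∀ a, Finset.Icc a T = Finset.Ico a (T + 1) := fun a => by
    ext
    simp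
  rw [h, h, Finset.prod_eq_prod_Ico_succ_bot (by omega)]

/-- First-step analysis: stay in the normal regime, or enter the extreme one with `k + 1` as first
date of the visit. -/
theorem probBefore_step (γ : ℕ → ℝ≥0) {T k : ℕ} {q : ℕ × ℕ} (hk : k < T)
    (hq : q.1 < q.2 ∨ q = (T + 1, T + 1)) :
    probBefore γ T q k = evenProb γ (k + 1) * probBefore γ T q (k + 1)
      + oddProb γ (k + 1) * probDuring γ T q (k + 1) (k + 1) := by
  obtain ⟨lam, mu⟩ := q
  simp only [Prod.mk.injEq] at hq
  unfold probBefore probDuring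
  dsimp only
  have hI : ∏ r ∈ Finset.Icc (k + 1) T, evenProb γ r
      = evenProb γ (k + 1) * ∏ r ∈ Finset.Icc (k + 1 + 1) T, evenProb γ r :=
    prod_Icc_succ_bot hk _
  by_cases h1 : lam = T + 1
  · simp [h1, hI]
  rcases lt_trichotomy lam (k + 1) with h2 | h2 | h2
  · simp [h1, (show lam ≤ k by omega), (show lam ≤ k + 1 by omega), h2.ne']
  · subst h2
    have h3 : ¬ mu ≤ k + 1 := by omega
    simp [h3, hk.ne, mul_assoc]
  · have h3 : ¬ lam ≤ k := by omega
    have h4 : ¬ lam ≤ k + 1 := by omega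
    have hJ : ∏ r ∈ Finset.Ico (k + 1) lam, evenProb γ r
        = evenProb γ (k + 1) * ∏ r ∈ Finset.Ico (k + 1 + 1) lam, evenProb γ r :=
      Finset.prod_eq_prod_Ico_succ_bot h2 _
    simp only [h1, h3, h4, h2.ne, if_false, hJ, Ne, not_false_eq_true, or_true, if_true, mul_zero,
      add_zero]
    split_ifs <;> ring

/-- First-step analysis during the visit: it goes on, or it ends at `k + 1`, which settles the
partition event. -/
theorem probDuring_step (γ : ℕ → ℝ≥0) {T k l : ℕ} {q : ℕ × ℕ} (hk : k < T) (hl : l ≤ k)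
    (hq : q.1 < q.2 ∨ q = (T + 1, T + 1)) :
    probDuring γ T q k l = evenProb γ (k + 1) * probDuring γ T q (k + 1) l
      + oddProb γ (k + 1) * (if (l, k + 1) = q then 1 else 0) := by
  obtain ⟨lam, mu⟩ := q
  simp only [Prod.mk.injEq] at hq ⊢
  unfold probDuring
  dsimp only
  have hI : ∏ r ∈ Finset.Icc (k + 1) T, evenProb γ r
      = evenProb γ (k + 1) * ∏ r ∈ Finset.Icc (k + 1 + 1) T, evenProb γ r :=
    prod_Icc_succ_bot hk _
  by_cases h1 : lam = T + 1
  · have : l ≠ T + 1 := by omega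
    simp [h1, this]
  by_cases h2 : l = lam
  · subst h2
    by_cases h3 : mu = T + 1
    · simp [h1, h3, hI, hk.ne]
    · rcases lt_trichotomy mu (k + 1) with h4 | h4 | h4
      · simp [h3, (show mu ≤ k by omega), (show mu ≤ k + 1 by omega), h4.ne']
      · subst h4
        simp [h1, hk.ne]
      · have hJ : ∏ r ∈ Finset.Ico (k + 1) mu, evenProb γ r
            = evenProb γ (k + 1) * ∏ r ∈ Finset.Ico (k + 1 + 1) mu, evenProb γ r :=
          Finset.prod_eq_prod_Ico_succ_bot h4 _
        simp [h1, h3, (show ¬ mu ≤ k by omega), (show ¬ mu ≤ k + 1 by omega), h4.ne, hJ, mul_assoc]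
  · simp [h2]

theorem mem_indexSet {T : ℕ} {p : ℕ × ℕ} :
    p ∈ indexSet T ↔ (1 ≤ p.1 ∧ p.1 < p.2 ∧ p.2 ≤ T + 1) ∨ p = (T + 1, T + 1) := by
  obtain ⟨l, m⟩ := p
  simp only [indexSet, Finset.mem_filter, Finset.mem_product, Finset.mem_Icc, Prod.mk.injEq]
  omega

theorem lt_or_eq_of_mem_indexSet {T : ℕ} {p : ℕ × ℕ} (hp : p ∈ indexSet T) :
    p.1 < p.2 ∨ p = (T + 1, T + 1) := by
  rcases mem_indexSet.1 hp with h | h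
  · exact Or.inl h.2.1
  · exact Or.inr h

namespace Market

variable {Ω : Type*} [m0 : MeasurableSpace Ω] {μ : Measure Ω} (M : Market μ)

/-! ### The partition -/

/-- The first date in the extreme regime (`T + 1` if there is none). -/
noncomputable def firstDown (ω : Ω) : ℕ := sInf ({j | M.I j ω = -1} ∪ {M.T + 1})

/-- The first date back in the normal regime (`T + 1` if there is none). -/
noncomputable def firstBack (ω : Ω) : ℕ :=
  sInf ({j | M.firstDown ω ≤ j ∧ M.I j ω = 1} ∪ {M.T + 1})

theorem I_ne_neg_one {k : ℕ} {ω : Ω} : M.I k ω ≠ -1 ↔ M.I k ω = 1 := by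
  rcases M.I_eq k ω with e | e <;> rw [e] <;> norm_num

theorem I_of_lt_firstDown {j : ℕ} {ω : Ω} (h : j < M.firstDown ω) : M.I j ω = 1 :=
  M.I_ne_neg_one.1 (not_of_lt_sInf_union_singleton h)

theorem I_of_lt_firstBack {j : ℕ} {ω : Ω} (h1 : M.firstDown ω ≤ j) (h : j < M.firstBack ω) :
    M.I j ω = -1 := by
  rcases M.I_eq j ω with e | e
  · exact absurd ⟨h1, e⟩ (not_of_lt_sInf_union_singleton h)
  · exact e

theorem firstDown_le (ω : Ω) : M.firstDown ω ≤ M.T + 1 := sInf_union_singleton_le _ _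

theorem firstBack_le (ω : Ω) : M.firstBack ω ≤ M.T + 1 := sInf_union_singleton_le _ _

theorem firstDown_le_of {j : ℕ} {ω : Ω} (h : M.I j ω = -1) : M.firstDown ω ≤ j :=
  Nat.sInf_le (Or.inl h)

theorem firstBack_le_of {j : ℕ} {ω : Ω} (h1 : M.firstDown ω ≤ j) (h : M.I j ω = 1) :
    M.firstBack ω ≤ j :=
  Nat.sInf_le (Or.inl ⟨h1, h⟩)

theorem firstDown_spec {ω : Ω} (h : M.firstDown ω ≤ M.T) : M.I (M.firstDown ω) ω = -1 := by
  rcases sInf_union_singleton_spec (fun j => M.I j ω = -1) (M.T + 1) with h1 | h1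
  · exact h1
  · rw [firstDown, h1] at h
    omega

theorem firstBack_spec {ω : Ω} (h : M.firstBack ω ≤ M.T) : M.I (M.firstBack ω) ω = 1 := by
  rcases sInf_union_singleton_spec (fun j => M.firstDown ω ≤ j ∧ M.I j ω = 1) (M.T + 1)
    with h1 | h1
  · exact h1.2
  · rw [firstBack, h1] at h
    omega

theorem firstDown_le_firstBack (ω : Ω) : M.firstDown ω ≤ M.firstBack ω :=
  le_sInf_union_singleton (M.firstDown_le ω) fun _ h => h.1

theorem firstDown_lt_firstBack {ω : Ω} (h : M.firstDown ω ≤ M.T) :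
    M.firstDown ω < M.firstBack ω := by
  refine lt_of_le_of_ne (M.firstDown_le_firstBack ω) fun he => ?_
  have h1 := M.firstDown_spec h
  rw [he, M.firstBack_spec (he ▸ h)] at h1
  norm_num at h1

/-- The index of the partition event. -/
noncomputable def index (ω : Ω) : ℕ × ℕ := (M.firstDown ω, M.firstBack ω)

theorem one_le_firstDown {ω : Ω} (h0 : M.I 0 ω = 1) : 1 ≤ M.firstDown ω := by
  refine le_sInf_union_singleton (by omega) fun l hl => Nat.one_le_iff_ne_zero.2 ?_
  rintro rfl
  rw [h0] at hl
  norm_num at hl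

theorem index_mem {ω : Ω} (h0 : M.I 0 ω = 1) : M.index ω ∈ indexSet M.T := by
  refine mem_indexSet.2 ?_
  have h1 := M.one_le_firstDown h0
  have h2 := M.firstDown_le ω
  have h3 := M.firstBack_le ω
  have h4 := M.firstDown_le_firstBack ω
  by_cases h : M.firstDown ω ≤ M.T
  · exact Or.inl ⟨h1, M.firstDown_lt_firstBack h, h3⟩
  · refine Or.inr (Prod.ext ?_ ?_) <;> simp only [index] <;> omega

theorem mem_part_index {ω : Ω} : ω ∈ M.part (M.index ω) := by
  refine fun j hj => ⟨fun h => M.I_of_lt_firstDown h, fun h => M.I_of_lt_firstBack h.1 h.2, ?_⟩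
  rintro rfl
  exact M.firstBack_spec hj

theorem index_eq_of_mem_part {p : ℕ × ℕ} (hp : p ∈ indexSet M.T) {ω : Ω} (h : ω ∈ M.part p) :
    M.index ω = p := by
  have hp' := mem_indexSet.1 hp
  have hp1 : p.1 ≤ M.T + 1 := by
    rcases hp' with hp' | hp' <;> [omega; simp [hp']]
  have hp2 : p.2 ≤ M.T + 1 := by
    rcases hp' with hp' | hp' <;> [omega; simp [hp']]
  have h12 : p.1 ≤ p.2 := by
    rcases hp' with hp' | hp' <;> [omega; simp [hp']]
  have e1 : M.firstDown ω = p.1 := by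
    refine le_antisymm ?_ (le_sInf_union_singleton hp1 fun l hl => ?_)
    · by_cases h1 : p.1 ≤ M.T
      · refine M.firstDown_le_of ((h p.1 h1).2.1 ⟨le_rfl, ?_⟩)
        rcases hp' with hp' | hp'
        · exact hp'.2.1
        · rw [hp'] at h1
          simp at h1
      · have := M.firstDown_le ω
        omega
    · by_contra hlt
      have := (h l (by omega)).1 (by omega)
      rw [this] at hl
      norm_num at hl
  refine Prod.ext e1 (le_antisymm ?_ (le_sInf_union_singleton hp2 fun l hl => ?_))
  · by_cases h1 : p.2 ≤ M.T
    · exact M.firstBack_le_of (e1.le.trans h12) ((h p.2 h1).2.2 rfl)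
    · have := M.firstBack_le ω
      simp only [index]
      omega
  · by_contra hlt
    have h3 := (h l (by omega)).2.1 ⟨e1 ▸ hl.1, by omega⟩
    rw [hl.2] at h3
    norm_num at h3

theorem mem_part_iff {p : ℕ × ℕ} (hp : p ∈ indexSet M.T) {ω : Ω} :
    ω ∈ M.part p ↔ M.index ω = p :=
  ⟨M.index_eq_of_mem_part hp, fun h => h ▸ M.mem_part_index⟩

theorem known_part (p : ℕ × ℕ) : M.Known M.T fun ω => ω ∈ M.part p := by
  refine ⟨fun s => ∀ j ≤ M.T, (j < p.1 → regimeOf j s = 1) ∧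
    (p.1 ≤ j ∧ j < p.2 → regimeOf j s = -1) ∧ (j = p.2 → regimeOf j s = 1),
    ae_of_all _ fun ω => propext ?_⟩
  refine forall₂_congr fun j hj => ?_
  rw [M.I_eq_regimeOf hj]

theorem measurableSet_part (p : ℕ × ℕ) : MeasurableSet (M.part p) := by
  have : M.part p = {ω | (fun s => ∀ j ≤ M.T, (j < p.1 → regimeOf j s = 1) ∧
    (p.1 ≤ j ∧ j < p.2 → regimeOf j s = -1) ∧ (j = p.2 → regimeOf j s = 1)) (M.path M.T ω)} := by
    ext ω
    refine forall₂_congr fun j hj => ?_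
    rw [M.I_eq_regimeOf hj]
  rw [this]
  exact M.𝓕.le M.T _ (M.measurableSet_path_prop M.T fun s => ∀ j ≤ M.T,
    (j < p.1 → regimeOf j s = 1) ∧ (p.1 ≤ j ∧ j < p.2 → regimeOf j s = -1) ∧
    (j = p.2 → regimeOf j s = 1))

/-- On a partition event the path is determined until the return to the normal regime. -/
theorem path_of_mem_part {p : ℕ × ℕ} {k : ℕ} (hk : k ≤ M.T) (hkp : k ≤ p.2) {ω : Ω}
    (h : ω ∈ M.part p) :
    M.path k ω = (Finset.range (k + 1)).filter fun j => p.1 ≤ j ∧ j < p.2 := by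
  refine Finset.filter_congr fun j hj => ?_
  have hjk : j ≤ k := by simpa [Nat.lt_succ_iff] using hj
  obtain ⟨h1, h2, h3⟩ := h j (hjk.trans hk)
  constructor
  · intro e
    rw [e] at h1 h3
    norm_num at h1 h3
    omega
  · exact h2

/-- The path is determined on the partition event as long as `k` does not exceed the date of return.
-/
theorem Known.const_on_part {M : Market μ} {β : Type*} {k : ℕ} {X : Ω → β} (hX : M.Known k X)
    {p : ℕ × ℕ} (hk : k ≤ M.T) (hkp : k ≤ p.2) : ∃ c, ∀ᵐ ω ∂μ, ω ∈ M.part p → X ω = c := by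
  obtain ⟨f, hf⟩ := hX
  exact ⟨_, hf.mono fun ω e h => by rw [e, M.path_of_mem_part hk hkp h]⟩

/-- The value at date `k` of the conditional probability of a partition event. -/
noncomputable def partProb (q : ℕ × ℕ) (k : ℕ) (ω : Ω) : ℝ :=
  if k < M.firstDown ω then probBefore M.γ M.T q k
  else if k < M.firstBack ω then probDuring M.γ M.T q k (M.firstDown ω)
  else if M.index ω = q then 1 else 0

theorem partProb_eq {q : ℕ × ℕ} (hq : q ∈ indexSet M.T) {k : ℕ} (hk : k ≤ M.T) (ω : Ω) :
    M.partProb q k ω = transProb M.γ M.T k (M.index ω) q := by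
  have hq' := lt_or_eq_of_mem_indexSet hq
  unfold partProb
  split_ifs with h1 h2 h3
  · exact (transProb_of_lt M.γ (p := M.index ω) h1 hk hq').symm
  · exact (transProb_of_le_of_lt M.γ (p := M.index ω) (not_lt.1 h1) h2 hq').symm
  · rw [transProb_of_le M.γ (p := M.index ω) (M.firstDown_le_firstBack ω) (not_lt.1 h2) hk hq', if_pos h3]
  · rw [transProb_of_le M.γ (p := M.index ω) (M.firstDown_le_firstBack ω) (not_lt.1 h2) hk hq', if_neg h3]

theorem partProb_terminal {q : ℕ × ℕ} (hq : q ∈ indexSet M.T) {ω : Ω} :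
    M.partProb q M.T ω = (M.part q).indicator (fun _ => (1 : ℝ)) ω := by
  have hq' := mem_indexSet.1 hq
  have h2 := M.firstDown_le ω
  have h3 := M.firstBack_le ω
  have h4 := M.firstDown_le_firstBack ω
  have hind : (M.part q).indicator (fun _ => (1 : ℝ)) ω = if M.index ω = q then 1 else 0 := by
    by_cases h : M.index ω = q
    · rw [if_pos h, Set.indicator_of_mem ((M.mem_part_iff hq).2 h)]
    · rw [if_neg h, Set.indicator_of_notMem fun hm => h ((M.mem_part_iff hq).1 hm)]
  rw [hind]
  obtain ⟨lam, mu⟩ := q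
  simp only [Prod.mk.injEq] at hq'
  simp only [partProb, index, Prod.mk.injEq]
  -- At `T` the phase is given by the capped dates: `T < firstDown` means index `(T + 1, T + 1)`,
  -- and `T < firstBack` means second index `T + 1`.
  split_ifs with h5 h6 h7 h8
  · simp only [probBefore]
    rw [if_pos (by omega)]
    simp
  · simp only [probBefore]
    rw [if_neg (by omega), if_pos (by omega)]
  · simp only [probDuring]
    rw [if_neg (by omega), if_pos (by omega)]
    simp
  · simp only [probDuring]
    split_ifs <;> first | rfl | omega
  · rfl
  · rfl

/-- The first element of a set of dates. -/
noncomputable def firstIn (T : ℕ) (s : Finset ℕ) : ℕ := sInf ({j | j ∈ s} ∪ {T + 1})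

/-- The first gap in a set of dates after its first element. -/
noncomputable def firstGap (T : ℕ) (s : Finset ℕ) : ℕ :=
  sInf ({j | firstIn T s ≤ j ∧ j ∉ s} ∪ {T + 1})

theorem path_eq_empty {k : ℕ} {ω : Ω} (hk : k < M.firstDown ω) : M.path k ω = ∅ := by
  refine Finset.eq_empty_of_forall_notMem fun j hj => ?_
  obtain ⟨h1, h2⟩ := M.mem_path.1 hj
  have := M.firstDown_le_of h2
  omega

theorem path_ne_empty {k : ℕ} {ω : Ω} (hk : k ≤ M.T) (h : M.firstDown ω ≤ k) :
    M.path k ω ≠ ∅ :=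
  Finset.nonempty_iff_ne_empty.1 ⟨_, M.mem_path.2 ⟨h, M.firstDown_spec (h.trans hk)⟩⟩

theorem firstIn_path {k : ℕ} {ω : Ω} (hk : k ≤ M.T) (h : M.firstDown ω ≤ k) :
    firstIn M.T (M.path k ω) = M.firstDown ω := by
  refine le_antisymm ?_ (le_sInf_union_singleton (M.firstDown_le ω) fun l hl => ?_)
  · exact Nat.sInf_le (Or.inl (M.mem_path.2 ⟨h, M.firstDown_spec (h.trans hk)⟩))
  · exact M.firstDown_le_of (M.mem_path.1 hl).2

theorem firstGap_path {k : ℕ} {ω : Ω} (hk : k ≤ M.T) (h : M.firstBack ω ≤ k) :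
    firstGap M.T (M.path k ω) = M.firstBack ω := by
  have h1 := M.firstIn_path hk ((M.firstDown_le_firstBack ω).trans h)
  refine le_antisymm ?_ (le_sInf_union_singleton (M.firstBack_le ω) fun l hl => ?_)
  · refine Nat.sInf_le (Or.inl ⟨h1 ▸ M.firstDown_le_firstBack ω, fun hm => ?_⟩)
    have := (M.mem_path.1 hm).2
    rw [M.firstBack_spec (h.trans hk)] at this
    norm_num at this
  · by_contra hlt
    exact hl.2 (M.mem_path.2 ⟨by omega, M.I_of_lt_firstBack (h1 ▸ hl.1) (by omega)⟩)

theorem lt_firstBack_iff {k : ℕ} {ω : Ω} (hk : k ≤ M.T) (h : M.firstDown ω ≤ k) :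
    k < M.firstBack ω ↔ ∀ j ∈ Finset.Icc (firstIn M.T (M.path k ω)) k, j ∈ M.path k ω := by
  rw [M.firstIn_path hk h]
  constructor
  · intro h1 j hj
    obtain ⟨h2, h3⟩ := Finset.mem_Icc.1 hj
    exact M.mem_path.2 ⟨h3, M.I_of_lt_firstBack h2 (by omega)⟩
  · intro h1
    by_contra hlt
    have h2 := M.mem_path.1 (h1 (M.firstBack ω)
      (Finset.mem_Icc.2 ⟨M.firstDown_le_firstBack ω, not_lt.1 hlt⟩))
    rw [M.firstBack_spec (by omega)] at h2
    norm_num at h2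

open Classical in
/-- The value of `partProb` after one more step of the regime from a given path. -/
noncomputable def partProbNext (q : ℕ × ℕ) (k : ℕ) (s : Finset ℕ) (i : ℤ) : ℝ :=
  if s = ∅ then
    if i = 1 then probBefore M.γ M.T q (k + 1) else probDuring M.γ M.T q (k + 1) (k + 1)
  else if ∀ j ∈ Finset.Icc (firstIn M.T s) k, j ∈ s then
    if i = -1 then probDuring M.γ M.T q (k + 1) (firstIn M.T s)
    else if (firstIn M.T s, k + 1) = q then 1 else 0
  else if (firstIn M.T s, firstGap M.T s) = q then 1 else 0

/-- `partProbNext` depends only on the path up to `k` and on the next regime, which is the form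
required by `condExp_path_step`; the dates of the current visit are read off that path. -/
theorem partProb_succ {q : ℕ × ℕ} {k : ℕ} (hk : k < M.T) (ω : Ω) :
    M.partProb q (k + 1) ω = M.partProbNext q k (M.path k ω) (M.I (k + 1) ω) := by
  unfold partProbNext
  by_cases h1 : k < M.firstDown ω
  · rw [if_pos (M.path_eq_empty h1)]
    by_cases h2 : M.I (k + 1) ω = 1
    · have h3 : k + 1 < M.firstDown ω := by
        refine lt_of_le_of_ne h1 fun he => ?_
        have h4 := M.firstDown_spec (ω := ω) (by omega)
        rw [← he, h2] at h4
        norm_num at h4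
      rw [if_pos h2, partProb, if_pos h3]
    · have h3 : M.I (k + 1) ω = -1 := (M.I_eq _ _).resolve_left h2
      have h4 : M.firstDown ω = k + 1 := le_antisymm (M.firstDown_le_of h3) h1
      have h5 := M.firstDown_lt_firstBack (ω := ω) (by omega)
      rw [if_neg h2, partProb, if_neg (by omega), if_pos (by omega), h4]
  · have h1' := not_lt.1 h1
    rw [if_neg (M.path_ne_empty hk.le h1'), M.firstIn_path hk.le h1']
    by_cases h2 : k < M.firstBack ω
    · have h6 := (M.lt_firstBack_iff hk.le h1').1 h2
      rw [M.firstIn_path hk.le h1'] at h6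
      rw [if_pos h6]
      by_cases h3 : M.I (k + 1) ω = -1
      · have h4 : k + 1 < M.firstBack ω := by
          refine lt_of_le_of_ne h2 fun he => ?_
          have h4 := M.firstBack_spec (ω := ω) (by omega)
          rw [← he, h3] at h4
          norm_num at h4
        rw [if_pos h3, partProb, if_neg (by omega), if_pos h4]
      · have h4 : M.firstBack ω = k + 1 :=
          le_antisymm (M.firstBack_le_of (by omega) (M.I_ne_neg_one.1 h3)) h2
        rw [if_neg h3, partProb, if_neg (by omega), if_neg (by omega), index, h4]
    · have h6 := mt (M.lt_firstBack_iff hk.le h1').2 h2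
      rw [M.firstIn_path hk.le h1'] at h6
      rw [if_neg h6, M.firstGap_path hk.le (not_lt.1 h2), partProb, if_neg (by omega),
        if_neg (by omega), index]

/-- Averaging over the two possible next regimes gives back the current value, so `partProb` is
harmonic for the chain. After the visit this is just `u + v = 1`. -/
theorem partProb_eq_step {q : ℕ × ℕ} (hq : q ∈ indexSet M.T) {k : ℕ} (hk : k < M.T) (ω : Ω) :
    M.partProb q k ω = evenProb M.γ (k + 1) * M.partProbNext q k (M.path k ω) (M.I k ω)
      + oddProb M.γ (k + 1) * M.partProbNext q k (M.path k ω) (-M.I k ω) := by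
  have hq' := lt_or_eq_of_mem_indexSet hq
  unfold partProbNext
  by_cases h1 : k < M.firstDown ω
  · have h2 := M.I_of_lt_firstDown h1
    simp only [M.path_eq_empty h1, if_true, h2]
    rw [partProb, if_pos h1, probBefore_step M.γ hk hq']
    norm_num
  · have h1' := not_lt.1 h1
    simp only [if_neg (M.path_ne_empty hk.le h1'), M.firstIn_path hk.le h1']
    by_cases h2 : k < M.firstBack ω
    · have h6 := (M.lt_firstBack_iff hk.le h1').1 h2
      rw [M.firstIn_path hk.le h1'] at h6
      simp only [if_pos h6, M.I_of_lt_firstBack h1' h2]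
      rw [partProb, if_neg h1, if_pos h2, probDuring_step M.γ hk h1' hq']
      norm_num
    · have h6 := mt (M.lt_firstBack_iff hk.le h1').2 h2
      rw [M.firstIn_path hk.le h1'] at h6
      simp only [if_neg h6, M.firstGap_path hk.le (not_lt.1 h2)]
      rw [partProb, if_neg h1, if_neg h2, oddProb_eq, index]
      ring

/-! ### Conditional probabilities of the partition events -/

variable [IsProbabilityMeasure μ]

/-- Backward induction from `T`, where the candidate is the indicator of the event; the inductive
step is the tower property with the one-step equation. -/
theorem condExp_part {q : ℕ × ℕ} (hq : q ∈ indexSet M.T) {k : ℕ} (hk : k ≤ M.T) :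
    ∀ᵐ ω ∂μ, (μ⟦M.part q | M.𝓕 k⟧) ω = M.partProb q k ω := by
  induction hk using Nat.decreasingInduction with
  | self =>
    have h : M.Known M.T ((M.part q).indicator fun _ => (1 : ℝ)) := by
      classical
      refine ((M.known_part q).map fun p => if p then (1 : ℝ) else 0).congr (ae_of_all _ fun ω => ?_)
      by_cases h : ω ∈ M.part q <;> simp [h]
    filter_upwards [h.condExp_self] with ω e
    rw [e, M.partProb_terminal hq]
  | of_succ k hk ih =>
    have h1 : μ[μ⟦M.part q | M.𝓕 (k + 1)⟧ | M.𝓕 k] =ᵐ[μ] μ⟦M.part q | M.𝓕 k⟧ :=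
      Known.condExp_le (Nat.le_succ k)
    have h2 : μ[μ⟦M.part q | M.𝓕 (k + 1)⟧ | M.𝓕 k] =ᵐ[μ]
        μ[fun ω => M.partProbNext q k (M.path k ω) (M.I (k + 1) ω) | M.𝓕 k] :=
      condExp_congr_ae (ih.mono fun ω e => by rw [e, M.partProb_succ hk])
    filter_upwards [h1, h2, M.condExp_path_step hk (M.partProbNext q k)] with ω e1 e2 e3
    rw [← e1, e2, e3, M.partProb_eq_step hq hk]

theorem condExp_part_eq {k : ℕ} (hk : k ≤ M.T) {p q : ℕ × ℕ} (hp : p ∈ indexSet M.T)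
    (hq : q ∈ indexSet M.T) : ∀ᵐ ω ∂μ, ω ∈ M.part p →
      (μ⟦M.part q | M.𝓕 k⟧) ω = transProb M.γ M.T k p q := by
  filter_upwards [M.condExp_part hq hk] with ω h hω
  rw [h, M.partProb_eq hq hk, M.index_eq_of_mem_part hp hω]

theorem index_mem_ae : ∀ᵐ ω ∂μ, M.index ω ∈ indexSet M.T :=
  M.I_zero.mono fun _ h => M.index_mem h

theorem sum_indicator_part {ω : Ω} (h : M.index ω ∈ indexSet M.T) (f : ℕ × ℕ → ℝ) :
    ∑ q ∈ indexSet M.T, f q * (M.part q).indicator (fun _ => (1 : ℝ)) ω = f (M.index ω) := by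
  rw [Finset.sum_eq_single (M.index ω)]
  · rw [Set.indicator_of_mem M.mem_part_index, mul_one]
  · intro q hq hne
    rw [Set.indicator_of_notMem fun hm => hne (M.index_eq_of_mem_part hq hm).symm, mul_zero]
  · exact fun hn => absurd h hn

theorem integrable_indicator_part (q : ℕ × ℕ) :
    Integrable ((M.part q).indicator fun _ => (1 : ℝ)) μ :=
  (integrable_const _).indicator (M.measurableSet_part q)

/-- The conditional expectation of a random variable that is constant on the partition events. -/
theorem condExp_of_const_on_part {X : Ω → ℝ} {f : ℕ × ℕ → ℝ}
    (hX : ∀ q ∈ indexSet M.T, ∀ᵐ ω ∂μ, ω ∈ M.part q → X ω = f q) {k : ℕ} (hk : k ≤ M.T)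
    {p : ℕ × ℕ} (hp : p ∈ indexSet M.T) : ∀ᵐ ω ∂μ, ω ∈ M.part p →
      (μ[X | M.𝓕 k]) ω = ∑ q ∈ indexSet M.T, f q * transProb M.γ M.T k p q := by
  have h1 : X =ᵐ[μ] ∑ q ∈ indexSet M.T, f q • (M.part q).indicator fun _ => (1 : ℝ) := by
    filter_upwards [M.index_mem_ae, (Finset.eventually_all _).2 hX] with ω h2 h3
    rw [h3 _ h2 M.mem_part_index, Finset.sum_apply, ← M.sum_indicator_part h2 f]
    rfl
  have h2 := condExp_finsetSum (μ := μ) (s := indexSet M.T)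
    (f := fun q => f q • (M.part q).indicator fun _ => (1 : ℝ))
    (fun q _ => (M.integrable_indicator_part q).smul (f q)) (M.𝓕 k)
  have h3 : ∀ᵐ ω ∂μ, ∀ q ∈ indexSet M.T,
      (μ[f q • (M.part q).indicator fun _ => (1 : ℝ) | M.𝓕 k]) ω
        = f q * (μ⟦M.part q | M.𝓕 k⟧) ω :=
    (Finset.eventually_all _).2 fun q _ => condExp_smul (f q) _ (M.𝓕 k)
  have h4 : ∀ᵐ ω ∂μ, ∀ q ∈ indexSet M.T, ω ∈ M.part p →
      (μ⟦M.part q | M.𝓕 k⟧) ω = transProb M.γ M.T k p q :=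
    (Finset.eventually_all _).2 fun q hq => M.condExp_part_eq hk hp hq
  filter_upwards [condExp_congr_ae (m := M.𝓕 k) h1, h2, h3, h4] with ω e1 e2 e3 e4 hω
  rw [e1, e2, Finset.sum_apply]
  exact Finset.sum_congr rfl fun q hq => by rw [e3 q hq, e4 q hq hω]

end Market

namespace Market

variable {Ω : Type*} [m0 : MeasurableSpace Ω] {μ : Measure Ω} (M : Market μ)

/-! ### Stopping times -/

/-- `τ` is almost surely a stopping time of the regime. -/
def Stopping (τ : Ω → ℕ) : Prop := ∀ k ≤ M.T, M.Known k fun ω => τ ω ≤ k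

variable {M}

theorem Known.sInf {k T : ℕ} {p : ℕ → Ω → Prop} (hp : ∀ j < T, M.Known k (p j)) :
    M.Known k fun ω => sInf ({l | p l ω} ∪ {T}) := by
  have h : ∀ j, M.Known k fun ω => j < T ∧ p j ω := by
    intro j
    by_cases hj : j < T
    · exact (hp j hj).map fun q => j < T ∧ q
    · exact (Known.const False).congr (ae_of_all _ fun ω => by simp [hj])
  refine ((Known.pi h).map fun f : ℕ → Prop => InfSet.sInf ({l | f l} ∪ {T})).congr
    (ae_of_all _ fun ω => ?_)
  exact sInf_union_singleton_congr fun l hl => by simp [hl]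

theorem stopping_sInf {p : ℕ → Ω → Prop} (hp : ∀ j < M.T, M.Known j (p j)) :
    M.Stopping fun ω => sInf ({l | p l ω} ∪ {M.T}) := by
  intro k hk
  -- The constraints discard the dates at which `p j` is not yet known at `k`, or not known at all.
  have h : ∀ j, M.Known k fun ω => j < M.T ∧ j ≤ k ∧ p j ω := by
    intro j
    by_cases hj : j < M.T ∧ j ≤ k
    · exact ((hp j hj.1).mono hj.2).map fun q => j < M.T ∧ j ≤ k ∧ q
    · exact (Known.const False).congr (ae_of_all _ fun ω => by
        simp only [eq_iff_iff, iff_false]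
        tauto)
  refine ((Known.pi h).map fun f : ℕ → Prop => (∃ j, f j) ∨ M.T ≤ k).congr
    (ae_of_all _ fun ω => propext ?_)
  rw [sInf_union_singleton_le_iff]
  by_cases hT : M.T ≤ k
  · simp [hT]
  · simp only [hT, or_false]
    exact exists_congr fun j => ⟨fun h => ⟨by omega, h.1, h.2⟩, fun h => h.2⟩

theorem Stopping.congr {τ τ' : Ω → ℕ} (hτ : M.Stopping τ) (h : ∀ᵐ ω ∂μ, τ' ω = τ ω) :
    M.Stopping τ' := fun k hk => (hτ k hk).congr (h.mono fun ω e => by rw [e])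

theorem Stopping.known_min {τ : Ω → ℕ} (hτ : M.Stopping τ) {k : ℕ} (hk : k ≤ M.T) :
    M.Known k fun ω => min k (τ ω) := by
  -- `min k (τ ω)` is the first date `j` with `τ ω ≤ j`, capped at `k`.
  refine (Known.sInf (T := k) (p := fun j ω => τ ω ≤ j) fun j hj =>
    (hτ j (by omega)).mono hj.le).congr (ae_of_all _ fun ω => ?_)
  refine eq_of_forall_ge_iff fun n => ?_
  rw [sInf_union_singleton_le_iff, min_le_iff]
  constructor
  · rintro (h | h)
    · exact Or.inr h
    · exact Or.inl ⟨n, le_rfl, h⟩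
  · rintro (⟨l, hl, h⟩ | h)
    · exact Or.inr (h.trans hl)
    · exact Or.inl h

theorem Stopping.known_stopAt {τ : Ω → ℕ} (hτ : M.Stopping τ) {X : ℕ → Ω → ℝ} {k : ℕ} (hk : k ≤ M.T)
    (hX : ∀ j ≤ k, M.Known j (X j)) : M.Known k (stopAt X τ k) :=
  Known.eval (X := X) (hτ.known_min hk) (ae_of_all _ fun _ => min_le_left _ _) fun j hj => (hX j hj).mono hj

theorem Stopping.known {τ : Ω → ℕ} (hτ : M.Stopping τ) (h : ∀ ω, τ ω ≤ M.T) : M.Known M.T τ :=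
  (hτ.known_min le_rfl).congr (ae_of_all _ fun ω => (min_eq_right (h ω)).symm)

theorem Stopping.known_at {τ : Ω → ℕ} (hτ : M.Stopping τ) (h : ∀ ω, τ ω ≤ M.T) {X : ℕ → Ω → ℝ}
    (hX : ∀ j ≤ M.T, M.Known j (X j)) : M.Known M.T (at' X τ) :=
  Known.eval (hτ.known h) (ae_of_all _ h) fun j hj => (hX j hj).mono hj

variable (M)

theorem lt_firstDown_iff {k : ℕ} (hk : k ≤ M.T) (ω : Ω) :
    k < M.firstDown ω ↔ M.path k ω = ∅ := by
  refine ⟨fun h => M.path_eq_empty h, fun h => ?_⟩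
  by_contra hlt
  exact M.path_ne_empty hk (not_lt.1 hlt) h

theorem known_lt_firstDown {k : ℕ} (hk : k ≤ M.T) : M.Known k fun ω => k < M.firstDown ω :=
  ⟨fun s => s = ∅, ae_of_all _ fun ω => propext (M.lt_firstDown_iff hk ω)⟩

/-- The return has occurred by `k` exactly when the observed path has visited the extreme regime and
has a gap afterwards. -/
theorem known_firstBack_le {k : ℕ} (hk : k ≤ M.T) : M.Known k fun ω => M.firstBack ω ≤ k := by
  refine ⟨fun s => ¬ (s = ∅ ∨ ∀ j ∈ Finset.Icc (firstIn M.T s) k, j ∈ s),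
    ae_of_all _ fun ω => propext ?_⟩
  dsimp only
  rw [← not_lt, not_iff_not, ← M.lt_firstDown_iff hk]
  by_cases h : k < M.firstDown ω
  · simp [h, h.trans_le (M.firstDown_le_firstBack ω)]
  · rw [M.lt_firstBack_iff hk (not_lt.1 h)]
    simp [h]

theorem τs_le (ω : Ω) : M.τs ω ≤ M.T := inf_le_right

theorem τs_eq (ω : Ω) : M.τs ω = min (M.firstDown ω) M.T := by
  refine eq_of_forall_ge_iff fun n => ?_
  rw [τs, min_le_iff, min_le_iff, firstDown, sInf_union_singleton_le_iff,
    sInf_union_singleton_le_iff]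
  by_cases h : M.T ≤ n
  · simp [h]
  · simp [h, show ¬ M.T + 1 ≤ n by omega]

theorem stopping_τs : M.Stopping M.τs := by
  refine (stopping_sInf (p := fun j ω => M.I j ω = -1) fun j _ =>
    (Known.regime le_rfl).map fun i => i = -1).congr (ae_of_all _ fun ω => ?_)
  exact min_eq_left (sInf_union_singleton_le _ _)

theorem θstar_le (ω : Ω) : M.θstar ω ≤ M.τs ω := sInf_union_singleton_le _ _

theorem fairRule_le (k : ℕ) (ω : Ω) : M.fairRule k ω ≤ M.T := sInf_union_singleton_le _ _

theorem le_fairRule {k : ℕ} (hk : k ≤ M.T) (ω : Ω) : k ≤ M.fairRule k ω :=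
  le_sInf_union_singleton hk fun _ h => h.1

theorem τe_le (ω : Ω) : M.τe ω ≤ M.T := by
  unfold τe
  split_ifs with h
  · exact h.le.trans (M.τs_le ω)
  · exact M.fairRule_le _ _

/-- The trader exits before the switch exactly when it calls before the switch, at a date when the
asset is worthless in its model. -/
theorem τe_cases (ω : Ω) :
    (M.θstar ω < M.τs ω ∧ M.τe ω = M.θstar ω ∧ M.q (M.τe ω) ω = 0) ∨
    (M.θstar ω = M.τs ω ∧ M.τs ω ≤ M.τe ω ∧ M.τe ω = M.fairRule (M.τs ω) ω) := by
  by_cases h : M.θstar ω < M.τs ω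
  · have he : M.τe ω = M.θstar ω := if_pos h
    refine Or.inl ⟨h, he, ?_⟩
    rcases sInf_union_singleton_spec (fun k => k < M.τs ω ∧ M.q k ω = 0) (M.τs ω) with h1 | h1
    · rw [he]
      exact h1.2
    · exact absurd h1 h.ne
  · have he : M.τe ω = M.fairRule (M.τs ω) ω := if_neg h
    exact Or.inr ⟨le_antisymm (M.θstar_le ω) (not_lt.1 h), he ▸ M.le_fairRule (M.τs_le ω) ω, he⟩

/-! ### Random variables determined by the path -/

theorem known_Js {k : ℕ} (hk : k ≤ M.T) : M.Known k (M.Js k) := by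
  classical
  refine ((M.stopping_τs k hk).map fun p => if p then (0 : ℝ) else 1).congr
    (ae_of_all _ fun ω => ?_)
  unfold Js
  by_cases h : k < M.τs ω
  · simp [h, not_le.2 h]
  · simp [h, not_lt.1 h]

theorem known_promised {k : ℕ} : M.Known k (M.promised k) :=
  Known.sum _ fun _ hl => ((Known.regime (Finset.mem_Icc.1 hl).2).map fun i => dn i - up i)

variable [IsProbabilityMeasure μ]

theorem known_Q {k : ℕ} (hk : k ≤ M.T) : M.Known k (M.Q k) :=
  (M.known_fun_regime k _).congr (M.Q_eq hk)

theorem known_q {k : ℕ} (hk : k ≤ M.T) : M.Known k (M.q k) :=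
  (M.known_fun_regime k _).congr (M.q_eq hk)

theorem known_binary {k l : ℕ} (hl : l ≤ M.T) : M.Known k (M.binary k l) :=
  (M.known_fun_regime l dn).condExp hl

theorem known_fairRule (k : ℕ) : M.Known M.T (M.fairRule k) :=
  Known.sInf fun _ hj => ((M.known_Q hj.le).mono hj.le).map fun x => k ≤ _ ∧ x = 0

theorem known_ratioA {k l : ℕ} (hl : l ≤ M.T) : M.Known k (M.ratioA k l) := by
  refine Known.div (Known.condExp (n := M.T) ?_ le_rfl) (M.known_binary hl)
  exact ((M.known_fun_regime l dn).mono hl).mul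
    ((M.known_fairRule k).map fun t => if l ≤ t then (1 : ℝ) else 0)

theorem known_ratioB {k l : ℕ} (hl : l ≤ M.T) : M.Known k (M.ratioB k l) := by
  refine Known.div (Known.condExp (n := M.T) ?_ le_rfl) ((M.known_binary hl).map fun x => 1 - x)
  exact ((M.known_fun_regime l up).mono hl).mul
    ((M.known_fairRule k).map fun t => if l ≤ t then (1 : ℝ) else 0)

/-- The cash flow at date `l` of the hedge rebalanced at date `t`. -/
theorem known_goodFlow {t l n : ℕ} (ht : t ≤ n) (hln : l ≤ n) (hl : l ≤ M.T) :
    M.Known n fun ω => M.ratioA t l ω * dn (M.I l ω) - M.ratioB t l ω * up (M.I l ω) :=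
  (((M.known_ratioA hl).mono ht).mul ((M.known_fun_regime l dn).mono hln)).sub
    (((M.known_ratioB hl).mono ht).mul ((M.known_fun_regime l up).mono hln))

theorem known_Pbad {k : ℕ} : M.Known k (M.Pbad k) :=
  Known.condExp (n := M.T) (Known.sum _ fun _ hl =>
    (M.known_badFlow (Finset.mem_Ioc.1 hl).2).mono (Finset.mem_Ioc.1 hl).2) le_rfl

theorem known_Pgood {k : ℕ} : M.Known k (M.Pgood k) := by
  refine Known.condExp (n := M.T) (Known.sum _ fun l hl => ?_) le_rfl
  have hl' := (Finset.mem_Ioc.1 hl).2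
  exact Known.eval (X := fun t ω => M.ratioA t l ω * dn (M.I l ω) - M.ratioB t l ω * up (M.I l ω))
    (M.stopping_τs.known M.τs_le) (ae_of_all _ M.τs_le) fun t ht => M.known_goodFlow ht hl' hl'

/-! ### The exit time and the value of the hedge -/

section Exit

/-- The exit time as a first hitting time. -/
theorem τe_eq (hQ : ∀ k ≤ M.T, fairFn M.γ M.T k 1 = 0) : ∀ᵐ ω ∂μ, M.τe ω =
    sInf ({k | (k < M.firstDown ω ∧ M.q k ω = 0) ∨ M.firstBack ω ≤ k} ∪ {M.T}) := by
  have hQ' : ∀ᵐ ω ∂μ, ∀ k ∈ Finset.range (M.T + 1), M.Q k ω = fairFn M.γ M.T k (M.I k ω) :=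
    (Finset.eventually_all _).2 fun k hk => M.Q_eq (by simpa [Nat.lt_succ_iff] using hk)
  filter_upwards [hQ'] with ω hω
  have hs := M.τs_eq ω
  refine eq_of_forall_ge_iff fun n => ?_
  rw [sInf_union_singleton_le_iff]
  rcases M.τe_cases ω with ⟨h1, h2, h3⟩ | ⟨h1, h2, h3⟩
  · rw [h2] at h3 ⊢
    constructor
    · intro h
      exact Or.inl ⟨_, h, Or.inl ⟨by omega, h3⟩⟩
    · rintro (⟨k, hk, ⟨h4, h5⟩ | h4⟩ | h4)
      · by_cases h6 : k < M.τs ω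
        · exact (Nat.sInf_le (Or.inl ⟨h6, h5⟩)).trans hk
        · omega
      · have := M.firstDown_le_firstBack ω
        omega
      · omega
  · have h4 : M.fairRule (M.τs ω) ω ≤ n ↔ M.firstBack ω ≤ n ∨ M.T ≤ n := by
      rw [fairRule, sInf_union_singleton_le_iff]
      by_cases hT : M.T ≤ n
      · simp [hT]
      simp only [hT, or_false]
      constructor
      · rintro ⟨l, hl, h5, h6⟩
        rw [hω l (by simp; omega)] at h6
        have h7 : M.I l ω = 1 := by
          rcases M.I_eq l ω with e | e
          · exact e
          · rw [e] at h6
            exact absurd h6 (fairFn_neg_one_pos M.γ (by omega)).ne'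
        exact (M.firstBack_le_of (by omega) h7).trans hl
      · intro h5
        have h6 := M.firstDown_le_firstBack ω
        refine ⟨M.firstBack ω, h5, by omega, ?_⟩
        rw [hω _ (by simp; omega), M.firstBack_spec (by omega)]
        exact hQ _ (by omega)
    rw [h3, h4]
    constructor
    · rintro (h | h)
      · exact Or.inl ⟨n, le_rfl, Or.inr h⟩
      · exact Or.inr h
    · rintro (⟨k, hk, ⟨h5, h6⟩ | h5⟩ | h5)
      -- A zero of `q` strictly before the switch would make `θstar` smaller than `τs`. So `τs ≤ k <
      -- firstDown`, which is possible only if `T ≤ k`.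
      · have h7 : M.τs ω ≤ k := by
          by_contra h8
          have : M.θstar ω ≤ k := Nat.sInf_le (Or.inl ⟨not_le.1 h8, h6⟩)
          omega
        right
        omega
      · exact Or.inl (h5.trans hk)
      · exact Or.inr h5

variable (hQ : ∀ k ≤ M.T, fairFn M.γ M.T k 1 = 0)
include hQ

theorem stopping_τe : M.Stopping M.τe := by
  refine (stopping_sInf (p := fun k ω => (k < M.firstDown ω ∧ M.q k ω = 0) ∨ M.firstBack ω ≤ k)
    fun j hj => ?_).congr (M.τe_eq hQ)
  exact ((M.known_lt_firstDown hj.le).map₂ ((M.known_q hj.le).map₂ (M.known_firstBack_le hj.le)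
    Prod.mk) fun a b => (a ∧ b.1 = 0) ∨ b.2)

theorem τe_le_firstBack : ∀ᵐ ω ∂μ, M.τe ω ≤ M.firstBack ω := by
  filter_upwards [M.τe_eq hQ] with ω h
  rw [h]
  exact Nat.sInf_le (Or.inl (Or.inr le_rfl))

/-- The asset is worthless at the exit time. -/
theorem Q_τe : ∀ᵐ ω ∂μ, M.Q (M.τe ω) ω = 0 := by
  have hQ' : ∀ᵐ ω ∂μ, ∀ k ∈ Finset.range (M.T + 1), M.Q k ω = fairFn M.γ M.T k (M.I k ω) :=
    (Finset.eventually_all _).2 fun k hk => M.Q_eq (by simpa [Nat.lt_succ_iff] using hk)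
  filter_upwards [hQ'] with ω hω
  have hs := M.τs_eq ω
  rcases M.τe_cases ω with ⟨h1, h2, _⟩ | ⟨h1, h2, h3⟩
  · rw [hω _ (by simp [M.τe_le ω]), M.I_of_lt_firstDown (by omega)]
    exact hQ _ (M.τe_le ω)
  · rcases sInf_union_singleton_spec (fun l => M.τs ω ≤ l ∧ M.Q l ω = 0) M.T with h4 | h4
    · rw [h3]
      exact h4.2
    · rw [h3, fairRule, h4, hω M.T (by simp)]
      exact fairFn_terminal _ _ _

theorem known_Qflow {k : ℕ} (hk : k ≤ M.T) : M.Known k (M.Qflow k) := by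
  refine Known.sum _ fun l hl => ?_
  have hl' := (Finset.mem_Icc.1 hl).2
  refine ((Known.regime hl').map fun i => dn i - up i).mul ?_
  -- For `l ≤ k`, the indicator of `l ≤ τe` depends on `τe` only through `min k τe`.
  refine (((M.stopping_τe hQ).known_min hk).map fun t => if l ≤ t then (1 : ℝ) else 0).congr
    (ae_of_all _ fun ω => ?_)
  simp [hl']

theorem known_Pflow {k : ℕ} (hk : k ≤ M.T) : M.Known k (M.Pflow k) := by
  have hs := M.stopping_τs.known_min hk
  have he := (M.stopping_τe hQ).known_min hk
  have h1 : M.Known k fun ω => ∑ l ∈ Finset.Icc 1 (min k (M.τs ω)),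
      (M.ratio_a 0 l ω * dn (M.I l ω) - M.ratio_b 0 l ω * up (M.I l ω)) :=
    Known.eval (X := fun t ω => ∑ l ∈ Finset.Icc 1 t,
      (M.ratio_a 0 l ω * dn (M.I l ω) - M.ratio_b 0 l ω * up (M.I l ω))) hs
      (ae_of_all _ fun _ => min_le_left _ _) fun t ht => Known.sum _ fun l hl => by
        have hl' := (Finset.mem_Icc.1 hl).2
        exact (M.known_badFlow (by omega)).mono (by omega)
  -- Only the capped times are known at `k`. This term enters when `τs ≤ k`; there the cap on `τs`
  -- is inactive, and comparing the capped times decides whether `τe < τs`.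
  have h2 : M.Known k fun ω => ∑ l ∈ Finset.Icc (min k (M.τs ω)) k,
      (M.ratioA (min k (M.τs ω)) l ω * dn (M.I l ω)
        - M.ratioB (min k (M.τs ω)) l ω * up (M.I l ω)) :=
    Known.eval (X := fun t ω => ∑ l ∈ Finset.Icc t k,
      (M.ratioA t l ω * dn (M.I l ω) - M.ratioB t l ω * up (M.I l ω))) hs
      (ae_of_all _ fun _ => min_le_left _ _) fun t ht => Known.sum _ fun l hl => by
        have hl' := (Finset.mem_Icc.1 hl).2
        exact M.known_goodFlow ht hl' (by omega)
  have h3 : M.Known k fun ω => min k (M.τe ω) < min k (M.τs ω) :=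
    he.map₂ hs fun a b => a < b
  refine (h1.add (Known.ite (M.stopping_τs k hk)
    (Known.ite h3 (Known.const (0 : ℝ)) h2) (Known.const (0 : ℝ)))).congr (ae_of_all _ fun ω => ?_)
  unfold Pflow
  congr 1
  unfold Js
  by_cases h : M.τs ω ≤ k
  · have h4 : min k (M.τe ω) < M.τs ω ↔ M.τe ω < M.τs ω := by
      rw [min_lt_iff]
      omega
    rw [if_neg (not_lt.2 h), if_pos h, min_eq_right h]
    by_cases h5 : M.τe ω < M.τs ω
    · simp [h5]
    · simp [h5, h4]
  · simp [h, not_le.1 h]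

theorem known_Pexit : M.Known M.T M.Pexit := by
  have he := M.stopping_τe hQ
  have hJ := he.known_at M.τe_le fun j hj => M.known_Js hj
  exact (hJ.mul (he.known_at M.τe_le fun j _ => M.known_Pbad)).add
    ((hJ.map fun x => 1 - x).mul (he.known_at M.τe_le fun j _ => M.known_Pgood))

/-- The cumulative cash flow of the hedge, including its liquidation at the exit time. -/
theorem known_hedgeTotal : M.Known M.T fun ω => at' M.Pflow M.τe ω + M.Pexit ω :=
  ((M.stopping_τe hQ).known_at M.τe_le fun _ hj => M.known_Pflow hQ hj).add (M.known_Pexit hQ)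

theorem P_eq {k : ℕ} (hk : k ≤ M.T) : ∀ᵐ ω ∂μ, M.P k ω =
    (μ[fun ω => at' M.Pflow M.τe ω + M.Pexit ω | M.𝓕 k]) ω - M.Pflow k ω := by
  have h1 := (M.known_hedgeTotal hQ).condExp_sub (k := k) ((M.known_Pflow hQ hk).mono hk)
  have h2 := (M.known_Pflow hQ hk).condExp_self
  have h3 : M.P k = μ[fun ω => at' M.Pflow M.τe ω + M.Pexit ω - M.Pflow k ω | M.𝓕 k] := by
    unfold P
    congr 1
    funext ω
    ring
  rw [h3]
  filter_upwards [h1, h2] with ω e1 e2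
  rw [e1, e2]

theorem known_P {k : ℕ} (hk : k ≤ M.T) : M.Known k (M.P k) :=
  (((M.known_hedgeTotal hQ).condExp le_rfl).sub (M.known_Pflow hQ hk)).congr (M.P_eq hQ hk)

/-- `P` at a random time is glued from conditional expectations at fixed dates. On `{τe = j}`, an
event known at `j`, the total cash flow of the hedge is itself known at `j`, so conditioning leaves
it unchanged. -/
theorem P_τe : ∀ᵐ ω ∂μ, M.P (M.τe ω) ω = M.Pexit ω := by
  have he := M.stopping_τe hQ
  have key : ∀ j ∈ Finset.range (M.T + 1), ∀ᵐ ω ∂μ, M.τe ω = j → M.P j ω = M.Pexit ω := by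
    intro j hj
    have hjT : j ≤ M.T := by simpa [Nat.lt_succ_iff] using hj
    have hi : M.Known j fun ω => if M.τe ω = j then (1 : ℝ) else 0 := by
      have h0 : M.Known j fun ω => M.τe ω = j := by
        rcases Nat.eq_zero_or_pos j with rfl | hpos
        · exact (he 0 hjT).congr (ae_of_all _ fun ω => by simp)
        · refine (((he j hjT).map₂ ((he (j - 1) (by omega)).mono (by omega))
            fun a b => a ∧ ¬ b)).congr (ae_of_all _ fun ω => propext ?_)
          omega
      exact Known.ite h0 (Known.const _) (Known.const _)
    have hX : M.Known j fun ω => (if M.τe ω = j then (1 : ℝ) else 0) *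
        (M.Pflow j ω + (M.Js j ω * M.Pbad j ω + (1 - M.Js j ω) * M.Pgood j ω)) :=
      hi.mul ((M.known_Pflow hQ hjT).add (((M.known_Js hjT).mul M.known_Pbad).add
        (((M.known_Js hjT).map fun x => 1 - x).mul M.known_Pgood)))
    have h1 := hi.condExp_mul (M.known_hedgeTotal hQ)
    have h2 : (fun ω => (if M.τe ω = j then (1 : ℝ) else 0) * (at' M.Pflow M.τe ω + M.Pexit ω))
        = fun ω => (if M.τe ω = j then (1 : ℝ) else 0) *
        (M.Pflow j ω + (M.Js j ω * M.Pbad j ω + (1 - M.Js j ω) * M.Pgood j ω)) := by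
      funext ω
      by_cases h : M.τe ω = j
      · simp only [Market.at', Pexit, h]
      · simp [h]
    rw [h2] at h1
    filter_upwards [h1, hX.condExp_self, M.P_eq hQ hjT] with ω e1 e2 e3 h
    rw [e2] at e1
    simp only [h, if_true, one_mul] at e1
    rw [e3, ← e1]
    simp only [Pexit, Market.at', h]
    ring
  filter_upwards [(Finset.eventually_all _).2 key] with ω h
  exact h _ (by simp [M.τe_le ω]) rfl

/-- The hedge, with its cash flow, is fairly valued until the exit time. -/
theorem condExp_hedge {k : ℕ} (hk : k ≤ M.T) : ∀ᵐ ω ∂μ,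
    (μ[fun ω => at' M.Pflow M.τe ω + at' M.P M.τe ω | M.𝓕 k]) ω
      = stopAt M.Pflow M.τe k ω + stopAt M.P M.τe k ω := by
  have he := M.stopping_τe hQ
  have h0 : (fun ω => at' M.Pflow M.τe ω + at' M.P M.τe ω) =ᵐ[μ]
      fun ω => at' M.Pflow M.τe ω + M.Pexit ω := by
    filter_upwards [M.P_τe hQ] with ω h
    simp only [Market.at', h]
  have hs : M.Known k fun ω => stopAt M.Pflow M.τe k ω + stopAt M.P M.τe k ω :=
    (he.known_stopAt hk fun j hj => M.known_Pflow hQ (hj.trans hk)).add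
      (he.known_stopAt hk fun j hj => M.known_P hQ (hj.trans hk))
  have hi : M.Known k fun ω => if M.τe ω ≤ k then (1 : ℝ) else 0 :=
    Known.ite (he k hk) (Known.const _) (Known.const _)
  have h1 := hi.condExp_mul (M.known_hedgeTotal hQ)
  -- After the exit, the total is the stopped value, already known at `k`; before it, the claim is
  -- the defining formula of `P`.
  have h2 : (fun ω => (if M.τe ω ≤ k then (1 : ℝ) else 0) * (at' M.Pflow M.τe ω + M.Pexit ω))
      =ᵐ[μ] fun ω => (if M.τe ω ≤ k then (1 : ℝ) else 0) *
        (stopAt M.Pflow M.τe k ω + stopAt M.P M.τe k ω) := by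
    filter_upwards [M.P_τe hQ] with ω h
    by_cases h3 : M.τe ω ≤ k
    · simp only [Market.at', Market.stopAt, min_eq_right h3, h]
    · simp [h3]
  filter_upwards [condExp_congr_ae (m := M.𝓕 k) h0, h1, condExp_congr_ae (m := M.𝓕 k) h2,
    (hi.mul hs).condExp_self, M.P_eq hQ hk] with ω e0 e1 e2 e3 e4
  rw [e0]
  by_cases h : M.τe ω ≤ k
  · rw [e2, e3] at e1
    simpa [h] using e1.symm
  · rw [stopAt, stopAt, min_eq_left (not_le.1 h).le, e4]
    ring

/-! ### The decompositions of the profit and loss and of the adjustments -/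

omit hQ in
theorem known_promised_add_Q {k : ℕ} (hk : k ≤ M.T) :
    M.Known k fun ω => M.promised k ω + M.Q k ω := M.known_promised.add (M.known_Q hk)

omit hQ in
theorem promised_eq_Qflow {n : ℕ} {ω : Ω} (h : n ≤ M.τe ω) : M.promised n ω = M.Qflow n ω := by
  refine Finset.sum_congr rfl fun l hl => ?_
  rw [if_pos ((Finset.mem_Icc.1 hl).2.trans h), mul_one]

/-- The drift `K` is minus the sum of the conditional increments of `promised + Q`. Since `{l < τe}`
is known at `l`, under `𝔼_k` these may be replaced by the increments themselves, which telescope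
between `min k τe` and `τe`; up to `τe`, `promised` and `Qflow` coincide. -/
theorem va_K {k : ℕ} (hk : k ≤ M.T) : ∀ᵐ ω ∂μ, M.va (stopAt M.K M.τe) k ω =
    stopAt M.Qflow M.τe k ω + stopAt M.Q M.τe k ω
      - (μ[fun ω' => at' M.Qflow M.τe ω' + at' M.Q M.τe ω' | M.𝓕 k]) ω := by
  have he := M.stopping_τe hQ
  set f : ℕ → Ω → ℝ := fun j ω => M.promised j ω + M.Q j ω with hf
  have hfk : ∀ j ≤ M.T, M.Known j (f j) := fun j hj => M.known_promised_add_Q hj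
  have hd : ∀ l ∈ Finset.Ico k M.T, M.Known M.T (f (l + 1) - f l) := fun l hl =>
    have hl' := (Finset.mem_Ico.1 hl).2
    ((hfk (l + 1) hl').mono hl').sub ((hfk l hl'.le).mono hl'.le)
  have hi : ∀ l ≤ M.T, M.Known l fun ω => if l < M.τe ω then (1 : ℝ) else 0 := fun l hl => by
    have h0 : M.Known l fun ω => l < M.τe ω := by
      simp only [← not_le]
      exact (he l hl).map Not
    exact Known.ite h0 (Known.const _) (Known.const _)
  have e1 : (fun ω => stopAt M.K M.τe M.T ω - stopAt M.K M.τe k ω) = fun ω =>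
      (-1) * ∑ l ∈ Finset.Ico k M.T, (if l < M.τe ω then 1 else 0) * (μ[f (l + 1) - f l | M.𝓕 l]) ω := by
    funext ω
    have := stopped_sub_eq_sum (fun l => predictablePart f M.𝓕 μ l ω) (M.τe ω) k M.T hk
    simp only [stopAt, K]
    rw [neg_sub_neg, ← neg_sub, this, neg_one_mul]
    congr 1
    refine Finset.sum_congr rfl fun l _ => ?_
    simp [predictablePart, Finset.sum_range_succ]
  have e2 : (fun ω => (at' M.Qflow M.τe ω + at' M.Q M.τe ω)
        - (stopAt M.Qflow M.τe k ω + stopAt M.Q M.τe k ω))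
      = fun ω => ∑ l ∈ Finset.Ico k M.T, (if l < M.τe ω then 1 else 0) * (f (l + 1) - f l) ω := by
    funext ω
    have := stopped_sub_eq_sum (fun l => f l ω) (M.τe ω) k M.T hk
    simp only [Pi.sub_apply]
    rw [← this, min_eq_right (M.τe_le ω)]
    simp only [hf, at', stopAt]
    rw [M.promised_eq_Qflow le_rfl, M.promised_eq_Qflow (min_le_right _ _)]
  have hE : ∀ l ∈ Finset.Ico k M.T,
      M.Known l (μ[f (l + 1) - f l | M.𝓕 l]) := fun l hl => (hd l hl).condExp le_rfl
  have hlT : ∀ l ∈ Finset.Ico k M.T, l ≤ M.T := fun l hl => (Finset.mem_Ico.1 hl).2.le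
  have h1 := Known.condExp_sum (M := M) (k := k) (n := M.T) (Finset.Ico k M.T)
    (X := fun l ω => (if l < M.τe ω then 1 else 0) * (μ[f (l + 1) - f l | M.𝓕 l]) ω)
    fun l hl => ((hi l (hlT l hl)).mul (hE l hl)).mono (hlT l hl)
  have h2 := Known.condExp_sum (M := M) (k := k) (n := M.T) (Finset.Ico k M.T)
    (X := fun l ω => (if l < M.τe ω then 1 else 0) * (f (l + 1) - f l) ω)
    fun l hl => ((hi l (hlT l hl)).mono (hlT l hl)).mul (hd l hl)
  have h3 : ∀ᵐ ω ∂μ, ∀ l ∈ Finset.Ico k M.T,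
      (μ[fun ω => (if l < M.τe ω then 1 else 0) * (μ[f (l + 1) - f l | M.𝓕 l]) ω | M.𝓕 k]) ω
      = (μ[fun ω => (if l < M.τe ω then 1 else 0) * (f (l + 1) - f l) ω | M.𝓕 k]) ω := by
    refine (Finset.eventually_all _).2 fun l hl => ?_
    refine EventuallyEq.trans ?_ (Known.condExp_le (X := fun ω =>
      (if l < M.τe ω then 1 else 0) * (f (l + 1) - f l) ω) (Finset.mem_Ico.1 hl).1)
    exact condExp_congr_ae ((hi l (hlT l hl)).condExp_mul (hd l hl)).symm
  have hsum : M.Known M.T fun ω => ∑ l ∈ Finset.Ico k M.T,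
      (if l < M.τe ω then 1 else 0) * (μ[f (l + 1) - f l | M.𝓕 l]) ω :=
    Known.sum _ fun l hl => ((hi l (hlT l hl)).mul (hE l hl)).mono (hlT l hl)
  have h4 := (Known.const (M := M) (k := k) (-1 : ℝ)).condExp_mul hsum
  have hs : M.Known k fun ω => stopAt M.Qflow M.τe k ω + stopAt M.Q M.τe k ω :=
    (he.known_stopAt hk fun j hj => M.known_Qflow hQ (hj.trans hk)).add
      (he.known_stopAt hk fun j hj => M.known_Q (hj.trans hk))
  have ht : M.Known M.T fun ω => at' M.Qflow M.τe ω + at' M.Q M.τe ω :=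
    (he.known_at M.τe_le fun j hj => M.known_Qflow hQ hj).add (he.known_at M.τe_le fun j hj => M.known_Q hj)
  have h5 := ht.condExp_sub (k := k) (hs.mono hk)
  rw [e2] at h5
  rw [va, e1]
  filter_upwards [h1, h2, h3, h4, h5, hs.condExp_self] with ω a1 a2 a3 a4 a5 a6
  rw [a4, a1, Finset.sum_congr rfl a3, ← a2, a5, a6]
  ring

/-- The closing term vanishes at the exit: a call before the switch occurs when `q = 0`, any other
exit has `J^s = 0`, and `Q = 0` in both cases. -/
theorem pnl_eq {k : ℕ} : ∀ᵐ ω ∂μ, M.pnl k ω =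
    stopAt M.Qflow M.τe k ω + stopAt M.Js M.τe k ω * stopAt M.q M.τe k ω
      + (1 - stopAt M.Js M.τe k ω) * stopAt M.Q M.τe k ω
      - (stopAt M.Pflow M.τe k ω + stopAt M.Js M.τe k ω * stopAt M.Pbad M.τe k ω
        + (1 - stopAt M.Js M.τe k ω) * stopAt M.P M.τe k ω) := by
  filter_upwards [M.Q_τe hQ] with ω h
  have h1 : at' M.Js M.τe ω * at' M.q M.τe ω = 0 := by
    rcases M.τe_cases ω with ⟨_, _, h3⟩ | ⟨_, h2, _⟩
    · simp [at', h3]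
    · simp [at', Js, not_lt.2 h2]
  have h2 : at' M.Q M.τe ω = 0 := h
  rw [pnl, h1, h2]
  ring

/-- At maturity the profit and loss is `𝒬 + Q` minus `𝒫 + P` minus the integrand of `D`, all taken
at `τe`. Their conditional expectations come from `va_K`, from `condExp_hedge`, and from the
definition of `D`. -/
theorem HVA_eq {k : ℕ} (hk : k ≤ M.T) : ∀ᵐ ω ∂μ, M.HVA k ω =
    stopAt M.Js M.τe k ω * (stopAt M.q M.τe k ω - stopAt M.Q M.τe k ω
      - (stopAt M.Pbad M.τe k ω - stopAt M.P M.τe k ω))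
    + M.D k ω + M.va (stopAt M.K M.τe) k ω := by
  have he := M.stopping_τe hQ
  set W : Ω → ℝ := fun ω => at' M.Js M.θstar ω *
    (at' M.Q M.θstar ω - (at' M.P M.θstar ω - at' M.Pbad M.θstar ω)) with hW
  -- `θstar` may be replaced by `τe`: the two agree for a call before the switch, and otherwise both
  -- factors `J^s` are zero.
  have hWeq : ∀ ω, W ω = at' M.Js M.τe ω *
      (at' M.Q M.τe ω - (at' M.P M.τe ω - at' M.Pbad M.τe ω)) := by
    intro ω
    rcases M.τe_cases ω with ⟨_, h2, _⟩ | ⟨h1, h2, _⟩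
    · simp only [hW, at', h2]
    · simp only [hW, at', h1]
      simp [Js, not_lt.2 h2]
  have kJ := he.known_at M.τe_le fun j hj => M.known_Js hj
  have kQ := he.known_at M.τe_le fun j hj => M.known_Q hj
  have kP := he.known_at M.τe_le fun j hj => M.known_P hQ hj
  have kB := he.known_at M.τe_le fun j _ => M.known_Pbad (k := j)
  have kF := he.known_at M.τe_le fun j hj => M.known_Qflow hQ hj
  have kG := he.known_at M.τe_le fun j hj => M.known_Pflow hQ hj
  have kW : M.Known M.T W := (kJ.mul (kQ.sub (kP.sub kB))).congr (ae_of_all _ hWeq)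
  have h1 : M.pnl M.T =ᵐ[μ] fun ω => (at' M.Qflow M.τe ω + at' M.Q M.τe ω)
      - ((at' M.Pflow M.τe ω + at' M.P M.τe ω) + W ω) := by
    filter_upwards [M.pnl_eq hQ (k := M.T), M.Q_τe hQ] with ω a1 a2
    have a3 : at' M.Q M.τe ω = 0 := a2
    have a4 : at' M.Js M.τe ω * at' M.q M.τe ω = 0 := by
      rcases M.τe_cases ω with ⟨_, _, h3⟩ | ⟨_, h2, _⟩
      · simp [at', h3]
      · simp [at', Js, not_lt.2 h2]
    rw [a1, hWeq, a3]
    simp only [stopAt, min_eq_right (M.τe_le ω)]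
    simp only [at'] at a3 a4 ⊢
    rw [a4, a3]
    ring
  have h2 := (kF.add kQ).condExp_sub (k := k) ((kG.add kP).add kW)
  have h3 := (kG.add kP).condExp_add (k := k) kW
  filter_upwards [condExp_congr_ae (m := M.𝓕 k) h1, h2, h3, M.condExp_hedge hQ hk,
    M.va_K hQ hk, M.pnl_eq hQ (k := k)] with ω a1 a2 a3 a4 a5 a6
  rw [HVA, a1, a2, a3, a4, a5, a6, D]
  ring

theorem HVA_sub_pnl {k : ℕ} (hk : k ≤ M.T) : ∀ᵐ ω ∂μ, M.HVA k ω - M.pnl k ω =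
    -(stopAt M.Qflow M.τe k ω + stopAt M.Q M.τe k ω) + stopAt M.Pflow M.τe k ω
      + stopAt M.P M.τe k ω + (M.D k ω + M.va (stopAt M.K M.τe) k ω) := by
  filter_upwards [M.HVA_eq hQ hk, M.pnl_eq hQ (k := k)] with ω a1 a2
  rw [a1, a2]
  ring

theorem HVA_zero : ∀ᵐ ω ∂μ, M.HVA 0 ω =
    M.q 0 ω - M.Q 0 ω - (M.Pbad 0 ω - M.P 0 ω) + M.D 0 ω + M.va (stopAt M.K M.τe) 0 ω := by
  filter_upwards [M.HVA_eq hQ (Nat.zero_le _), M.I_zero] with ω a1 a2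
  have h1 : 0 < M.τs ω := by
    have := M.one_le_firstDown a2
    have := M.T_pos
    rw [M.τs_eq]
    omega
  rw [a1]
  simp [stopAt, Js, h1]

/-- Since `q_0 = P^bad_0`, the trader's prices cancel at inception and only `Q_0 - P_0` remains. -/
theorem HVA_sub_HVA_zero {k : ℕ} (hk : k ≤ M.T) : ∀ᵐ ω ∂μ,
    -M.pnl k ω + (M.HVA k ω - M.HVA 0 ω) =
        -(stopAt M.Qflow M.τe k ω + stopAt M.Q M.τe k ω) + stopAt M.Pflow M.τe k ω
          + stopAt M.P M.τe k ω + (M.Q 0 ω - M.P 0 ω)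
          + (M.D k ω + M.va (stopAt M.K M.τe) k ω)
          - (M.D 0 ω + M.va (stopAt M.K M.τe) 0 ω) := by
  filter_upwards [M.HVA_sub_pnl hQ hk, M.HVA_zero hQ, M.Pbad_zero] with ω a1 a2 a3
  rw [a2, a3]
  linarith

theorem loss_eq {k : ℕ} (hk : k ≤ M.T) : ∀ᵐ ω ∂μ,
    M.HVA (min (k + 1) M.T) ω - M.HVA k ω - (M.pnl (min (k + 1) M.T) ω - M.pnl k ω) =
          -(stopAt M.Qflow M.τe (k + 1) ω + stopAt M.Q M.τe (k + 1) ω)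
            + stopAt M.Pflow M.τe (k + 1) ω + stopAt M.P M.τe (k + 1) ω
            + (stopAt M.Qflow M.τe k ω + stopAt M.Q M.τe k ω)
            - stopAt M.Pflow M.τe k ω - stopAt M.P M.τe k ω
            + (M.D (min (k + 1) M.T) ω + M.va (stopAt M.K M.τe) (min (k + 1) M.T) ω
              - M.D k ω - M.va (stopAt M.K M.τe) k ω) := by
  filter_upwards [M.HVA_sub_pnl hQ hk, M.HVA_sub_pnl hQ (k := min (k + 1) M.T) (min_le_right _ _)]
    with ω a1 a2
  -- As `τe ≤ T`, the cap of `k + 1` at `T` is invisible to stopped processes.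
  have h : ∀ X : ℕ → Ω → ℝ, stopAt X M.τe (min (k + 1) M.T) ω = stopAt X M.τe (k + 1) ω := by
    intro X
    simp only [stopAt, min_assoc, min_eq_right (M.τe_le ω)]
  simp only [h] at a2
  linarith

end Exit

end Market

/-! ### Conditional laws, expected shortfall and capital valuation adjustment -/

theorem transProb_nonneg (γ : ℕ → ℝ≥0) (T k : ℕ) (p q : ℕ × ℕ) : 0 ≤ transProb γ T k p q := by
  have hu := evenProb_nonneg γ
  have hv := oddProb_nonneg γ
  have hP : ∀ s : Finset ℕ, 0 ≤ ∏ r ∈ s, evenProb γ r := fun s => Finset.prod_nonneg fun r _ => hu r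
  unfold transProb
  dsimp only
  split_ifs
  · exact hP _
  · exact le_rfl
  · exact hP _
  · exact mul_nonneg (mul_nonneg (hP _) (hv _)) (hP _)
  · exact le_rfl
  · exact zero_le_one
  · exact mul_nonneg (hP _) (hv _)
  · exact mul_nonneg (mul_nonneg (mul_nonneg (hP _) (hv _)) (hP _)) (hv _)
  · exact le_rfl

/-- The law of a random variable with values `v q` and weights `transProb γ T k p q`. -/
noncomputable def mixture (γ : ℕ → ℝ≥0) (T k : ℕ) (p : ℕ × ℕ) (v : ℕ × ℕ → ℝ) : Measure ℝ :=
  ∑ q ∈ indexSet T, ENNReal.ofReal (transProb γ T k p q) • Measure.dirac (v q)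

theorem mixture_apply (γ : ℕ → ℝ≥0) (T k : ℕ) (p : ℕ × ℕ) (v : ℕ × ℕ → ℝ) {s : Set ℝ}
    (hs : MeasurableSet s) : mixture γ T k p v s = ENNReal.ofReal (∑ q ∈ indexSet T,
      s.indicator (fun _ => (1 : ℝ)) (v q) * transProb γ T k p q) := by
  rw [ENNReal.ofReal_sum_of_nonneg]
  · rw [mixture, Measure.finsetSum_apply]
    refine Finset.sum_congr rfl fun q _ => ?_
    rw [Measure.smul_apply, Measure.dirac_apply' _ hs]
    by_cases h : v q ∈ s <;> simp [h]
  · intro q _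
    exact mul_nonneg (Set.indicator_nonneg (fun _ _ => zero_le_one) _) (transProb_nonneg _ _ _ _ _)

namespace Market

variable {Ω : Type*} [m0 : MeasurableSpace Ω] {μ : Measure Ω} [IsProbabilityMeasure μ]
  (M : Market μ)

/-- At date `0` the conditional expectation is the expectation. -/
theorem Known.condExp_zero {M : Market μ} {X : Ω → ℝ} (hX : M.Known M.T X) :
    ∀ᵐ ω ∂μ, (μ[X | M.𝓕 0]) ω = ∫ ω', X ω' ∂μ := by
  obtain ⟨f, hf⟩ := hX.condExp (k := 0) le_rfl
  have h1 : ∀ᵐ ω ∂μ, (μ[X | M.𝓕 0]) ω = f ∅ := by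
    filter_upwards [hf, M.I_zero] with ω e1 e2
    rw [e1, M.path_eq_empty (M.one_le_firstDown e2)]
  have h2 : ∫ ω', X ω' ∂μ = f ∅ := by
    rw [← integral_condExp (M.𝓕.le 0), integral_congr_ae h1]
    simp
  rw [h2]
  exact h1

/-- A random variable that is constant on the partition events is known at maturity. -/
theorem known_of_const_on_part {X : Ω → ℝ} {f : ℕ × ℕ → ℝ}
    (hX : ∀ q ∈ indexSet M.T, ∀ᵐ ω ∂μ, ω ∈ M.part q → X ω = f q) :
    ∀ᵐ ω ∂μ, X ω = ∑ q ∈ indexSet M.T, f q * (M.part q).indicator (fun _ => (1 : ℝ)) ω := by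
  filter_upwards [M.index_mem_ae, (Finset.eventually_all _).2 hX] with ω h1 h2
  rw [M.sum_indicator_part h1, h2 _ h1 M.mem_part_index]

theorem measurable_sum_part (f : ℕ × ℕ → ℝ) :
    Measurable fun ω => ∑ q ∈ indexSet M.T, f q * (M.part q).indicator (fun _ => (1 : ℝ)) ω :=
  Finset.measurable_sum _ fun q _ =>
    (measurable_const.indicator (M.measurableSet_part q)).const_mul (f q)

/-- For each fixed set, the conditional probability that `X` lies in it is a finite sum of weights.
The laws agree almost surely as measures because countably many rational half-lines and the total
mass determine a finite measure on the line. -/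
theorem condDistrib_of_const_on_part {X : Ω → ℝ} {v : ℕ × ℕ → ℝ}
    (hX : ∀ q ∈ indexSet M.T, ∀ᵐ ω ∂μ, ω ∈ M.part q → X ω = v q) {k : ℕ} (hk : k ≤ M.T)
    {p : ℕ × ℕ} (hp : p ∈ indexSet M.T) : ∀ᵐ ω ∂μ, ω ∈ M.part p →
      @condDistrib Ω Ω ℝ _ _ _ m0 (M.𝓕 k) X id μ _ ω = mixture M.γ M.T k p v := by
  -- A measurable version of `X`, since the comparison of `condDistrib` with conditional
  -- expectations requires measurability.
  set X' : Ω → ℝ := fun ω =>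
    ∑ q ∈ indexSet M.T, v q * (M.part q).indicator (fun _ => (1 : ℝ)) ω with hX'
  have hXX : X =ᵐ[μ] X' := M.known_of_const_on_part hX
  have hm : Measurable X' := M.measurable_sum_part v
  have hid : @Measurable Ω Ω m0 (M.𝓕 k) id := fun s hs => M.𝓕.le k s hs
  rw [@condDistrib_congr_left Ω Ω ℝ _ _ _ m0 μ _ id X (M.𝓕 k) X' hXX]
  have key : ∀ s : Set ℝ, MeasurableSet s → ∀ᵐ ω ∂μ, ω ∈ M.part p →
      @condDistrib Ω Ω ℝ _ _ _ m0 (M.𝓕 k) X' id μ _ ω s = mixture M.γ M.T k p v s := by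
    intro s hs
    have h1 := @condDistrib_ae_eq_condExp Ω Ω ℝ _ _ _ m0 μ _ id X' (M.𝓕 k) s hid hm hs
    rw [MeasurableSpace.comap_id] at h1
    have h2 := M.condExp_of_const_on_part (X := (X' ⁻¹' s).indicator fun _ => (1 : ℝ))
      (f := fun q => s.indicator (fun _ => (1 : ℝ)) (v q)) (fun q hq => by
        filter_upwards [M.index_mem_ae] with ω h3 h4
        have h5 : X' ω = v q := by
          rw [hX']
          dsimp only
          rw [M.sum_indicator_part h3, M.index_eq_of_mem_part hq h4]
        by_cases h6 : v q ∈ s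
        · rw [Set.indicator_of_mem h6, Set.indicator_of_mem]
          rwa [Set.mem_preimage, h5]
        · rw [Set.indicator_of_notMem h6, Set.indicator_of_notMem]
          rwa [Set.mem_preimage, h5]) hk hp
    filter_upwards [h1, h2] with ω e1 e2 hω
    rw [mixture_apply _ _ _ _ _ hs, ← e2 hω, ← e1, ofReal_measureReal]
    rfl
  have h1 : ∀ᵐ ω ∂μ, ∀ a : ℚ, ω ∈ M.part p →
      @condDistrib Ω Ω ℝ _ _ _ m0 (M.𝓕 k) X' id μ _ ω (Set.Iic (a : ℝ))
        = mixture M.γ M.T k p v (Set.Iic (a : ℝ)) :=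
    ae_all_iff.2 fun a => key _ measurableSet_Iic
  filter_upwards [h1, key Set.univ MeasurableSet.univ] with ω e1 e2 hω
  refine ext_of_generate_finite _ ((BorelSpace.measurable_eq (α := ℝ)).trans
    Real.borel_eq_generateFrom_Iic_rat) Real.isPiSystem_Iic_rat ?_ (e2 hω)
  intro s hs
  obtain ⟨a, ha⟩ := Set.mem_iUnion.1 hs
  rw [Set.mem_singleton_iff.1 ha]
  exact e1 a hω

section

variable (hQ : ∀ k ≤ M.T, fairFn M.γ M.T k 1 = 0)
include hQ

/-- The profit and loss is constant on the partition events. -/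
theorem pnl_const {k : ℕ} (hk : k ≤ M.T) (p : ℕ × ℕ) (hp : p ∈ indexSet M.T) :
    ∃ c, ∀ᵐ ω ∂μ, ω ∈ M.part p → M.pnl k ω = c := by
  obtain ⟨e, he⟩ := ((M.stopping_τe hQ).known_min (min_le_left M.T p.2)).const_on_part
    (p := p) (min_le_left _ _) (min_le_right _ _)
  -- The exit precedes both `T` and the return date `m`, so the cap is inactive and `τe` is the
  -- constant `e`. The outer minimum only keeps the constant within these bounds when the event is
  -- null and `e` is arbitrary.
  have he' : ∀ᵐ ω ∂μ, ω ∈ M.part p → M.τe ω = min e (min M.T p.2) := by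
    filter_upwards [he, M.τe_le_firstBack hQ] with ω h1 h2 h3
    have h4 : M.firstBack ω = p.2 := congrArg Prod.snd (M.index_eq_of_mem_part hp h3)
    have h5 := M.τe_le ω
    have h6 := h1 h3
    omega
  set s := min k (min e (min M.T p.2)) with hs
  have hsT : s ≤ M.T := by omega
  have hsp : s ≤ p.2 := by omega
  -- On the partition event the stopped date is the deterministic `s`, which is at most `m`, so
  -- everything stopped there is read off the determined part of the path.
  have hZ : M.Known s fun ω => M.Qflow s ω + M.Js s ω * M.q s ω + (1 - M.Js s ω) * M.Q s ω
      - (M.Pflow s ω + M.Js s ω * M.Pbad s ω + (1 - M.Js s ω) * M.P s ω) :=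
    (((M.known_Qflow hQ hsT).add ((M.known_Js hsT).mul (M.known_q hsT))).add
      (((M.known_Js hsT).map fun x => 1 - x).mul (M.known_Q hsT))).sub
      (((M.known_Pflow hQ hsT).add ((M.known_Js hsT).mul M.known_Pbad)).add
        (((M.known_Js hsT).map fun x => 1 - x).mul (M.known_P hQ hsT)))
  obtain ⟨c, hc⟩ := hZ.const_on_part hsT hsp
  refine ⟨c, ?_⟩
  filter_upwards [hc, he', M.pnl_eq hQ (k := k)] with ω h1 h2 h3 h4
  rw [h3, ← h1 h4]
  simp only [stopAt, h2 h4, ← hs]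

end

/-- The conditional shortfalls are constant on the partition events, and conditioning at date `0` is
plain expectation, because the path up to `0` is almost surely trivial. -/
theorem KVA_zero (α r : ℝ) (v : ℕ → ℕ × ℕ → ℝ)
    (hv : ∀ l < M.T, ∀ q ∈ indexSet M.T, ∀ᵐ ω ∂μ, ω ∈ M.part q →
      M.condES α l (M.loss l) ω = v l q) :
    ∀ᵐ ω ∂μ, M.KVA α r 0 ω = r * ∑ l ∈ Finset.range M.T, Real.exp (-r * (l : ℝ)) *
      ∑ q ∈ indexSet M.T, v l q * μ.real (M.part q) := by
  have h1 : (fun ω' => ∑ l ∈ Finset.Ico 0 M.T,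
      Real.exp (-r * ((l : ℝ) - ((0 : ℕ) : ℝ))) * M.condES α l (M.loss l) ω') =ᵐ[μ]
      fun ω => ∑ l ∈ Finset.range M.T, Real.exp (-r * (l : ℝ)) *
        ∑ q ∈ indexSet M.T, v l q * (M.part q).indicator (fun _ => (1 : ℝ)) ω := by
    have h2 : ∀ᵐ ω ∂μ, ∀ l ∈ Finset.range M.T, M.condES α l (M.loss l) ω
        = ∑ q ∈ indexSet M.T, v l q * (M.part q).indicator (fun _ => (1 : ℝ)) ω :=
      (Finset.eventually_all _).2 fun l hl =>
        M.known_of_const_on_part (hv l (Finset.mem_range.1 hl))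
    filter_upwards [h2] with ω h3
    rw [Nat.Ico_zero_eq_range]
    refine Finset.sum_congr rfl fun l hl => ?_
    rw [h3 l hl, Nat.cast_zero, sub_zero]
  have h4 : M.Known M.T fun ω => ∑ l ∈ Finset.range M.T, Real.exp (-r * (l : ℝ)) *
        ∑ q ∈ indexSet M.T, v l q * (M.part q).indicator (fun _ => (1 : ℝ)) ω := by
    classical
    refine Known.sum _ fun l _ => (Known.const _).mul (Known.sum _ fun q _ => (Known.const _).mul ?_)
    exact (Known.ite (M.known_part q) (Known.const (1 : ℝ)) (Known.const 0)).congr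
      (ae_of_all _ fun ω => rfl)
  have h5 : ∫ ω, ∑ l ∈ Finset.range M.T, Real.exp (-r * (l : ℝ)) *
        ∑ q ∈ indexSet M.T, v l q * (M.part q).indicator (fun _ => (1 : ℝ)) ω ∂μ
      = ∑ l ∈ Finset.range M.T, Real.exp (-r * (l : ℝ)) *
        ∑ q ∈ indexSet M.T, v l q * μ.real (M.part q) := by
    have h6 : ∀ l q, Integrable
        (fun ω => v l q * (M.part q).indicator (fun _ => (1 : ℝ)) ω) μ := fun l q =>
      (M.integrable_indicator_part q).const_mul _
    rw [integral_finsetSum _ fun l _ =>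
      (integrable_finsetSum _ fun q _ => h6 l q).const_mul (Real.exp (-r * (l : ℝ)))]
    refine Finset.sum_congr rfl fun l _ => ?_
    rw [integral_const_mul, integral_finsetSum _ fun q _ => h6 l q]
    congr 1
    refine Finset.sum_congr rfl fun q _ => ?_
    rw [integral_const_mul, integral_indicator (M.measurableSet_part q)]
    simp
  filter_upwards [condExp_congr_ae (m := M.𝓕 0) h1, h4.condExp_zero] with ω e1 e2
  rw [KVA, e1, e2, h5]

end Market

end RangeAccrual

/-! ### Assembly of the proposition -/

open RangeAccrual RangeAccrual.Market in
theorem proposition5p2 {Ω : Type*} [MeasurableSpace Ω] {μ : Measure Ω} [IsProbabilityMeasure μ]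
    (M : Market μ) (hQ : ∀ k ≤ M.T, fairFn M.γ M.T k 1 = 0)
    (α : ℝ) (hα : 1 / 2 < α) (hα' : α < 1) (r : ℝ) (hr : 0 < r) :
    -- (i) the decompositions
    (∀ k ≤ M.T,
      (∀ᵐ ω ∂μ, M.pnl k ω =
        stopAt M.Qflow M.τe k ω + stopAt M.Js M.τe k ω * stopAt M.q M.τe k ω
          + (1 - stopAt M.Js M.τe k ω) * stopAt M.Q M.τe k ω
          - (stopAt M.Pflow M.τe k ω + stopAt M.Js M.τe k ω * stopAt M.Pbad M.τe k ω
            + (1 - stopAt M.Js M.τe k ω) * stopAt M.P M.τe k ω)) ∧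
      (∀ᵐ ω ∂μ, M.HVA k ω =
        stopAt M.Js M.τe k ω * (stopAt M.q M.τe k ω - stopAt M.Q M.τe k ω
          - (stopAt M.Pbad M.τe k ω - stopAt M.P M.τe k ω))
        + M.D k ω + M.va (stopAt M.K M.τe) k ω) ∧
      (∀ᵐ ω ∂μ, M.va (stopAt M.K M.τe) k ω =
        stopAt M.Qflow M.τe k ω + stopAt M.Q M.τe k ω
          - (μ[fun ω' => at' M.Qflow M.τe ω' + at' M.Q M.τe ω' | M.𝓕 k]) ω) ∧
      (∀ᵐ ω ∂μ, M.HVA 0 ω =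
        M.q 0 ω - M.Q 0 ω - (M.Pbad 0 ω - M.P 0 ω) + M.D 0 ω + M.va (stopAt M.K M.τe) 0 ω) ∧
      (∀ᵐ ω ∂μ, -M.pnl k ω + (M.HVA k ω - M.HVA 0 ω) =
        -(stopAt M.Qflow M.τe k ω + stopAt M.Q M.τe k ω) + stopAt M.Pflow M.τe k ω + stopAt M.P M.τe k ω
          + (M.Q 0 ω - M.P 0 ω)
          + (M.D k ω + M.va (stopAt M.K M.τe) k ω)
          - (M.D 0 ω + M.va (stopAt M.K M.τe) 0 ω)) ∧
      (∀ᵐ ω ∂μ,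
        M.HVA (min (k + 1) M.T) ω - M.HVA k ω - (M.pnl (min (k + 1) M.T) ω - M.pnl k ω) =
          -(stopAt M.Qflow M.τe (k + 1) ω + stopAt M.Q M.τe (k + 1) ω)
            + stopAt M.Pflow M.τe (k + 1) ω + stopAt M.P M.τe (k + 1) ω
            + (stopAt M.Qflow M.τe k ω + stopAt M.Q M.τe k ω)
            - stopAt M.Pflow M.τe k ω - stopAt M.P M.τe k ω
            + (M.D (min (k + 1) M.T) ω + M.va (stopAt M.K M.τe) (min (k + 1) M.T) ω
              - M.D k ω - M.va (stopAt M.K M.τe) k ω))) ∧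
    -- the ingredients of the computation of the values in (ii)
    (∀ k ≤ M.T,
      (∀ᵐ ω ∂μ, M.Q k ω = fairFn M.γ M.T k (M.I k ω)) ∧
      (∀ᵐ ω ∂μ, M.I k ω = 1 →
        M.q k ω = traderFn (calibIntensity (normalPrice M.γ k) k) M.T k) ∧
      (∀ p ∈ indexSet M.T, ∀ p' ∈ indexSet M.T, ∀ᵐ ω ∂μ, ω ∈ M.part p →
        (μ⟦M.part p' | M.𝓕 k⟧) ω = transProb M.γ M.T k p p')) ∧
    -- (ii) and (iii): the values `pnlV k (l, m)` and `hvaV k (l, m)` on the partition events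
    ∃ pnlV hvaV : ℕ → ℕ × ℕ → ℝ,
      (∀ k ≤ M.T, ∀ p ∈ indexSet M.T,
        hvaV k p = pnlV k p - ∑ p' ∈ indexSet M.T, pnlV M.T p' * transProb M.γ M.T k p p') ∧
      (∀ k ≤ M.T, ∀ p ∈ indexSet M.T, ∀ᵐ ω ∂μ, ω ∈ M.part p →
        M.pnl k ω = pnlV k p ∧
        M.HVA k ω = hvaV k p ∧
        M.HVA k ω - M.HVA 0 ω - M.pnl k ω = hvaV k p - hvaV 0 p - pnlV k p ∧
        M.HVA (min (k + 1) M.T) ω - M.HVA k ω - (M.pnl (min (k + 1) M.T) ω - M.pnl k ω) =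
          hvaV (min (k + 1) M.T) p - hvaV k p - (pnlV (min (k + 1) M.T) p - pnlV k p)) ∧
      ∃ esV : ℕ → ℕ × ℕ → ℝ,
        (∀ k ≤ M.T, ∀ p ∈ indexSet M.T,
          esV k p = expectedShortfall α (∑ p' ∈ indexSet M.T,
            ENNReal.ofReal (transProb M.γ M.T k p p') •
              Measure.dirac (hvaV (min (k + 1) M.T) p' - hvaV k p'
                - (pnlV (min (k + 1) M.T) p' - pnlV k p')))) ∧
        (∀ k ≤ M.T, ∀ p ∈ indexSet M.T, ∀ᵐ ω ∂μ, ω ∈ M.part p →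
          M.condES α k (M.loss k) ω = esV k p) ∧
        (∀ᵐ ω ∂μ, M.KVA α r 0 ω =
          r * ∑ l ∈ Finset.range M.T, Real.exp (-r * (l : ℝ)) *
            ∑ p ∈ indexSet M.T, esV l p * μ.real (M.part p)) := by

  -- The value `0` is used outside the range of dates and indices, where nothing is claimed.
  choose pnlV hpnl using fun (k : ℕ) (p : ℕ × ℕ) =>
    show ∃ c, k ≤ M.T → p ∈ indexSet M.T → ∀ᵐ ω ∂μ, ω ∈ M.part p → M.pnl k ω = c by
      by_cases h : k ≤ M.T ∧ p ∈ indexSet M.T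
      · obtain ⟨c, hc⟩ := M.pnl_const hQ h.1 p h.2
        exact ⟨c, fun _ _ => hc⟩
      · exact ⟨0, fun h1 h2 => absurd ⟨h1, h2⟩ h⟩
  -- The values of the adjustment are defined by the formula to be proved; what needs proof is that
  -- the adjustment takes them.
  set hvaV : ℕ → ℕ × ℕ → ℝ := fun k p => pnlV k p
    - ∑ p' ∈ indexSet M.T, pnlV M.T p' * transProb M.γ M.T k p p' with hhvaV
  have hHVA : ∀ k ≤ M.T, ∀ p ∈ indexSet M.T, ∀ᵐ ω ∂μ, ω ∈ M.part p →
      M.HVA k ω = hvaV k p := by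
    intro k hk p hp
    have h := M.condExp_of_const_on_part (fun q hq => hpnl M.T q le_rfl hq) hk hp
    filter_upwards [h, hpnl k p hk hp] with ω e1 e2 hω
    rw [HVA, e1 hω, e2 hω]
  have hloss : ∀ k ≤ M.T, ∀ p ∈ indexSet M.T, ∀ᵐ ω ∂μ, ω ∈ M.part p →
      M.loss k ω = hvaV (min (k + 1) M.T) p - hvaV k p
        - (pnlV (min (k + 1) M.T) p - pnlV k p) := by
    intro k hk p hp
    filter_upwards [hHVA k hk p hp, hHVA _ (min_le_right (k + 1) M.T) p hp, hpnl k p hk hp,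
      hpnl _ p (min_le_right (k + 1) M.T) hp] with ω e1 e2 e3 e4 hω
    rw [loss, e1 hω, e2 hω, e3 hω, e4 hω]
  -- `mixture` unfolds to the sum of weighted Dirac masses in the statement, so the formula for the
  -- shortfall holds by definition.
  set esV : ℕ → ℕ × ℕ → ℝ := fun k p => expectedShortfall α (mixture M.γ M.T k p fun p' =>
    hvaV (min (k + 1) M.T) p' - hvaV k p' - (pnlV (min (k + 1) M.T) p' - pnlV k p')) with hesV
  have hES : ∀ k ≤ M.T, ∀ p ∈ indexSet M.T, ∀ᵐ ω ∂μ, ω ∈ M.part p →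
      M.condES α k (M.loss k) ω = esV k p := by
    intro k hk p hp
    filter_upwards [M.condDistrib_of_const_on_part (hloss k hk) hk hp] with ω e hω
    rw [condES, e hω]
  refine ⟨fun k hk => ⟨M.pnl_eq hQ, M.HVA_eq hQ hk, M.va_K hQ hk, M.HVA_zero hQ,
    M.HVA_sub_HVA_zero hQ hk, M.loss_eq hQ hk⟩, fun k hk => ⟨M.Q_eq hk, ?_,
    fun p hp q hq => M.condExp_part_eq hk hp hq⟩, pnlV, hvaV, fun _ _ _ _ => rfl, ?_, esV,
    fun _ _ _ _ => rfl, hES, M.KVA_zero α r esV fun l hl => hES l hl.le⟩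
  · filter_upwards [M.q_eq hk] with ω h1 h2
    rw [h1, h2, traderPrice_one]
    rfl
  · intro k hk p hp
    filter_upwards [hpnl k p hk hp, hHVA k hk p hp, hHVA 0 (Nat.zero_le _) p hp,
      hloss k hk p hp] with ω e1 e2 e3 e4 hω
    refine ⟨e1 hω, e2 hω, ?_, e4 hω⟩
    rw [e1 hω, e2 hω, e3 hω]
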